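/- **Setting.** Let $n\ge 0$ and let $\Psi^A$ be bosonic and fermionic fields of parities $|A|\in\mathbb Z/2$ on a space-time with coordinates $x^\mu$, $\mu=1,\dots,n$. *Local functions* are smooth functions of $x^\mu$ and of finitely many of the jet coordinates $\Psi^A_{(\mu)}$ (derivatives of the fields), polynomial in the odd ones. $\partial_\mu$ is the total derivative. Let $s$ be a BRST differential: an odd vector field with $s^2=0$, $sx^\mu=0$, $[s,\partial_\mu]=0$, determined by local functions $s\Psi^A=S^A[x,\Psi]$. *Trivial pairs for $s$, not necessarily algebraic,* are local functions $w^a,v^a$ of definite parity which, together with $x^\mu$ and further local functions $\varphi^i$ of definite parity, form a coordinate system on the jet space (so that passing to these coordinates is an isomorphism of superalgebras of functions) such that $sw^a=v^a$ and each $s\varphi^i$ is a function of $x^\mu$ and the $\varphi^j$ only. The splitting need not be compatible with the $\partial_\mu$. The pairs are called *algebraically* trivial if $w^a,v^a,\varphi^i$ are new fields, i.e. if $x^\mu$ and the total derivatives of all orders of $w^a,v^a,\varphi^i$ form the coordinate system, $sw^a=v^a$, and each $s\varphi^i$ is a local function of the fields $\varphi^j$ only. *Generalized auxiliary fields* of a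 theory with differential $s$ are fields $w^a,v^a$ for which there is an invertible local change of fields, possibly involving derivatives, to new fields $w^a,v^a,\varphi^i$ such that the equations $sw^a|_{w=0}=0$, understood as algebraic equations in the fields and their derivatives, are equivalent to $v^a=V^a[\varphi]$ for some local functions $V^a$ of the $\varphi^i$. (Equivalent means: the equations $w^a=0,\ sw^a=0$ and the equations $w^a=0,\ v^a-V^a[\varphi]=0$, together with all their total derivatives, generate the same ideal of local functions.) They are *local* if moreover there are local functions $\varphi_R^i$ such that $(w^a,sw^a)$ are algebraically trivial pairs for $s$ with remaining fields $\varphi_R^i$. *Parent theory.* Its fields are $\Psi^A_{(\lambda)[\nu]}$, where $(\lambda)=\lambda_1\dots\lambda_k$ is a symmetric and $[\nu]=\nu_1\dots\nu_l$ a skew-symmetric multi-index, of parity $|A|+l$; the jet coordinates are $\Psi^A_{(\mu)(\lambda)[\nu]}$. The odd vector fields $\partial^F/\partial\theta^\nu$ annihilate $x^\mu$ and act by $\frac{\partial^F}{\partial\theta^\nu}\Psi^A_{(\mu)(\lambda)|\nu_1\dots\nu_l}=(-1)^{|A|}\Psi^A_{(\mu)(\lambda)|\nu\nu_1\dots\nu_l}$.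 The odd vector fields $d^F$ and $\sigma^F$ annihilate $x^\mu$, commute with the $\partial_\mu$, and send $\Psi^A_{(\lambda)|\nu_1\dots\nu_l}$ to $(-1)^{|A|}\sum_{i=1}^l(-1)^{i-1}$ times the field obtained by removing the index $\nu_i$ from $[\nu]$ and adding it to the $x$-derivative indices, respectively to the $(\lambda)$ indices. For a local function $f$ of the original theory, $\bar f$ is obtained by replacing each $\Psi^A_{(\mu)}$ by the $\Psi^A_{(\lambda)}$ with the same multi-index. The odd vector field $\bar s$ annihilates $x^\mu$, satisfies $\bar s\,\bar f=\overline{sf}$ for every such $f$, commutes with the $\partial_\mu$, and anticommutes with the $\partial^F/\partial\theta^\nu$. The parent differential is $s^P=d^F-\sigma^F+\bar s$. **Proposition.** Let $(w^a,v^a)$ be trivial pairs for $s$, not necessarily algebraic, with remaining coordinates $\varphi^i$. Then all their descendants $$\frac{\partial^F}{\partial\theta^{\nu_1}}\cdots\frac{\partial^F}{\partial\theta^{\nu_k}}\,\bar w^a,\qquad \frac{\partial^F}{\partial\theta^{\nu_1}}\cdots\frac{\partial^F}{\partial\theta^{\nu_k}}\,\bar v^a,\qquad \nu_1<\dots<\nu_k,\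 0\le k\le n,$$ are local generalized auxiliary fields of the parent theory determined by $s^P$; the corresponding descendants of the $\varphi^i$ complete them to the new fields of the parent theory. -/

import Mathlib

open scoped TensorProduct ContDiff

namespace ParentBRST

/-! ## Functions on a superspace with possibly infinitely many coordinates -/

/-- Smooth real functions of the real variables `z e`, `e : E`, each of which depends on finitely
many of these variables only. -/
def SmoothFun (E : Type*) : Subalgebra ℝ ((E → ℝ) → ℝ) where
  carrier := {f | ∃ (T : Finset E) (g : (T → ℝ) → ℝ),
    ContDiff ℝ ∞ g ∧ ∀ z, f z = g (fun i => z i)}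
  mul_mem' := by
    classical
    rintro f₁ f₂ ⟨T₁, g₁, h₁, e₁⟩ ⟨T₂, g₂, h₂, e₂⟩
    refine ⟨T₁ ∪ T₂, fun y => g₁ (fun i => y ⟨i, Finset.mem_union_left _ i.2⟩) *
      g₂ (fun i => y ⟨i, Finset.mem_union_right _ i.2⟩), ?_, fun z => by simp [e₁, e₂]⟩
    exact (h₁.comp (contDiff_pi.2 fun i => contDiff_apply ℝ ℝ _)).mul
      (h₂.comp (contDiff_pi.2 fun i => contDiff_apply ℝ ℝ _))
  add_mem' := by
    classical
    rintro f₁ f₂ ⟨T₁, g₁, h₁, e₁⟩ ⟨T₂, g₂, h₂, e₂⟩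
    refine ⟨T₁ ∪ T₂, fun y => g₁ (fun i => y ⟨i, Finset.mem_union_left _ i.2⟩) +
      g₂ (fun i => y ⟨i, Finset.mem_union_right _ i.2⟩), ?_, fun z => by simp [e₁, e₂]⟩
    exact (h₁.comp (contDiff_pi.2 fun i => contDiff_apply ℝ ℝ _)).add
      (h₂.comp (contDiff_pi.2 fun i => contDiff_apply ℝ ℝ _))
  algebraMap_mem' r := ⟨∅, fun _ => r, contDiff_const, fun _ => rfl⟩

/-- The coordinate function `z ↦ z e`. -/
def SmoothFun.proj {E : Type*} (e : E) : SmoothFun E :=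
  ⟨fun z => z e, {e}, fun y => y ⟨e, Finset.mem_singleton_self e⟩, contDiff_apply ℝ ℝ _,
    fun _ => rfl⟩

/-- `f ↦ (z ↦ f (z ∘ r))`: rename the variables along `r`. -/
def SmoothFun.rename {E E' : Type*} (r : E → E') : SmoothFun E →ₐ[ℝ] SmoothFun E' where
  toFun f := ⟨fun z => f.1 (z ∘ r), by
    classical
    obtain ⟨T, g, hg, e⟩ := f.2
    refine ⟨T.image r, fun y => g (fun i => y ⟨r i, Finset.mem_image_of_mem r i.2⟩), ?_,
      fun z => by simp [e]⟩
    exact hg.comp (contDiff_pi.2 fun i => contDiff_apply ℝ ℝ _)⟩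
  map_one' := rfl
  map_mul' _ _ := rfl
  map_zero' := rfl
  map_add' _ _ := rfl
  commutes' _ := rfl

open Classical in
theorem SmoothFun.differentiable_update {E : Type*} (f : SmoothFun E) (z : E → ℝ) (e : E) :
    Differentiable ℝ (fun t : ℝ => f.1 (Function.update z e t)) := by
  obtain ⟨T, g, hg, h⟩ := f.2
  simp only [h]
  refine (hg.differentiable (by simp)).comp (differentiable_pi.2 fun i => ?_)
  by_cases hi : (i : E) = e
  · simp only [hi, Function.update_self]; exact differentiable_id
  · simp only [Function.update_of_ne hi]; exact differentiable_const _

open Classical in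
/-- The partial derivative with respect to the variable `z e`. -/
noncomputable def SmoothFun.pderiv {E : Type*} (e : E) : SmoothFun E →ₗ[ℝ] SmoothFun E where
  toFun f := ⟨fun z => deriv (fun t : ℝ => f.1 (Function.update z e t)) (z e), by
    obtain ⟨T, g, hg, h⟩ := f.2
    by_cases he : e ∈ T
    · refine ⟨T, fun y => fderiv ℝ g y (Pi.single ⟨e, he⟩ 1), ?_, fun z => ?_⟩
      · exact (hg.fderiv_right (m := ∞) (by simp)).clm_apply contDiff_const
      · simp only [h]
        have h1 : HasDerivAt (fun t : ℝ => (fun i : T => Function.update z e t i))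
            (Pi.single ⟨e, he⟩ 1) (z e) := by
          rw [hasDerivAt_pi]
          intro i
          by_cases hi : i = ⟨e, he⟩
          · subst hi; simpa using hasDerivAt_id' (z e)
          · have : (i : E) ≠ e := fun h' => hi (Subtype.ext h')
            simp only [Function.update_of_ne this, Pi.single_eq_of_ne hi]
            exact hasDerivAt_const _ _
        have h2 := (hg.differentiable (by simp)
          (fun i : T => Function.update z e (z e) i)).hasFDerivAt.comp_hasDerivAt (z e) h1
        simpa [Function.comp_def] using h2.deriv
    · refine ⟨∅, fun _ => 0, contDiff_const, fun z => ?_⟩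
      have : ∀ (t : ℝ) (i : T), Function.update z e t i = z i := fun t i =>
        Function.update_of_ne (fun h' => he (by simpa [h'] using i.2)) _ _
      simp [h, this]⟩
  map_add' f g := by
    ext z
    exact deriv_add (differentiable_update f z e _)
      (differentiable_update g z e _)
  map_smul' c f := by
    ext z
    exact deriv_const_mul c (differentiable_update f z e _)

theorem SmoothFun.finite_pderiv {E : Type*} (f : SmoothFun E) :
    {e | SmoothFun.pderiv e f ≠ 0}.Finite := by
  classical
  obtain ⟨T, g, hg, h⟩ := f.2
  refine T.finite_toSet.subset fun e he => ?_
  by_contra hT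
  refine he (Subtype.ext (funext fun z => ?_))
  have : ∀ (t : ℝ) (i : T), Function.update z e t i = z i := fun t i =>
    Function.update_of_ne (fun h' => hT (by simpa [h'] using i.2)) _ _
  simp [SmoothFun.pderiv, h, this]

variable {K L : Type*}

/-- The even (commuting) coordinates, for a Grassmann parity `p`. -/
abbrev EvenIdx (p : K → ZMod 2) : Type _ := {k : K // p k = 0}

/-- The odd (anticommuting) coordinates. -/
abbrev OddIdx (p : K → ZMod 2) : Type _ := {k : K // ¬ p k = 0}

/-- The Grassmann algebra on the odd coordinates. -/
abbrev Grassmann (p : K → ZMod 2) : Type _ := ExteriorAlgebra ℝ (OddIdx p →₀ ℝ)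

/-- The supercommutative algebra of smooth functions in the even coordinates with values in the
Grassmann algebra on the odd coordinates. -/
abbrev SuperFun (p : K → ZMod 2) : Type _ := SmoothFun (EvenIdx p) ⊗[ℝ] Grassmann p

/-- The coordinate `k` as a function. -/
noncomputable def coord (p : K → ZMod 2) (k : K) : SuperFun p :=
  if h : p k = 0 then SmoothFun.proj ⟨k, h⟩ ⊗ₜ 1
  else 1 ⊗ₜ ExteriorAlgebra.ι ℝ (Finsupp.single ⟨k, h⟩ 1)

/-- The left partial derivative with respect to the coordinate `k`. -/
noncomputable def pd (p : K → ZMod 2) (k : K) : SuperFun p →ₗ[ℝ] SuperFun p :=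
  if h : p k = 0 then TensorProduct.map (SmoothFun.pderiv ⟨k, h⟩) LinearMap.id
  else TensorProduct.map LinearMap.id
    (CliffordAlgebra.contractLeft (Q := (0 : QuadraticForm ℝ (OddIdx p →₀ ℝ)))
      (Finsupp.lapply ⟨k, h⟩))

/-- The parity involution: `f ↦ f` on even functions, `f ↦ -f` on odd functions. -/
noncomputable def parityInv (p : K → ZMod 2) : SuperFun p →ₐ[ℝ] SuperFun p :=
  Algebra.TensorProduct.map (AlgHom.id ℝ _)
    (CliffordAlgebra.involute (Q := (0 : QuadraticForm ℝ (OddIdx p →₀ ℝ))))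

/-- The sign `(-1) ^ ε`. -/
def sgn (ε : ZMod 2) : ℝ := if ε = 0 then 1 else -1

/-- `f` is homogeneous of parity `ε`. -/
def HasParity {p : K → ZMod 2} (ε : ZMod 2) (f : SuperFun p) : Prop :=
  parityInv p f = sgn ε • f

theorem finite_contractLeft {O : Type*} (a : ExteriorAlgebra ℝ (O →₀ ℝ)) :
    {o | CliffordAlgebra.contractLeft (Q := (0 : QuadraticForm ℝ (O →₀ ℝ)))
      (Finsupp.lapply o) a ≠ 0}.Finite := by
  classical
  induction a using CliffordAlgebra.left_induction with
  | algebraMap r => simp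
  | add x y hx hy =>
    refine (hx.union hy).subset fun o ho => ?_
    by_contra hc
    simp only [Set.mem_union, Set.mem_ofPred_eq, not_or, not_not] at hc
    exact ho (by rw [map_add, hc.1, hc.2, add_zero])
  | ι_mul x m hx =>
    refine (hx.union m.support.finite_toSet).subset fun o ho => ?_
    by_contra hc
    simp only [Set.mem_union, Set.mem_ofPred_eq, not_or, not_not, Finset.mem_coe,
      Finsupp.mem_support_iff] at hc
    refine ho ?_
    rw [CliffordAlgebra.contractLeft_ι_mul, hc.1]
    simp [hc.2]

theorem finite_pd (p : K → ZMod 2) (f : SuperFun p) : {k | pd p k f ≠ 0}.Finite := by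
  classical
  induction f using TensorProduct.induction_on with
  | zero => simp
  | add x y hx hy =>
    refine (hx.union hy).subset fun o ho => ?_
    by_contra hc
    simp only [Set.mem_union, Set.mem_ofPred_eq, not_or, not_not] at hc
    exact ho (by rw [map_add, hc.1, hc.2, add_zero])
  | tmul g a =>
    refine (((SmoothFun.finite_pderiv g).image Subtype.val).union
      ((finite_contractLeft a).image Subtype.val)).subset fun k hk => ?_
    by_contra hc
    simp only [Set.mem_union, Set.mem_image, Set.mem_ofPred_eq, not_or, not_exists,
      not_and] at hc
    refine hk ?_
    by_cases h : p k = 0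
    · have := hc.1 ⟨k, h⟩
      simp only [not_true_eq_false, imp_false, not_not] at this
      simp [pd, h, this]
    · have := hc.2 ⟨k, h⟩
      simp only [not_true_eq_false, imp_false, not_not] at this
      simp [pd, h, this]

/-- The vector field `∑ₖ Xₖ ∂/∂k`, acting from the left. -/
noncomputable def vectorField {p : K → ZMod 2} (X : K → SuperFun p) :
    SuperFun p →ₗ[ℝ] SuperFun p where
  toFun f := ∑ᶠ k, X k * pd p k f
  map_add' f g := by
    have hf : ∀ f : SuperFun p, (Function.support fun k => X k * pd p k f).Finite := fun f =>
      (finite_pd p f).subset fun k hk h0 => hk (by simp [h0])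
    simp only [map_add, mul_add]
    exact finsum_add_distrib (hf f) (hf g)
  map_smul' c f := by
    simp only [map_smul, mul_smul_comm, RingHom.id_apply]
    refine (smul_finsum' c ?_).symm
    exact (finite_pd p f).subset fun k hk h0 => hk (by simp [h0])

/-- Rename the coordinates along a parity preserving map `r`. -/
noncomputable def rename {p : K → ZMod 2} {q : L → ZMod 2} (r : K → L)
    (hr : ∀ k, q (r k) = p k) : SuperFun p →ₐ[ℝ] SuperFun q :=
  Algebra.TensorProduct.map
    (SmoothFun.rename fun k : EvenIdx p => (⟨r k, (hr k).trans k.2⟩ : EvenIdx q))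
    (ExteriorAlgebra.map (Finsupp.lmapDomain ℝ ℝ
      fun k : OddIdx p => (⟨r k, fun h => k.2 ((hr k).symm.trans h)⟩ : OddIdx q)))

/-- The functions `u l` on the superspace with coordinates `K` form a new coordinate system, with
parities `q`: `Φ`, which expresses functions of the new coordinates through the old ones, is an
isomorphism of superalgebras. -/
structure IsCoordChange {p : K → ZMod 2} {q : L → ZMod 2} (u : L → SuperFun p)
    (Φ : SuperFun q ≃ₐ[ℝ] SuperFun p) : Prop where
  map_parityInv : ∀ f, Φ (parityInv q f) = parityInv p (Φ f)
  map_coord : ∀ l, Φ (coord q l) = u l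

/-! ## Jet space, total derivatives, evolutionary differentials -/

section Jets

variable {F G : Type*} {n : ℕ}

/-- Coordinates of jet space: `inl μ` is `x^μ`; `inr (A, m)` is the derivative of the field `A`
that involves `m μ` derivatives with respect to `x^μ`, for each `μ`. -/
abbrev Jet (n : ℕ) (F : Type*) : Type _ := Fin n ⊕ F × (Fin n → ℕ)

/-- The parities of the jet coordinates, from the parities of the fields. -/
def jetParity (n : ℕ) (p : F → ZMod 2) : Jet n F → ZMod 2 :=
  Sum.elim (fun _ => 0) (fun k => p k.1)

/-- Local functions of the fields `F`. -/
abbrev LocalFun (n : ℕ) (p : F → ZMod 2) : Type _ := SuperFun (jetParity n p)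

/-- The base coordinate `x^μ`. -/
noncomputable abbrev xCoord (p : F → ZMod 2) (μ : Fin n) : LocalFun n p :=
  coord (jetParity n p) (Sum.inl μ)

/-- The jet coordinate of the field `A` with multi-index `m`. -/
noncomputable abbrev jetCoord (p : F → ZMod 2) (A : F) (m : Fin n → ℕ) : LocalFun n p :=
  coord (jetParity n p) (Sum.inr (A, m))

/-- The total derivative `∂_μ`. -/
noncomputable def totalD (p : F → ZMod 2) (μ : Fin n) : Module.End ℝ (LocalFun n p) :=
  vectorField (Sum.elim (fun ν => if ν = μ then 1 else 0)
    (fun k => jetCoord p k.1 (k.2 + Pi.single μ 1)))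

/-- The iterated total derivative with multi-index `m`. -/
noncomputable def totalDs (p : F → ZMod 2) (m : Fin n → ℕ) : Module.End ℝ (LocalFun n p) :=
  ((List.finRange n).map fun μ => totalD p μ ^ m μ).prod

/-- The vector field on jet space that sends the field `A` to `S A`, annihilates the `x^μ`, and is
prolonged to the derivatives of the fields so as to commute with the total derivatives. -/
noncomputable def evol {p : F → ZMod 2} (S : F → LocalFun n p) : Module.End ℝ (LocalFun n p) :=
  vectorField (Sum.elim (fun _ => 0) (fun k => totalDs p k.2 (S k.1)))

/-- `evol S` is a BRST differential: an odd vector field that squares to zero. -/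
structure IsBRST {p : F → ZMod 2} (S : F → LocalFun n p) : Prop where
  odd : ∀ A, HasParity (p A + 1) (S A)
  nilpotent : ∀ f, evol S (evol S f) = 0

/-- An invertible local change of fields, possibly involving derivatives, to the new fields
`u b`: the total derivatives of all orders of the `u b`, with the `x^μ`, are new coordinates on
jet space. -/
def IsFieldChange {p : F → ZMod 2} {q : G → ZMod 2} (u : G → LocalFun n p)
    (Φ : LocalFun n q ≃ₐ[ℝ] LocalFun n p) : Prop :=
  IsCoordChange (Sum.elim (xCoord p) (fun k => totalDs p k.2 (u k.1))) Φ

/-! ## Trivial pairs and generalized auxiliary fields -/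

variable {W R : Type*}

/-- Parities of variables `w^a, v^a, φ^i`, with `v^a` of parity opposite to `w^a`. -/
def splitParity (pw : W → ZMod 2) (pφ : R → ZMod 2) : W ⊕ W ⊕ R → ZMod 2 :=
  Sum.elim pw (Sum.elim (fun a => pw a + 1) pφ)

/-- Parities of the coordinates `x^μ, w^a, v^a, φ^i`. -/
def pairParity (n : ℕ) (pw : W → ZMod 2) (pφ : R → ZMod 2) : Fin n ⊕ W ⊕ W ⊕ R → ZMod 2 :=
  Sum.elim (fun _ => 0) (splitParity pw pφ)

/-- Parities of the coordinates `x^μ, φ^i`. -/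
def restParity (n : ℕ) (pφ : R → ZMod 2) : Fin n ⊕ R → ZMod 2 :=
  Sum.elim (fun _ => 0) pφ

/-- A function of the `x^μ, φ^i`, viewed as a function of the `x^μ, w^a, v^a, φ^i`. -/
noncomputable def inclRest (n : ℕ) (pw : W → ZMod 2) (pφ : R → ZMod 2) :
    SuperFun (restParity n pφ) →ₐ[ℝ] SuperFun (pairParity n pw pφ) :=
  rename (Sum.map id (fun i => Sum.inr (Sum.inr i))) (by rintro (μ | i) <;> rfl)

/-- A local function of the fields `φ^i`, viewed as one of the fields `w^a, v^a, φ^i`. -/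
noncomputable def inclRestJet (n : ℕ) (pw : W → ZMod 2) (pφ : R → ZMod 2) :
    LocalFun n pφ →ₐ[ℝ] LocalFun n (splitParity pw pφ) :=
  rename (Sum.map id (fun k => (Sum.inr (Sum.inr k.1), k.2))) (by rintro (μ | k) <;> rfl)

/-- `(w^a, v^a)` are trivial pairs for `s = evol S`, with remaining coordinates `φ^i`, which are
not necessarily algebraic: the local functions `w^a, v^a, φ^i`, with the `x^μ`, are coordinates on
jet space such that `s w^a = v^a` and `s φ^i` is a function of the `x^μ, φ^j` only. Nothing is
required of the total derivatives of the `w^a, v^a, φ^i`. -/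
def IsTrivialPairs {p : F → ZMod 2} (S : F → LocalFun n p) (pw : W → ZMod 2) (pφ : R → ZMod 2)
    (w v : W → LocalFun n p) (φ : R → LocalFun n p) : Prop :=
  ∃ Φ : SuperFun (pairParity n pw pφ) ≃ₐ[ℝ] LocalFun n p,
    IsCoordChange (Sum.elim (xCoord p) (Sum.elim w (Sum.elim v φ))) Φ ∧
    (∀ a, evol S (w a) = v a) ∧
    ∀ i, ∃ g, evol S (φ i) = Φ (inclRest n pw pφ g)

/-- `(w^a, v^a)` are algebraically trivial pairs for `s = evol S`, with remaining fields `φ^i`: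
the same, for a splitting of the fields that respects the total derivatives. -/
def IsAlgTrivialPairs {p : F → ZMod 2} (S : F → LocalFun n p) (pw : W → ZMod 2)
    (pφ : R → ZMod 2) (w v : W → LocalFun n p) (φ : R → LocalFun n p) : Prop :=
  ∃ Φ : LocalFun n (splitParity pw pφ) ≃ₐ[ℝ] LocalFun n p,
    IsFieldChange (Sum.elim w (Sum.elim v φ)) Φ ∧
    (∀ a, evol S (w a) = v a) ∧
    ∀ i, ∃ g, evol S (φ i) = Φ (inclRestJet n pw pφ g)

/-- The ideal of the equations `e a = 0`, `a : W`, and all their total derivatives. -/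
noncomputable def eqIdeal {p : F → ZMod 2} (e : W → LocalFun n p) : Ideal (LocalFun n p) :=
  Ideal.span (Set.range fun k : W × (Fin n → ℕ) => totalDs p k.2 (e k.1))

/-- `(w^a, v^a)` are generalized auxiliary fields for `s = evol S`, with remaining fields `φ^i`:
an invertible local change of fields splits the fields into `w^a, v^a, φ^i`, and the equations
`s w^a = 0` at `w^a = 0` are equivalent, as algebraic equations in the fields and their
derivatives, to `v^a = V^a[φ]` for some local functions `V^a` of the `φ^i`. -/
def IsGenAux {p : F → ZMod 2} (S : F → LocalFun n p) (pw : W → ZMod 2)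
    (pφ : R → ZMod 2) (w v : W → LocalFun n p) (φ : R → LocalFun n p) : Prop :=
  ∃ Φ : LocalFun n (splitParity pw pφ) ≃ₐ[ℝ] LocalFun n p,
    IsFieldChange (Sum.elim w (Sum.elim v φ)) Φ ∧
    ∃ V : W → LocalFun n pφ, (∀ a, HasParity (pw a + 1) (V a)) ∧
      eqIdeal w ⊔ eqIdeal (fun a => evol S (w a)) =
        eqIdeal w ⊔ eqIdeal (fun a => v a - Φ (inclRestJet n pw pφ (V a)))

/-- Local generalized auxiliary fields: the `w^a` and `s w^a` moreover decouple within the space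
of local functions, i.e. some local functions `φR^i` complete them to new fields such that
`s φR^i` depends on the `φR^j` only. -/
def IsLocalGenAux {p : F → ZMod 2} (S : F → LocalFun n p) (pw : W → ZMod 2)
    (pφ : R → ZMod 2) (w v : W → LocalFun n p) (φ : R → LocalFun n p) : Prop :=
  IsGenAux S pw pφ w v φ ∧
    ∃ φR : R → LocalFun n p, IsAlgTrivialPairs S pw pφ w (fun a => evol S (w a)) φR

/-! ## The parent theory -/

/-- The fields of the parent theory: `(A, l, N)` is `Ψ^A_{(λ)[ν]}`, where `l` is the symmetric
multi-index of `y`-derivatives and `N = {ν₁ < ⋯ < ν_k}` the skew-symmetric multi-index. -/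
abbrev ParentField (n : ℕ) (F : Type*) : Type _ := F × (Fin n → ℕ) × Finset (Fin n)

/-- Each index of the skew-symmetric multi-index flips the parity. -/
def parentParity (n : ℕ) (p : F → ZMod 2) : ParentField n F → ZMod 2 :=
  fun B => p B.1 + (B.2.2.card : ZMod 2)

/-- The sign that moves the index `ν` in front of the increasing sequence `N`. -/
def idxSign (N : Finset (Fin n)) (ν : Fin n) : ℝ := (-1) ^ (N.filter (· < ν)).card

/-- Replace the `x`-derivatives of the original fields by the corresponding `y`-derivatives. -/
noncomputable def bar (p : F → ZMod 2) : LocalFun n p →ₐ[ℝ] LocalFun n (parentParity n p) :=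
  rename (Sum.map id (fun k => ((k.1, k.2, ∅), 0)))
    (by rintro (μ | k) <;> simp [jetParity, parentParity])

/-- The odd vector field `∂^F/∂θ^ν`: it sends `Ψ^A_{(μ)(λ)|ν₁…ν_k}` to
`(-1)^{|A|} Ψ^A_{(μ)(λ)|ν ν₁…ν_k}` and annihilates the `x^μ`. -/
noncomputable def thetaD (p : F → ZMod 2) (ν : Fin n) :
    Module.End ℝ (LocalFun n (parentParity n p)) :=
  vectorField (Sum.elim (fun _ => 0) fun k =>
    if ν ∈ k.1.2.2 then 0
    else (sgn (p k.1.1) * idxSign k.1.2.2 ν) •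
      jetCoord (parentParity n p) (k.1.1, k.1.2.1, insert ν k.1.2.2) k.2)

/-- `∂^F/∂θ^{ν₁} ⋯ ∂^F/∂θ^{ν_k}` for `N = {ν₁ < ⋯ < ν_k}`. -/
noncomputable def thetaDs (p : F → ZMod 2) (N : Finset (Fin n)) :
    Module.End ℝ (LocalFun n (parentParity n p)) :=
  ((N.sort (· ≤ ·)).map (thetaD p)).prod

/-- `d^F` on the parent fields: an index of `N` becomes an `x`-derivative. -/
noncomputable def dF (p : F → ZMod 2) (B : ParentField n F) : LocalFun n (parentParity n p) :=
  ∑ ν ∈ B.2.2, (sgn (p B.1) * idxSign B.2.2 ν) •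
    jetCoord (parentParity n p) (B.1, B.2.1, B.2.2.erase ν) (Pi.single ν 1)

/-- `σ^F` on the parent fields: an index of `N` becomes a `y`-derivative. -/
noncomputable def sigmaF (p : F → ZMod 2) (B : ParentField n F) :
    LocalFun n (parentParity n p) :=
  ∑ ν ∈ B.2.2, (sgn (p B.1) * idxSign B.2.2 ν) •
    jetCoord (parentParity n p) (B.1, B.2.1 + Pi.single ν 1, B.2.2.erase ν) 0

/-- `s̄` on the parent fields. On `Ψ^A_{(λ)}` it is `s` with `x`-derivatives replaced by
`y`-derivatives. As `∂^F/∂θ^{ν₁} ⋯ ∂^F/∂θ^{ν_k}` sends `Ψ^A_{(λ)}` to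
`(-1)^{k|A|} Ψ^A_{(λ)|ν₁…ν_k}`, the sign below is the one for which `s̄` anticommutes with the
`∂^F/∂θ^ν`. -/
noncomputable def sBar {p : F → ZMod 2} (S : F → LocalFun n p) (B : ParentField n F) :
    LocalFun n (parentParity n p) :=
  sgn ((B.2.2.card : ZMod 2) * (p B.1 + 1)) •
    thetaDs p B.2.2 (bar p (totalDs p B.2.1 (S B.1)))

/-- The parent differential `s^P = d^F - σ^F + s̄` is `evol (parentS S)`. -/
noncomputable def parentS {p : F → ZMod 2} (S : F → LocalFun n p) (B : ParentField n F) :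
    LocalFun n (parentParity n p) :=
  dF p B - sigmaF p B + sBar S B

/-- The `∂^F/∂θ`-descendants, in the parent theory, of the local functions `f a` of the original
theory. -/
noncomputable def descendant {p : F → ZMod 2} (f : W → LocalFun n p)
    (k : W × Finset (Fin n)) : LocalFun n (parentParity n p) :=
  thetaDs p k.2 (bar p (f k.1))

/-- Parities of the descendants. -/
def descParity (n : ℕ) (q : W → ZMod 2) : W × Finset (Fin n) → ZMod 2 :=
  fun k => q k.1 + (k.2.card : ZMod 2)

end Jets

end ParentBRST

/-! The variables `Ψ^A_{(λ)}`, which replace the jet coordinates of the original theory, are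
independent fields of the parent theory. A coordinate system `w, v, φ` on the original jet space,
however badly it behaves under total derivatives, therefore becomes under `bar` a change of fields
without derivatives. The `Ψ^A_{(λ)}` are the lowest components of superfields, and an isomorphism of
the functions of the lowest components prolongs to all components by commuting with `∂/∂θ^ν` and
`∂_μ` (`Superfields.exists_prolong_fieldChange`). Hence the descendants are new fields.

Filter the fields by rank, the number of `θ`-indices. The anticommutator of `s^P` with `∂/∂θ^ν` is
the difference of the `x^ν`- and the `y^ν`-derivative; `s̄` drops out of it (`thetaShift_jetCoord`),
and it does not raise the rank. So, moving `s^P` through the `∂/∂θ`, the descendant of `f` is mapped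
to `(-1)^k` times the same descendant of `s f`, `k` being the number of `θ`-derivatives, plus terms
of rank below `k` (`parent_thetaDs_bar`). The same anticommutator reduces nilpotency of `s^P` to the
lowest components (`parent_nilpotent`).

What remains concerns any differential with `s w = c v` and `s φ` a function of the `φ`, both up to
lower rank (`isLocalGenAux_of_rank`). By triangularity `w, s w, φ` are again fields, so that `s w =
0` at `w = 0` can be solved for `v`. To decouple them (`exists_decoupled`), rename `s w` to `v`,
write `Q` for the differential, and put `ρ = w ∂/∂v`, `L = Qρ + ρQ`. Then `L` commutes with `Q`,
preserves `w` and `v`, and maps each `φ` to functions of lower rank. If corrected fields satisfy `L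
φ' = 0`, then `L` is the Euler vector field of the `w, v` in the coordinates `w, v, φ'`, and `L Q φ'
= 0` says that `Q φ'` is free of `w` and `v`. The corrections are found by induction on the rank: `L
φ = ρ Q φ` vanishes at `w = 0` and involves only fields of lower rank, on whose functions `L` is
already an Euler vector field, hence can be inverted.

The calculus used is that of superfunctions in infinitely many variables: even homomorphisms and
superderivations are determined by the coordinates (`IsEven.ext`, `IsSDer.ext`), the values of a
homomorphism on them are arbitrary up to parity (`superSubst`), and an Euler vector field has the
expected image and kernel (`exists_eulerField_eq`, `restrictTo_of_eulerField_eq_zero`). -/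

namespace ParentBRST

/-! ## The Grassmann algebra and supercommutativity -/

section Grassmann

variable {O : Type*}

/-- The generators of the Grassmann algebra. -/
noncomputable def gen (o : O) : ExteriorAlgebra ℝ (O →₀ ℝ) :=
  ExteriorAlgebra.ι ℝ (Finsupp.single o 1)

/-- Products of generators. -/
noncomputable def mono (l : List O) : ExteriorAlgebra ℝ (O →₀ ℝ) := (l.map gen).prod

/-- The parity involution of the Grassmann algebra. -/
noncomputable abbrev invol : ExteriorAlgebra ℝ (O →₀ ℝ) →ₐ[ℝ] ExteriorAlgebra ℝ (O →₀ ℝ) :=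
  CliffordAlgebra.involute (Q := (0 : QuadraticForm ℝ (O →₀ ℝ)))

@[simp] theorem mono_nil : mono ([] : List O) = 1 := rfl

@[simp] theorem mono_cons (o : O) (l : List O) : mono (o :: l) = gen o * mono l := by
  simp [mono]

theorem invol_ι (m : O →₀ ℝ) :
    invol (ExteriorAlgebra.ι ℝ m) = -ExteriorAlgebra.ι ℝ m :=
  CliffordAlgebra.involute_ι m

@[simp] theorem invol_gen (o : O) : invol (gen o) = -gen o := invol_ι _

theorem invol_mono (l : List O) : invol (mono l) = (-1 : ℝ) ^ l.length • mono l := by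
  induction l with
  | nil => simp
  | cons o l ih =>
    rw [mono_cons, map_mul, ih, invol_gen, List.length_cons, pow_succ]
    simp

theorem ι_mul_comm (m : O →₀ ℝ) (x : ExteriorAlgebra ℝ (O →₀ ℝ)) :
    ExteriorAlgebra.ι ℝ m * x = invol x * ExteriorAlgebra.ι ℝ m := by
  induction x using CliffordAlgebra.left_induction with
  | algebraMap r => rw [AlgHom.commutes, Algebra.commutes]
  | add x y hx hy => rw [mul_add, map_add, add_mul, hx, hy]
  | ι_mul x m' hx =>
    have h := ExteriorAlgebra.ι_add_mul_swap (R := ℝ) m m'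
    have h1 : ExteriorAlgebra.ι ℝ m * ExteriorAlgebra.ι ℝ m' =
        -(ExteriorAlgebra.ι ℝ m' * ExteriorAlgebra.ι ℝ m) := eq_neg_of_add_eq_zero_left h
    rw [map_mul]
    change ExteriorAlgebra.ι ℝ m * (ExteriorAlgebra.ι ℝ m' * x) =
      invol (ExteriorAlgebra.ι ℝ m') * invol x * _
    rw [invol_ι, ← mul_assoc, h1, neg_mul, mul_assoc, hx]
    simp [mul_assoc]

theorem mono_mul_comm (l : List O) (x : ExteriorAlgebra ℝ (O →₀ ℝ)) :
    mono l * x = (invol^[l.length] x) * mono l := by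
  induction l generalizing x with
  | nil => simp
  | cons o l ih =>
    rw [mono_cons, mul_assoc, ih, ← mul_assoc, gen, ι_mul_comm, List.length_cons,
      Function.iterate_succ_apply', mul_assoc]

theorem iterate_invol (k : ℕ) (x : ExteriorAlgebra ℝ (O →₀ ℝ)) :
    invol^[k] x = if Even k then x else invol x := by
  induction k with
  | zero => simp
  | succ k ih =>
    rw [Function.iterate_succ_apply', ih]
    simp only [Nat.even_add_one]
    by_cases h : Even k <;> simp [h]

/-- Moving the second copy of the first generator past the rest costs a sign and brings it next to
the first copy. -/
theorem mono_sq {l : List O} (hl : l ≠ []) : mono l * mono l = 0 := by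
  cases l with
  | nil => exact absurd rfl hl
  | cons o l =>
    have h0 : gen o * gen o = 0 := ExteriorAlgebra.ι_sq_zero _
    rw [mono_cons, mul_assoc, ← mul_assoc (mono l), mono_mul_comm, ← mul_assoc, ← mul_assoc,
      iterate_invol]
    split_ifs <;> simp [h0]

theorem span_mono : Submodule.span ℝ (Set.range (mono (O := O))) = ⊤ := by
  rw [eq_top_iff]
  intro a _
  induction a using CliffordAlgebra.left_induction with
  | algebraMap r =>
    rw [Algebra.algebraMap_eq_smul_one]
    exact Submodule.smul_mem _ _ (Submodule.subset_span ⟨[], rfl⟩)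
  | add x y hx hy => exact add_mem (hx trivial) (hy trivial)
  | ι_mul x m hx =>
    replace hx := hx trivial
    rename_i h0
    clear h0
    change ExteriorAlgebra.ι ℝ m * x ∈ _
    induction m using Finsupp.induction_linear with
    | zero => simp
    | add f g hf hg => rw [map_add, add_mul]; exact add_mem hf hg
    | single o c =>
      have hc : (Finsupp.single o c : O →₀ ℝ) = c • Finsupp.single o 1 := by simp
      rw [hc, map_smul, smul_mul_assoc]
      refine Submodule.smul_mem _ _ ?_
      induction hx using Submodule.span_induction with
      | mem x h =>
        obtain ⟨l, rfl⟩ := h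
        exact Submodule.subset_span ⟨o :: l, mono_cons o l⟩
      | zero => simp
      | add x y _ _ hx hy => rw [mul_add]; exact add_mem hx hy
      | smul r x _ hx => rw [mul_smul_comm]; exact Submodule.smul_mem _ _ hx

theorem augmentation_mono {l : List O} (hl : l ≠ []) :
    ExteriorAlgebra.algebraMapInv (R := ℝ) (mono l) = 0 := by
  cases l with
  | nil => exact absurd rfl hl
  | cons o l => simp [gen, ExteriorAlgebra.algebraMapInv]

theorem contractLeft_mul (d : Module.Dual ℝ (O →₀ ℝ)) (a b : ExteriorAlgebra ℝ (O →₀ ℝ)) :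
    CliffordAlgebra.contractLeft (Q := (0 : QuadraticForm ℝ (O →₀ ℝ))) d (a * b) =
      CliffordAlgebra.contractLeft (Q := (0 : QuadraticForm ℝ (O →₀ ℝ))) d a * b +
      invol a * CliffordAlgebra.contractLeft (Q := (0 : QuadraticForm ℝ (O →₀ ℝ))) d b := by
  induction a using CliffordAlgebra.left_induction with
  | algebraMap r =>
    rw [CliffordAlgebra.contractLeft_algebraMap_mul, CliffordAlgebra.contractLeft_algebraMap,
      AlgHom.commutes, zero_mul, zero_add]
  | add x y hx hy => rw [add_mul, map_add, hx, hy, map_add, map_add, add_mul, add_mul]; abel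
  | ι_mul x m hx =>
    rw [mul_assoc, CliffordAlgebra.contractLeft_ι_mul, hx, CliffordAlgebra.contractLeft_ι_mul,
      map_mul, CliffordAlgebra.involute_ι]
    simp only [mul_add, sub_mul, smul_mul_assoc, mul_assoc, neg_mul]
    abel

end Grassmann

/-! ### Parity, supercommutativity, the body, and evaluation at points. -/

section SuperAlgebra

variable {K L : Type*} {p : K → ZMod 2}

noncomputable instance : Ring (SuperFun p) := Algebra.TensorProduct.instRing

noncomputable instance : NonAssocRing (SuperFun p) := inferInstance

noncomputable instance : NonUnitalNonAssocRing (SuperFun p) := inferInstance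

noncomputable instance : AddCommGroup (SuperFun p) := Ring.toAddCommGroup

noncomputable instance : AddCommMonoid (SuperFun p) := inferInstance

noncomputable instance : Algebra ℝ (SuperFun p) := Algebra.TensorProduct.instAlgebra

noncomputable instance : Module ℝ (SuperFun p) := inferInstance

instance : IsScalarTower ℝ (SuperFun p) (SuperFun p) := inferInstance

instance : SMulCommClass ℝ (SuperFun p) (SuperFun p) := inferInstance

theorem SuperFun.mono_induction {P : SuperFun p → Prop} (zero : P 0)
    (tmul : ∀ f l, P (f ⊗ₜ mono l)) (add : ∀ f g, P f → P g → P (f + g)) (f : SuperFun p) :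
    P f := by
  induction f using TensorProduct.induction_on with
  | zero => exact zero
  | add x y hx hy => exact add _ _ hx hy
  | tmul g a =>
    have ha : a ∈ Submodule.span ℝ (Set.range (mono (O := OddIdx p))) := by simp [span_mono]
    induction ha using Submodule.span_induction generalizing g with
    | mem x h => obtain ⟨l, rfl⟩ := h; exact tmul _ _
    | zero => simpa using zero
    | add x y _ _ hx hy => rw [TensorProduct.tmul_add]; exact add _ _ (hx g) (hy g)
    | smul r x _ hx => rw [← TensorProduct.smul_tmul]; exact hx _

@[simp] theorem parityInv_tmul (f : SmoothFun (EvenIdx p)) (a : Grassmann p) :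
    parityInv p (f ⊗ₜ a) = f ⊗ₜ invol a := by
  simp [parityInv]

@[simp] theorem parityInv_parityInv (f : SuperFun p) : parityInv p (parityInv p f) = f := by
  induction f using TensorProduct.induction_on with
  | zero => simp
  | add x y hx hy => simp only [map_add, hx, hy]
  | tmul g a => simp

theorem parityInv_tmul_mono (f : SmoothFun (EvenIdx p)) (l : List (OddIdx p)) :
    parityInv p (f ⊗ₜ mono l) = (-1 : ℝ) ^ l.length • f ⊗ₜ mono l := by
  rw [parityInv_tmul, invol_mono, TensorProduct.tmul_smul]

/-- The `ε`-th power of the parity involution. -/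
noncomputable def twist (p : K → ZMod 2) (ε : ZMod 2) : SuperFun p →ₐ[ℝ] SuperFun p :=
  if ε = 0 then AlgHom.id ℝ _ else parityInv p

@[simp] theorem twist_zero (f : SuperFun p) : twist p 0 f = f := by simp [twist]

@[simp] theorem twist_one (f : SuperFun p) : twist p 1 f = parityInv p f := by simp [twist]

theorem zmod2_cases (ε : ZMod 2) : ε = 0 ∨ ε = 1 := by
  revert ε; decide

@[simp] theorem sgn_zero : sgn 0 = 1 := by simp [sgn]

@[simp] theorem sgn_one : sgn 1 = -1 := by simp [sgn]

theorem sgn_add (a b : ZMod 2) : sgn (a + b) = sgn a * sgn b := by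
  rcases zmod2_cases a with rfl | rfl <;> rcases zmod2_cases b with rfl | rfl <;>
    simp [show (1 + 1 : ZMod 2) = 0 from rfl]

@[simp] theorem sgn_mul_self (a : ZMod 2) : sgn a * sgn a = 1 := by
  rcases zmod2_cases a with rfl | rfl <;> simp

theorem zmod2_add_self (a : ZMod 2) : a + a = 0 := by revert a; decide

theorem HasParity.eq_zero_case {f : SuperFun p} :
    HasParity 0 f ↔ parityInv p f = f := by rw [HasParity, sgn_zero, one_smul]

theorem HasParity.eq_one_case {f : SuperFun p} :
    HasParity 1 f ↔ parityInv p f = -f := by rw [HasParity, sgn_one, neg_one_smul]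

theorem twist_of_hasParity {δ : ZMod 2} (ε : ZMod 2) {f : SuperFun p} (hf : HasParity δ f) :
    twist p ε f = sgn (ε * δ) • f := by
  rcases zmod2_cases ε with rfl | rfl
  · simp
  · rw [twist_one, one_mul]; exact hf

theorem twist_add (ε δ : ZMod 2) (f : SuperFun p) :
    twist p (ε + δ) f = twist p ε (twist p δ f) := by
  rcases zmod2_cases ε with rfl | rfl <;> rcases zmod2_cases δ with rfl | rfl <;>
    simp [show (1 + 1 : ZMod 2) = 0 from rfl]

theorem HasParity.zero (ε : ZMod 2) : HasParity ε (0 : SuperFun p) := by simp [HasParity]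

theorem HasParity.one : HasParity 0 (1 : SuperFun p) := by simp [HasParity]

theorem HasParity.add {ε : ZMod 2} {f g : SuperFun p} (hf : HasParity ε f) (hg : HasParity ε g) :
    HasParity ε (f + g) := by
  unfold HasParity at *; rw [map_add, hf, hg, smul_add]

theorem HasParity.neg {ε : ZMod 2} {f : SuperFun p} (hf : HasParity ε f) :
    HasParity ε (-f) := by
  unfold HasParity at *; rw [map_neg, hf, smul_neg]

theorem HasParity.sub {ε : ZMod 2} {f g : SuperFun p} (hf : HasParity ε f) (hg : HasParity ε g) :
    HasParity ε (f - g) := by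
  rw [sub_eq_add_neg]; exact hf.add hg.neg

theorem HasParity.smul {ε : ZMod 2} {f : SuperFun p} (c : ℝ) (hf : HasParity ε f) :
    HasParity ε (c • f) := by
  unfold HasParity at *; rw [map_smul, hf, smul_comm]

theorem HasParity.sum {ι : Type*} {ε : ZMod 2} {f : ι → SuperFun p} (s : Finset ι)
    (hf : ∀ i ∈ s, HasParity ε (f i)) : HasParity ε (∑ i ∈ s, f i) := by
  unfold HasParity at *; rw [map_sum, Finset.smul_sum]; exact Finset.sum_congr rfl hf

theorem hasParity_parityInv {ε : ZMod 2} {f : SuperFun p} (hf : HasParity ε f) :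
    HasParity ε (parityInv p f) := by
  have h := hf
  unfold HasParity at h; rw [h]; exact hf.smul _

theorem hasParity_tmul_one (f : SmoothFun (EvenIdx p)) :
    HasParity 0 (f ⊗ₜ 1 : SuperFun p) := by
  simp [HasParity]

theorem hasParity_coord (k : K) : HasParity (p k) (coord p k) := by
  unfold coord HasParity
  split_ifs with h
  · simp [h]
  · rw [(zmod2_cases (p k)).resolve_left h, parityInv_tmul, invol_ι, TensorProduct.tmul_neg,
      sgn_one, neg_one_smul]

/-- The sum is twice the even part of `u`, and products of an even number of generators are central.
Stating this for the even part of an arbitrary `u`, and likewise below for the odd part, lets the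
induction run over summands that are not homogeneous. -/
theorem add_parityInv_mul_comm (u f : SuperFun p) :
    (u + parityInv p u) * f = f * (u + parityInv p u) := by
  induction u using SuperFun.mono_induction with
  | zero => simp
  | add x y hx hy =>
    rw [map_add, add_add_add_comm, add_mul, hx, hy, ← mul_add]
  | tmul g l =>
    rw [parityInv_tmul_mono]
    rcases Nat.even_or_odd l.length with h | h
    · rw [h.neg_one_pow, one_smul, add_mul, mul_add]
      suffices g ⊗ₜ mono l * f = f * g ⊗ₜ mono l by rw [this]
      induction f using TensorProduct.induction_on with
      | zero => simp
      | add x y hx hy => rw [mul_add, hx, hy, add_mul]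
      | tmul f a =>
        simp only [Algebra.TensorProduct.tmul_mul_tmul, mono_mul_comm, iterate_invol, h, if_true,
          mul_comm g]
    · rw [h.neg_one_pow, neg_one_smul, add_neg_cancel, zero_mul, mul_zero]

theorem sub_parityInv_mul_comm (u f : SuperFun p) :
    (u - parityInv p u) * f = parityInv p f * (u - parityInv p u) := by
  induction u using SuperFun.mono_induction with
  | zero => simp
  | add x y hx hy =>
    rw [map_add, add_sub_add_comm, add_mul, hx, hy, mul_add (parityInv p f)]
  | tmul g l =>
    rw [parityInv_tmul_mono]
    rcases Nat.even_or_odd l.length with h | h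
    · rw [h.neg_one_pow, one_smul, sub_self, zero_mul, mul_zero]
    · rw [h.neg_one_pow, neg_one_smul, sub_neg_eq_add, add_mul, mul_add]
      suffices g ⊗ₜ mono l * f = parityInv p f * g ⊗ₜ mono l by rw [this]
      induction f using TensorProduct.induction_on with
      | zero => simp
      | add x y hx hy => rw [mul_add, hx, hy, map_add, add_mul]
      | tmul f a =>
        simp only [Algebra.TensorProduct.tmul_mul_tmul, mono_mul_comm, iterate_invol,
          Nat.not_even_iff_odd.2 h, if_false, mul_comm g, parityInv_tmul]

theorem HasParity.mul_comm {ε : ZMod 2} {u : SuperFun p} (hu : HasParity ε u) (f : SuperFun p) :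
    u * f = twist p ε f * u := by
  have h2 : (2 : ℝ) ≠ 0 := two_ne_zero
  rcases zmod2_cases ε with rfl | rfl
  · have h := add_parityInv_mul_comm u f
    rw [HasParity.eq_zero_case.1 hu, ← two_smul ℝ u, smul_mul_assoc, mul_smul_comm] at h
    rw [twist_zero]
    exact smul_right_injective _ h2 h
  · have h := sub_parityInv_mul_comm u f
    rw [HasParity.eq_one_case.1 hu, sub_neg_eq_add, ← two_smul ℝ u, smul_mul_assoc,
      mul_smul_comm] at h
    rw [twist_one]
    exact smul_right_injective _ h2 h

theorem HasParity.commute {u : SuperFun p} (hu : HasParity 0 u) (f : SuperFun p) :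
    Commute u f := by
  have := hu.mul_comm f
  rwa [twist_zero] at this

theorem HasParity.mul_self {u : SuperFun p} (hu : HasParity 1 u) : u * u = 0 := by
  have h := hu.mul_comm u
  rw [twist_one, HasParity.eq_one_case.1 hu, neg_mul] at h
  have h2 : (2 : ℝ) • (u * u) = 0 := by rw [two_smul]; nth_rewrite 1 [h]; exact neg_add_cancel _
  exact (smul_eq_zero.1 h2).resolve_left two_ne_zero

/-- The body of a superfunction: all odd coordinates are put to zero. -/
noncomputable def body (p : K → ZMod 2) : SuperFun p →ₐ[ℝ] SmoothFun (EvenIdx p) :=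
  Algebra.TensorProduct.lift (AlgHom.id ℝ _)
    ((Algebra.ofId ℝ _).comp ExteriorAlgebra.algebraMapInv) fun _ _ => Commute.all _ _

theorem body_tmul (f : SmoothFun (EvenIdx p)) (a : Grassmann p) :
    body p (f ⊗ₜ a) = ExteriorAlgebra.algebraMapInv a • f := by
  simp [body, Algebra.ofId_apply, Algebra.smul_def, mul_comm]

/-- The central elements of square zero. -/
def centralSqZero (A : Type*) [Ring A] : Set A := {q | (∀ a, Commute q a) ∧ q * q = 0}

/-- An even function minus its body is a sum of terms `f ⊗ mono l` with `l` of even positive length;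
each is central and has square zero. Again the induction is made for the even part of an arbitrary
function. -/
theorem HasParity.sub_body_mem {u : SuperFun p} (hu : HasParity 0 u) :
    u - body p u ⊗ₜ 1 ∈ AddSubmonoid.closure (centralSqZero (SuperFun p)) := by
  suffices h : ∀ u : SuperFun p, (1 / 2 : ℝ) • (u + parityInv p u) - body p u ⊗ₜ 1 ∈
      AddSubmonoid.closure (centralSqZero (SuperFun p)) by
    have := h u
    rwa [HasParity.eq_zero_case.1 hu, ← two_smul ℝ, smul_smul, one_div,
      inv_mul_cancel₀ two_ne_zero, one_smul] at this
  intro u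
  induction u using SuperFun.mono_induction with
  | zero => simp
  | add x y hx hy =>
    convert add_mem hx hy using 1
    simp only [map_add, smul_add, TensorProduct.add_tmul]; abel
  | tmul f l =>
    rw [parityInv_tmul_mono, body_tmul]
    by_cases hl : l = []
    · subst hl
      simp only [List.length_nil, pow_zero, one_smul, mono_nil, map_one, ← two_smul ℝ, smul_smul]
      simp
    · rw [augmentation_mono hl, zero_smul, TensorProduct.zero_tmul, sub_zero]
      rcases Nat.even_or_odd l.length with h | h
      · rw [h.neg_one_pow, one_smul, ← two_smul ℝ, smul_smul, one_div,
          inv_mul_cancel₀ two_ne_zero, one_smul]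
        refine AddSubmonoid.subset_closure ⟨HasParity.commute ?_, ?_⟩
        · rw [HasParity.eq_zero_case, parityInv_tmul_mono, h.neg_one_pow, one_smul]
        · rw [Algebra.TensorProduct.tmul_mul_tmul, mono_sq hl, TensorProduct.tmul_zero]
      · rw [h.neg_one_pow]; simp

theorem isNilpotent_of_mem_closure {A : Type*} [Ring A] {a : A}
    (ha : a ∈ AddSubmonoid.closure (centralSqZero A)) : IsNilpotent a := by
  suffices (∀ b, Commute a b) ∧ IsNilpotent a from this.2
  induction ha using AddSubmonoid.closure_induction with
  | mem x hx => exact ⟨hx.1, 2, by rw [pow_two, hx.2]⟩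
  | zero => exact ⟨fun b => Commute.zero_left b, IsNilpotent.zero⟩
  | add x y _ _ hx hy =>
    exact ⟨fun b => (hx.1 b).add_left (hy.1 b), (hx.1 y).isNilpotent_add hx.2 hy.2⟩

/-- Evaluation of the coefficients at a point. -/
noncomputable def evalAt (p : K → ZMod 2) (z : EvenIdx p → ℝ) : SuperFun p →ₐ[ℝ] Grassmann p :=
  Algebra.TensorProduct.lift
    ((Algebra.ofId ℝ _).comp ((Pi.evalAlgHom ℝ (fun _ : EvenIdx p → ℝ => ℝ) z).comp
      (SmoothFun (EvenIdx p)).val))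
    (AlgHom.id ℝ _) fun f a => by
      rw [AlgHom.comp_apply, Algebra.ofId_apply]; exact Algebra.commute_algebraMap_left _ _

theorem evalAt_tmul (z : EvenIdx p → ℝ) (f : SmoothFun (EvenIdx p)) (a : Grassmann p) :
    evalAt p z (f ⊗ₜ a) = f.1 z • a := by
  rw [evalAt, Algebra.TensorProduct.lift_tmul, Algebra.smul_def]
  rfl

/-- The coefficients with respect to a basis of the Grassmann algebra are ordinary functions,
determined by their values. -/
theorem eq_zero_of_evalAt {f : SuperFun p} (h : ∀ z, evalAt p z f = 0) : f = 0 := by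
  let b := Module.Basis.ofVectorSpace ℝ (Grassmann p)
  let B := Algebra.TensorProduct.basis (SmoothFun (EvenIdx p)) b
  have key : ∀ (f : SuperFun p) (z) (i), ((B.repr f) i).1 z = b.repr (evalAt p z f) i := by
    intro f z i
    induction f using TensorProduct.induction_on with
    | zero => simp
    | add x y hx hy =>
      rw [map_add, map_add, map_add, Finsupp.add_apply, Finsupp.add_apply, ← hx, ← hy]; rfl
    | tmul g a =>
      rw [evalAt_tmul, map_smul, Algebra.TensorProduct.basis_repr_tmul]
      simp [Finsupp.smul_apply]
  apply B.repr.injective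
  ext i : 1
  apply Subtype.ext
  funext z
  rw [key, h]
  simp

theorem ext_evalAt {f g : SuperFun p} (h : ∀ z, evalAt p z f = evalAt p z g) : f = g :=
  sub_eq_zero.1 (eq_zero_of_evalAt fun z => by rw [map_sub, h, sub_self])

end SuperAlgebra

/-! ## Parametric integrals of smooth functions -/

theorem hasFDerivAt_integral_param {V : Type*} [NormedAddCommGroup V] [NormedSpace ℝ V]
    [FiniteDimensional ℝ V] {h : ℝ × V → ℝ} (hh : ContDiff ℝ 1 h) (x : V) :
    HasFDerivAt (fun y => ∫ t in (0 : ℝ)..1, h (t, y))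
      (∫ t in (0 : ℝ)..1, (fderiv ℝ h (t, x)).comp (ContinuousLinearMap.inr ℝ ℝ V)) x := by
  have hc : Continuous (fun q : ℝ × V =>
      (fderiv ℝ h q).comp (ContinuousLinearMap.inr ℝ ℝ V)) :=
    (hh.continuous_fderiv one_ne_zero).clm_comp continuous_const
  -- A constant serves as the integrable bound: the continuous derivative is bounded on the compact
  -- product of `[0, 1]` with a closed ball. Finite dimension of `V` makes the ball compact.
  obtain ⟨C, hC⟩ := ((isCompact_Icc (a := (0 : ℝ)) (b := 1)).prod
    (isCompact_closedBall x 1)).exists_bound_of_continuousOn hc.continuousOn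
  refine (intervalIntegral.hasFDerivAt_integral_of_dominated_of_fderiv_le
    (F := fun y t => h (t, y))
    (F' := fun y t => (fderiv ℝ h (t, y)).comp (ContinuousLinearMap.inr ℝ ℝ V))
    (bound := fun _ => C) (Metric.ball_mem_nhds x one_pos) ?_ ?_ ?_ ?_ ?_ ?_)
  · exact Filter.Eventually.of_forall fun y =>
      (hh.continuous.comp (by fun_prop : Continuous fun t : ℝ => (t, y))).aestronglyMeasurable
  · exact (hh.continuous.comp (by fun_prop : Continuous fun t : ℝ => (t, x))).intervalIntegrable _ _
  · exact (hc.comp (by fun_prop : Continuous fun t : ℝ => (t, x))).aestronglyMeasurable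
  · refine Filter.Eventually.of_forall fun t ht y hy => hC (t, y) ⟨?_, ?_⟩
    · rw [Set.uIoc_of_le zero_le_one] at ht
      exact ⟨ht.1.le, ht.2⟩
    · exact Metric.ball_subset_closedBall hy
  · exact intervalIntegrable_const
  · refine Filter.Eventually.of_forall fun t _ y _ => ?_
    have h1 := (hh.differentiable one_ne_zero (t, y)).hasFDerivAt
    exact h1.comp y (hasFDerivAt_prodMk_right t y)

/-- Induction on the order of differentiability: a directional derivative of the integral is the
integral of a directional derivative of `h`, which is of one order less. -/
theorem contDiff_integral_param_nat {V : Type*} [NormedAddCommGroup V] [NormedSpace ℝ V]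
    [FiniteDimensional ℝ V] (n : ℕ) {h : ℝ × V → ℝ} (hh : ContDiff ℝ n h) :
    ContDiff ℝ n (fun y => ∫ t in (0 : ℝ)..1, h (t, y)) := by
  induction n generalizing h with
  | zero =>
    rw [Nat.cast_zero, contDiff_zero] at *
    exact intervalIntegral.continuous_parametric_intervalIntegral_of_continuous'
      (f := fun y t => h (t, y)) (hh.comp continuous_swap) 0 1
  | succ n ih =>
    have h1 : ContDiff ℝ 1 h := hh.of_le (by exact_mod_cast Nat.le_add_left 1 n)
    rw [Nat.cast_add, Nat.cast_one] at hh ⊢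
    rw [contDiff_succ_iff_fderiv_apply]
    refine ⟨fun x => (hasFDerivAt_integral_param h1 x).differentiableAt, by simp, fun v => ?_⟩
    have : (fun x => fderiv ℝ (fun y => ∫ t in (0 : ℝ)..1, h (t, y)) x v) =
        fun x => ∫ t in (0 : ℝ)..1, fderiv ℝ h (t, x) (0, v) := by
      funext x
      rw [(hasFDerivAt_integral_param h1 x).fderiv, ContinuousLinearMap.intervalIntegral_apply]
      · simp
      · exact (((h1.continuous_fderiv one_ne_zero).clm_comp continuous_const).comp
          (by fun_prop : Continuous fun t : ℝ => (t, x))).intervalIntegrable _ _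
    rw [this]
    exact ih (h := fun q => fderiv ℝ h q (0, v))
      ((hh.fderiv_right (m := n) le_rfl).clm_apply contDiff_const)

theorem contDiff_integral_param {V : Type*} [NormedAddCommGroup V] [NormedSpace ℝ V]
    [FiniteDimensional ℝ V] {h : ℝ × V → ℝ} (hh : ContDiff ℝ ∞ h) :
    ContDiff ℝ ∞ (fun y => ∫ t in (0 : ℝ)..1, h (t, y)) := by
  rw [contDiff_infty] at *
  exact fun n => contDiff_integral_param_nat n (hh n)

/-! ### Smooth functions of finitely many among infinitely many variables. -/

section SmoothFun

variable {E E' : Type*}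

/-- `f` is a smooth function of the variables in `T`. -/
def SmoothFun.DependsOn (f : SmoothFun E) (T : Finset E) : Prop :=
  ∃ g : (T → ℝ) → ℝ, ContDiff ℝ ∞ g ∧ ∀ z, f.1 z = g (fun i => z i)

theorem SmoothFun.exists_dependsOn (f : SmoothFun E) : ∃ T, SmoothFun.DependsOn f T := f.2

theorem SmoothFun.DependsOn.mono {f : SmoothFun E} {T T' : Finset E} (h : SmoothFun.DependsOn f T)
    (hT : T ⊆ T') : SmoothFun.DependsOn f T' := by
  obtain ⟨g, hg, h⟩ := h
  exact ⟨fun y => g fun i => y ⟨i, hT i.2⟩,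
    hg.comp (contDiff_pi.2 fun i => contDiff_apply ℝ ℝ _), h⟩

@[ext] theorem SmoothFun.ext {f g : SmoothFun E} (h : ∀ z, f.1 z = g.1 z) : f = g :=
  Subtype.ext (funext h)

@[simp] theorem SmoothFun.proj_apply (e : E) (z : E → ℝ) : (SmoothFun.proj e).1 z = z e := rfl

theorem SmoothFun.coe_sum_apply {ι : Type*} (s : Finset ι) (f : ι → SmoothFun E) (z : E → ℝ) :
    (∑ i ∈ s, f i).1 z = ∑ i ∈ s, (f i).1 z := by
  classical
  induction s using Finset.induction_on with
  | empty => rfl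
  | insert a s ha ih => rw [Finset.sum_insert ha, Finset.sum_insert ha, ← ih]; rfl

open Classical in
theorem SmoothFun.pderiv_apply_of_eq {f : SmoothFun E} {T : Finset E} {g : (T → ℝ) → ℝ}
    (hg : ContDiff ℝ ∞ g) (h : ∀ z, f.1 z = g (fun i => z i)) (e : E) (z : E → ℝ) :
    (SmoothFun.pderiv e f).1 z =
      if he : e ∈ T then fderiv ℝ g (fun i => z i) (Pi.single ⟨e, he⟩ 1) else 0 := by
  change deriv (fun t : ℝ => f.1 (Function.update z e t)) (z e) = _
  simp only [h]
  split_ifs with he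
  · have h1 : HasDerivAt (fun t : ℝ => (fun i : T => Function.update z e t i))
        (Pi.single ⟨e, he⟩ 1) (z e) := by
      rw [hasDerivAt_pi]
      intro i
      by_cases hi : i = ⟨e, he⟩
      · subst hi; simpa using hasDerivAt_id' (z e)
      · have : (i : E) ≠ e := fun h' => hi (Subtype.ext h')
        simp only [Function.update_of_ne this, Pi.single_eq_of_ne hi]
        exact hasDerivAt_const _ _
    have h2 := (hg.differentiable (by simp)
      (fun i : T => Function.update z e (z e) i)).hasFDerivAt.comp_hasDerivAt (z e) h1
    simpa [Function.comp_def] using h2.deriv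
  · have : ∀ (t : ℝ) (i : T), Function.update z e t i = z i := fun t i =>
      Function.update_of_ne (fun h' => he (by simpa [h'] using i.2)) _ _
    simp [this]

theorem SmoothFun.pderiv_eq_zero {f : SmoothFun E} {T : Finset E} (h : SmoothFun.DependsOn f T) {e : E}
    (he : e ∉ T) : SmoothFun.pderiv e f = 0 := by
  obtain ⟨g, hg, h⟩ := h
  ext z
  rw [pderiv_apply_of_eq hg h, dif_neg he]
  rfl

theorem SmoothFun.DependsOn.pderiv {f : SmoothFun E} {T : Finset E} (h : SmoothFun.DependsOn f T) (e : E) :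
    SmoothFun.DependsOn (SmoothFun.pderiv e f) T := by
  classical
  obtain ⟨g, hg, h⟩ := h
  by_cases he : e ∈ T
  · refine ⟨fun y => fderiv ℝ g y (Pi.single ⟨e, he⟩ 1),
      (hg.fderiv_right (m := ∞) (by simp)).clm_apply contDiff_const, fun z => ?_⟩
    rw [pderiv_apply_of_eq hg h, dif_pos he]
  · refine ⟨fun _ => 0, contDiff_const, fun z => ?_⟩
    rw [pderiv_apply_of_eq hg h, dif_neg he]

theorem SmoothFun.DependsOn.hasDerivAt_comp {f : SmoothFun E} {T : Finset E} (h : SmoothFun.DependsOn f T)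
    {c : ℝ → E → ℝ} {c' : E → ℝ} {t : ℝ} (hc : ∀ e, HasDerivAt (fun s => c s e) (c' e) t) :
    HasDerivAt (fun s => f.1 (c s)) (∑ e ∈ T, c' e * (SmoothFun.pderiv e f).1 (c t)) t := by
  classical
  obtain ⟨g, hg, h⟩ := h
  simp only [h, SmoothFun.pderiv_apply_of_eq hg h]
  have h1 : HasDerivAt (fun s => fun i : T => c s i) (fun i : T => c' i) t :=
    hasDerivAt_pi.2 fun i => hc i
  have h2 := (hg.differentiable (by simp) (fun i : T => c t i)).hasFDerivAt.comp_hasDerivAt t h1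
  refine HasDerivAt.congr_deriv (f := fun s => g fun i : T => c s i) h2 ?_
  have h3 : (fun i : T => c' i) = ∑ i : T, c' i • (Pi.single i (1 : ℝ) : T → ℝ) := by
    funext j
    simp [Finset.sum_apply, Pi.single_apply]
  rw [h3, map_sum, ← Finset.sum_coe_sort T, eq_comm]
  refine Finset.sum_congr rfl fun i _ => ?_
  rw [map_smul, dif_pos i.2, smul_eq_mul]

theorem SmoothFun.pderiv_mul (e : E) (f g : SmoothFun E) :
    SmoothFun.pderiv e (f * g) = SmoothFun.pderiv e f * g + f * SmoothFun.pderiv e g := by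
  classical
  ext z
  have := deriv_fun_mul (differentiable_update f z e (z e)) (differentiable_update g z e (z e))
  simp only [Function.update_eq_self] at this
  exact this

open Classical in
theorem SmoothFun.pderiv_proj (e e' : E) :
    SmoothFun.pderiv e (SmoothFun.proj e') = if e = e' then 1 else 0 := by
  ext z
  change deriv (fun t : ℝ => Function.update z e t e') (z e) = _
  split_ifs with h
  · subst h; simp
  · have : ∀ t : ℝ, Function.update z e t e' = z e' := fun t => Function.update_of_ne (Ne.symm h) _ _
    simp [this]

/-- Substitution of smooth functions for the variables. -/
def SmoothFun.subst (b : E → SmoothFun E') : SmoothFun E →ₐ[ℝ] SmoothFun E' where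
  toFun f := ⟨fun z => f.1 fun e => (b e).1 z, by
    classical
    obtain ⟨T, g, hg, h⟩ := f.2
    choose T' hT' using fun e => SmoothFun.exists_dependsOn (b e)
    have hb : ∀ e : T, SmoothFun.DependsOn (b e) (T.biUnion T') := fun e =>
      (hT' e).mono (Finset.subset_biUnion_of_mem T' e.2)
    choose g' hg' h' using hb
    refine ⟨T.biUnion T', fun y => g fun e => g' e y, hg.comp (contDiff_pi.2 hg'), fun z => ?_⟩
    simp only [h, h']⟩
  map_one' := rfl
  map_mul' _ _ := rfl
  map_zero' := rfl
  map_add' _ _ := rfl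
  commutes' _ := rfl

@[simp] theorem SmoothFun.subst_apply (b : E → SmoothFun E') (f : SmoothFun E) (z : E' → ℝ) :
    (SmoothFun.subst b f).1 z = f.1 fun e => (b e).1 z := rfl

@[simp] theorem SmoothFun.subst_proj (b : E → SmoothFun E') (e : E) :
    SmoothFun.subst b (SmoothFun.proj e) = b e := rfl

/-! ### Scaling, Hadamard's lemma and the Euler vector field on smooth functions. -/

open Classical in
/-- The point reached by moving from `z` towards `c` in the variables outside `Q`. -/
noncomputable def scalePt (Q : E → Prop) (c : E → ℝ) (t : ℝ) (z : E → ℝ) : E → ℝ := fun e =>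
  if Q e then z e else c e + t * (z e - c e)

open Classical in
/-- Multiply the variables outside `Q` by `t`. -/
noncomputable def SmoothFun.scale (Q : E → Prop) (t : ℝ) : SmoothFun E →ₐ[ℝ] SmoothFun E :=
  SmoothFun.subst fun e => if Q e then SmoothFun.proj e else t • SmoothFun.proj e

theorem SmoothFun.scale_apply (Q : E → Prop) (t : ℝ) (f : SmoothFun E) (z : E → ℝ) :
    (SmoothFun.scale Q t f).1 z = f.1 (scalePt Q 0 t z) := by
  refine congrArg f.1 (funext fun e => ?_)
  simp only [scalePt]
  split_ifs
  · rfl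
  · simp

theorem contDiff_scalePt {T : Finset E} (Q : E → Prop) (c : E → ℝ) :
    ContDiff ℝ ∞ (fun q : ℝ × (T → ℝ) =>
      scalePt (fun i : T => Q i) (fun i => c i) q.1 q.2) := by
  refine contDiff_pi.2 fun i => ?_
  simp only [scalePt]
  split_ifs
  · fun_prop
  · fun_prop

/-- The integrand is a smooth function of `t` and of the variables in `T`, so the finite-dimensional
result on parametric integrals applies and no new variable enters. -/
theorem SmoothFun.DependsOn.radial_aux {f : SmoothFun E} {T : Finset E} (h : SmoothFun.DependsOn f T)
    (Q : E → Prop) (c : E → ℝ) (j : ℕ) : ∃ g : (T → ℝ) → ℝ, ContDiff ℝ ∞ g ∧ ∀ z,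
      ∫ t in (0 : ℝ)..1, t ^ j * f.1 (scalePt Q c t z) = g (fun i => z i) := by
  obtain ⟨g, hg, h⟩ := h
  refine ⟨_, contDiff_integral_param (h := fun q : ℝ × (T → ℝ) => q.1 ^ j *
    g (scalePt (fun i : T => Q i) (fun i => c i) q.1 q.2)) ?_, fun z => ?_⟩
  · exact (contDiff_fst.pow j).mul (hg.comp (contDiff_scalePt Q c))
  · simp only [h]
    rfl

/-- The weighted integral of `f` along the rays towards `c` in the variables outside `Q`. -/
noncomputable def SmoothFun.radial (Q : E → Prop) (c : E → ℝ) (j : ℕ) (f : SmoothFun E) :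
    SmoothFun E :=
  ⟨fun z => ∫ t in (0 : ℝ)..1, t ^ j * f.1 (scalePt Q c t z),
    (SmoothFun.exists_dependsOn f).imp fun _ h => h.radial_aux Q c j⟩

theorem SmoothFun.DependsOn.radial {f : SmoothFun E} {T : Finset E} (h : SmoothFun.DependsOn f T)
    (Q : E → Prop) (c : E → ℝ) (j : ℕ) : SmoothFun.DependsOn (SmoothFun.radial Q c j f) T :=
  h.radial_aux Q c j

open Classical in
theorem SmoothFun.DependsOn.hasDerivAt_scalePt {f : SmoothFun E} {T : Finset E}
    (h : SmoothFun.DependsOn f T) (Q : E → Prop) (c : E → ℝ) (z : E → ℝ) (t : ℝ) :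
    HasDerivAt (fun s => f.1 (scalePt Q c s z))
      (∑ e ∈ T.filter (fun e => ¬ Q e),
        (z e - c e) * (SmoothFun.pderiv e f).1 (scalePt Q c t z)) t := by
  have := h.hasDerivAt_comp (c := fun s => scalePt Q c s z)
    (c' := fun e => if Q e then 0 else z e - c e) (t := t) fun e => by
      simp only [scalePt]
      split_ifs
      · exact hasDerivAt_const _ _
      · simpa using ((hasDerivAt_id t).mul_const (z e - c e)).const_add (c e)
  convert this using 1
  rw [Finset.sum_filter]
  refine Finset.sum_congr rfl fun e _ => ?_
  by_cases hQ : Q e <;> simp [hQ]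

theorem SmoothFun.continuous_scalePt (f : SmoothFun E) (Q : E → Prop) (c z : E → ℝ) :
    Continuous fun s => f.1 (scalePt Q c s z) := by
  obtain ⟨T, hT⟩ := (SmoothFun.exists_dependsOn f)
  exact continuous_iff_continuousAt.2 fun t => (hT.hasDerivAt_scalePt Q c z t).continuousAt

theorem scalePt_one (Q : E → Prop) (c z : E → ℝ) : scalePt Q c 1 z = z := by
  funext e; simp [scalePt]

theorem scalePt_scalePt (Q : E → Prop) (s t : ℝ) (c z : E → ℝ) :
    scalePt Q c t (scalePt Q c s z) = scalePt Q c (t * s) z := by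
  funext e
  simp only [scalePt]
  split_ifs
  · rfl
  · ring

open Classical in
/-- Hadamard's lemma. -/
theorem SmoothFun.DependsOn.hadamard {f : SmoothFun E} {T : Finset E} (h : SmoothFun.DependsOn f T)
    (Q : E → Prop) (c z : E → ℝ) : f.1 z = f.1 (scalePt Q c 0 z) +
      ∑ e ∈ T.filter (fun e => ¬ Q e),
        (z e - c e) * (SmoothFun.radial Q c 0 (SmoothFun.pderiv e f)).1 z := by
  have h1 := intervalIntegral.integral_eq_sub_of_hasDerivAt
    (fun t _ => h.hasDerivAt_scalePt Q c z t) (a := 0) (b := 1) (by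
      refine Continuous.intervalIntegrable ?_ _ _
      exact continuous_finsetSum _ fun e _ =>
        continuous_const.mul (SmoothFun.continuous_scalePt _ Q c z))
  rw [scalePt_one] at h1
  rw [← sub_eq_iff_eq_add', ← h1, intervalIntegral.integral_finsetSum]
  · refine Finset.sum_congr rfl fun e _ => ?_
    rw [intervalIntegral.integral_const_mul]
    simp [SmoothFun.radial]
  · exact fun e _ => (continuous_const.mul
      (SmoothFun.continuous_scalePt _ Q c z)).intervalIntegrable _ _

open Classical in
/-- The Euler vector field in the variables of `T` outside `Q`. -/
noncomputable def SmoothFun.euler (Q : E → Prop) (T : Finset E) (f : SmoothFun E) : SmoothFun E :=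
  ∑ e ∈ T.filter (fun e => ¬ Q e), SmoothFun.proj e * SmoothFun.pderiv e f

open Classical in
theorem SmoothFun.euler_apply (Q : E → Prop) (T : Finset E) (f : SmoothFun E) (z : E → ℝ) :
    (SmoothFun.euler Q T f).1 z =
      ∑ e ∈ T.filter (fun e => ¬ Q e), z e * (SmoothFun.pderiv e f).1 z := by
  rw [euler, SmoothFun.coe_sum_apply]; rfl

-- Scaling by `t` is the flow of the Euler vector field in the time `log t`; multiplication by `t`
-- keeps the relation meaningful at `t = 0`.
open Classical in
theorem SmoothFun.DependsOn.hasDerivAt_scale {f : SmoothFun E} {T : Finset E}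
    (h : SmoothFun.DependsOn f T) (Q : E → Prop) (z : E → ℝ) (t : ℝ) :
    ∃ d, HasDerivAt (fun s => f.1 (scalePt Q 0 s z)) d t ∧
      t * d = (SmoothFun.euler Q T f).1 (scalePt Q 0 t z) := by
  refine ⟨_, h.hasDerivAt_scalePt Q 0 z t, ?_⟩
  rw [euler_apply, Finset.mul_sum]
  refine Finset.sum_congr rfl fun e he => ?_
  have : scalePt Q 0 t z e = t * z e := by
    simp only [scalePt, if_neg (Finset.mem_filter.1 he).2]; simp
  rw [this]
  simp [mul_assoc]

/-- Write `k` for the radial integral. The substitution `u = t s` shows that `s ^ (j + 1)` times `k`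
at the point scaled by `s` is the integral of `u ^ j f` over `[0, s]`; differentiating at `s = 1`
gives the identity. -/
theorem SmoothFun.DependsOn.euler_radial {f : SmoothFun E} {T : Finset E}
    (h : SmoothFun.DependsOn f T) (Q : E → Prop) (j : ℕ) :
    SmoothFun.euler Q T (SmoothFun.radial Q 0 j f) +
      ((j : ℝ) + 1) • SmoothFun.radial Q 0 j f = f := by
  ext z
  set k := SmoothFun.radial Q 0 j f with hk
  obtain ⟨d, hd, hd'⟩ := (h.radial Q 0 j).hasDerivAt_scale Q z 1
  have key : ∀ s : ℝ, s ^ (j + 1) * k.1 (scalePt Q 0 s z) =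
      ∫ u in (0 : ℝ)..s, u ^ j * f.1 (scalePt Q 0 u z) := by
    intro s
    have h1 := intervalIntegral.mul_integral_comp_mul_right (a := 0) (b := 1) s
      (f := fun u => u ^ j * f.1 (scalePt Q 0 u z))
    rw [zero_mul, one_mul] at h1
    rw [← h1]
    change s ^ (j + 1) * ∫ t in (0 : ℝ)..1, t ^ j * f.1 (scalePt Q 0 t (scalePt Q 0 s z)) = _
    simp only [scalePt_scalePt, mul_pow]
    rw [pow_succ', mul_assoc, ← intervalIntegral.integral_const_mul]
    congr 2
    funext t
    ring
  have h1 := ((hasDerivAt_id (1 : ℝ)).pow (j + 1)).mul hd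
  have hcont : Continuous fun u : ℝ => u ^ j * f.1 (scalePt Q 0 u z) :=
    (continuous_pow j).mul (SmoothFun.continuous_scalePt f Q 0 z)
  have h2 := intervalIntegral.integral_hasDerivAt_right (hcont.intervalIntegrable 0 1)
    (hcont.stronglyMeasurableAtFilter _ _) hcont.continuousAt
  have h3 := h2.unique (h1.congr_of_eventuallyEq (Filter.Eventually.of_forall fun s => by
    simpa using (key s).symm))
  simp only [scalePt_one, one_mul, id_eq, one_pow, Nat.cast_add, Nat.cast_one, mul_one,
    Pi.pow_apply] at h3 hd'
  change (SmoothFun.euler Q T k).1 z + ((j : ℝ) + 1) * k.1 z = f.1 z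
  rw [← hd', h3]
  ring

theorem SmoothFun.euler_mul (Q : E → Prop) (T : Finset E) (f g : SmoothFun E) :
    SmoothFun.euler Q T (f * g) = SmoothFun.euler Q T f * g + f * SmoothFun.euler Q T g := by
  classical
  simp only [euler, pderiv_mul, Finset.sum_mul, Finset.mul_sum, ← Finset.sum_add_distrib]
  exact Finset.sum_congr rfl fun e _ => by ring

theorem SmoothFun.euler_sum {ι : Type*} (Q : E → Prop) (T : Finset E) (s : Finset ι)
    (f : ι → SmoothFun E) :
    SmoothFun.euler Q T (∑ i ∈ s, f i) = ∑ i ∈ s, SmoothFun.euler Q T (f i) := by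
  classical
  simp only [euler, map_sum, Finset.mul_sum]
  exact Finset.sum_comm

/-- This inverts `euler + j`, where `j` will count the odd generators that multiply `f`. For `j > 0`
the radial integral with weight `j - 1` is a solution, and the factor `0 ^ j` removes the
correction. For `j = 0` the value at scale zero must be subtracted; by Hadamard the rest is a sum of
`z e * g e`, and `euler` maps `z e * radial (g e)` to `z e * (euler + 1) (radial (g e)) = z e * g
e`. -/
theorem SmoothFun.DependsOn.exists_euler_eq {f : SmoothFun E} {T : Finset E}
    (h : SmoothFun.DependsOn f T) (Q : E → Prop) (j : ℕ) : ∃ k : SmoothFun E, SmoothFun.DependsOn k T ∧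
      SmoothFun.euler Q T k + (j : ℝ) • k = f - (0 : ℝ) ^ j • SmoothFun.scale Q 0 f := by
  classical
  cases j with
  | succ j =>
    refine ⟨_, h.radial Q 0 j, ?_⟩
    rw [Nat.cast_succ, h.euler_radial]
    simp
  | zero =>
    let g : E → SmoothFun E := fun e => SmoothFun.radial Q 0 0 (SmoothFun.pderiv e f)
    have hg : ∀ e, SmoothFun.DependsOn (g e) T := fun e => (h.pderiv e).radial Q 0 0
    refine ⟨∑ e ∈ T.filter (fun e => ¬ Q e), SmoothFun.proj e * SmoothFun.radial Q 0 0 (g e),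
      ?_, ?_⟩
    · choose G hG hG' using fun e => (hg e).radial Q 0 0
      refine ⟨fun y => ∑ e ∈ T.attach, if Q e then 0 else y e * G e y, ?_, fun z => ?_⟩
      · refine ContDiff.sum fun e _ => ?_
        split_ifs
        · exact contDiff_const
        · exact (contDiff_apply ℝ ℝ _).mul (hG e)
      · rw [SmoothFun.coe_sum_apply, Finset.sum_filter, ← Finset.sum_attach]
        refine Finset.sum_congr rfl fun e _ => ?_
        rw [ite_not]
        split_ifs
        · rfl
        · change z e * (SmoothFun.radial Q 0 0 (g e)).1 z = _
          rw [hG']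
    · have h1 : ∀ e ∈ T.filter (fun e => ¬ Q e),
          SmoothFun.euler Q T (SmoothFun.proj e * SmoothFun.radial Q 0 0 (g e)) =
            SmoothFun.proj e * g e := by
        intro e he
        have h2 : SmoothFun.euler Q T (SmoothFun.proj e) = SmoothFun.proj e := by
          simp only [euler, pderiv_proj, mul_ite, mul_one, mul_zero]
          rw [Finset.sum_ite_eq' _ e, if_pos he]
        have h3 := (hg e).euler_radial Q 0
        rw [Nat.cast_zero, zero_add, one_smul] at h3
        rw [euler_mul, h2]
        nth_rewrite 3 [← h3]
        ring
      rw [SmoothFun.euler_sum, Finset.sum_congr rfl h1]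
      simp only [Nat.cast_zero, zero_smul, add_zero, pow_zero, one_smul]
      ext z
      change _ = f.1 z - (SmoothFun.scale Q 0 f).1 z
      rw [SmoothFun.scale_apply, h.hadamard Q 0 z, SmoothFun.coe_sum_apply, add_sub_cancel_left]
      exact Finset.sum_congr rfl fun e _ => by simp [g]

/-- Taylor expansion at `c`, with an algebraic remainder: Hadamard's lemma gives one factor of the
ideal, and the induction hypothesis is applied to its coefficients. -/
theorem SmoothFun.exists_polynomial_sub_mem (T : Finset E) (c : E → ℝ) (k : ℕ) (f : SmoothFun E)
    (hf : SmoothFun.DependsOn f T) : ∃ P ∈ Algebra.adjoin ℝ (Set.range (SmoothFun.proj (E := E))),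
      f - P ∈ Ideal.span ((fun e => SmoothFun.proj e - algebraMap ℝ (SmoothFun E) (c e)) ''
        (T : Set E)) ^ k := by
  classical
  induction k generalizing f with
  | zero => exact ⟨0, zero_mem _, by simp⟩
  | succ k ih =>
    choose P hP hP' using fun e => ih (SmoothFun.radial (fun _ => False) c 0
      (SmoothFun.pderiv e f)) ((hf.pderiv e).radial _ c 0)
    refine ⟨algebraMap ℝ _ (f.1 c) + ∑ e ∈ T,
      (SmoothFun.proj e - algebraMap ℝ (SmoothFun E) (c e)) * P e, ?_, ?_⟩
    · refine add_mem (Subalgebra.algebraMap_mem _ _) (sum_mem fun e _ => mul_mem ?_ (hP e))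
      exact sub_mem (Algebra.subset_adjoin ⟨e, rfl⟩) (Subalgebra.algebraMap_mem _ _)
    · have h1 : f = algebraMap ℝ _ (f.1 c) + ∑ e ∈ T,
          (SmoothFun.proj e - algebraMap ℝ (SmoothFun E) (c e)) *
            SmoothFun.radial (fun _ => False) c 0 (SmoothFun.pderiv e f) := by
        ext z
        refine Eq.trans ?_ (congrArg (f.1 c + ·) (SmoothFun.coe_sum_apply T _ z).symm)
        have h0 : scalePt (fun _ => False) c 0 z = c := by funext e; simp [scalePt]
        rw [hf.hadamard (fun _ => False) c z, h0]
        simp only [not_false_eq_true, Finset.filter_true]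
        rfl
      nth_rewrite 1 [h1]
      rw [add_sub_add_left_eq_sub, ← Finset.sum_sub_distrib]
      refine sum_mem fun e he => ?_
      rw [← mul_sub, pow_succ']
      exact Ideal.mul_mem_mul (Ideal.subset_span ⟨e, he, rfl⟩) (hP' e)

/-- An algebra homomorphism on smooth functions is determined by its values on the coordinates,
if these are nilpotent up to constants. -/
theorem SmoothFun.algHom_ext {C : Type*} [Ring C] [Algebra ℝ C] {φ₁ φ₂ : SmoothFun E →ₐ[ℝ] C}
    (h : ∀ e, φ₁ (SmoothFun.proj e) = φ₂ (SmoothFun.proj e))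
    (hn : ∀ e, ∃ c : ℝ, IsNilpotent (φ₁ (SmoothFun.proj e) - algebraMap ℝ C c)) : φ₁ = φ₂ := by
  choose c hc using hn
  refine AlgHom.ext fun f => ?_
  obtain ⟨T, hT⟩ := (SmoothFun.exists_dependsOn f)
  set I := Ideal.span ((fun e => SmoothFun.proj e - algebraMap ℝ (SmoothFun E) (c e)) ''
        (T : Set E)) with hI
  have hfg : I.FG := Submodule.fg_span (T.finite_toSet.image _)
  -- The generators of `I` are nilpotent modulo both kernels. As `I` is finitely generated, a whole
  -- power of it lies in both, so a Taylor remainder of that order is killed and only a polynomial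
  -- is left to compare.
  obtain ⟨k, hk⟩ := Ideal.exists_pow_le_of_le_radical_of_fg
    (J := RingHom.ker φ₁ ⊓ RingHom.ker φ₂) (I := I) (by
      rw [hI, Ideal.span_le]
      rintro _ ⟨e, -, rfl⟩
      obtain ⟨m, hm⟩ := hc e
      refine ⟨m, ?_, ?_⟩
      · change φ₁ ((SmoothFun.proj e - algebraMap ℝ _ (c e)) ^ m) = 0
        rw [map_pow, map_sub, AlgHom.commutes, hm]
      · change φ₂ ((SmoothFun.proj e - algebraMap ℝ _ (c e)) ^ m) = 0
        rw [map_pow, map_sub, AlgHom.commutes, ← h, hm]) hfg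
  obtain ⟨P, hP, hfP⟩ := SmoothFun.exists_polynomial_sub_mem T c k f hT
  have h1 := hk hfP
  have hP' : φ₁ P = φ₂ P := by
    have : Algebra.adjoin ℝ (Set.range (SmoothFun.proj (E := E))) ≤ AlgHom.equalizer φ₁ φ₂ := by
      rw [Algebra.adjoin_le_iff]
      rintro _ ⟨e, rfl⟩
      exact h e
    exact this hP
  have h2 : φ₁ (f - P) = 0 := h1.1
  have h3 : φ₂ (f - P) = 0 := h1.2
  rw [map_sub, sub_eq_zero] at h2 h3
  rw [h2, h3, hP']

end SmoothFun

/-! ## Substitution homomorphisms -/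

section Subst

variable {E : Type*} {K L M : Type*} {p : K → ZMod 2} {q : L → ZMod 2} {r : M → ZMod 2}

theorem SmoothFun.pderiv_one (e : E) : SmoothFun.pderiv e (1 : SmoothFun E) = 0 := by
  have h := SmoothFun.pderiv_mul e (1 : SmoothFun E) 1
  rw [mul_one, mul_one, one_mul] at h
  exact left_eq_add.1 h

/-- For a central `c` with `c ^ 2 = 0` the Taylor series of the shift stops after `h f + c * h
(∂f/∂e)`, which is multiplicative by the Leibniz rule. Sums of such elements are added one at a
time. -/
theorem exists_shift {C : Type*} [Ring C] [Algebra ℝ C] (h : SmoothFun E →ₐ[ℝ] C) (e : E) {n : C}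
    (hn : n ∈ AddSubmonoid.closure (centralSqZero C)) : ∃ h' : SmoothFun E →ₐ[ℝ] C,
      h' (SmoothFun.proj e) = h (SmoothFun.proj e) + n ∧
      ∀ e', e' ≠ e → h' (SmoothFun.proj e') = h (SmoothFun.proj e') := by
  classical
  induction hn using AddSubmonoid.closure_induction generalizing h with
  | zero => exact ⟨h, by simp, fun _ _ => rfl⟩
  | add x y _ _ hx hy =>
    obtain ⟨h₁, h1, h1'⟩ := hx h
    obtain ⟨h₂, h2, h2'⟩ := hy h₁
    exact ⟨h₂, by rw [h2, h1, add_assoc], fun e' he => by rw [h2' e' he, h1' e' he]⟩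
  | mem c hc =>
    obtain ⟨hc, hc2⟩ := hc
    refine ⟨AlgHom.ofLinearMap (h.toLinearMap + (LinearMap.mulLeft ℝ c).comp
      (h.toLinearMap.comp (SmoothFun.pderiv e))) ?_ ?_, ?_, ?_⟩
    · simp [SmoothFun.pderiv_one]
    · intro f g
      simp only [LinearMap.add_apply, LinearMap.comp_apply, AlgHom.toLinearMap_apply,
        LinearMap.mulLeft_apply, map_mul, SmoothFun.pderiv_mul, map_add]
      have h1 : h f * (c * h (SmoothFun.pderiv e g)) = c * (h f * h (SmoothFun.pderiv e g)) := by
        rw [← mul_assoc, ← (hc (h f)).eq, mul_assoc]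
      have h2 : c * h (SmoothFun.pderiv e f) * (c * h (SmoothFun.pderiv e g)) = 0 := by
        rw [mul_assoc, ← mul_assoc (h _) c, ← (hc _).eq, mul_assoc c, ← mul_assoc c c, hc2,
          zero_mul]
      rw [add_mul, mul_add, mul_add, h1, h2, mul_assoc]
      abel
    · simp [SmoothFun.pderiv_proj]
    · intro e' he
      simp [SmoothFun.pderiv_proj, he.symm]

/-- An even superfunction differs from its body, not from a constant, by a nilpotent. After
evaluation at a point the body is a constant, and `SmoothFun.algHom_ext` applies. -/
theorem SmoothFun.algHom_ext_super {φ₁ φ₂ : SmoothFun E →ₐ[ℝ] SuperFun p}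
    (hp : ∀ e, HasParity 0 (φ₁ (SmoothFun.proj e)))
    (h : ∀ e, φ₁ (SmoothFun.proj e) = φ₂ (SmoothFun.proj e)) : φ₁ = φ₂ := by
  refine AlgHom.ext fun f => ext_evalAt fun z => ?_
  refine DFunLike.congr_fun (SmoothFun.algHom_ext (φ₁ := (evalAt p z).comp φ₁)
    (φ₂ := (evalAt p z).comp φ₂) (fun e => ?_) fun e => ?_) f
  · rw [AlgHom.comp_apply, AlgHom.comp_apply, h]
  · refine ⟨(body p (φ₁ (SmoothFun.proj e))).1 z, ?_⟩
    have := (isNilpotent_of_mem_closure (hp e).sub_body_mem).map (evalAt p z)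
    rwa [map_sub, evalAt_tmul, ← Algebra.algebraMap_eq_smul_one] at this

/-- Substitute the bodies first, which is composition of smooth functions, then restore the
nilpotent parts by `exists_shift`. Only finitely many variables can be corrected in this way; since
every function depends on finitely many, the resulting homomorphisms can be glued. -/
theorem exists_smooth_lift (u : E → SuperFun p) (hu : ∀ e, HasParity 0 (u e)) :
    ∃ h : SmoothFun E →ₐ[ℝ] SuperFun p, ∀ e, h (SmoothFun.proj e) = u e := by
  classical
  have h0 : ∀ T : Finset E, ∃ h : SmoothFun E →ₐ[ℝ] SuperFun p, ∀ e,
      h (SmoothFun.proj e) = if e ∈ T then u e else body p (u e) ⊗ₜ 1 := by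
    intro T
    induction T using Finset.induction_on with
    | empty =>
      refine ⟨Algebra.TensorProduct.includeLeft.comp (SmoothFun.subst fun e => body p (u e)),
        fun e => ?_⟩
      simp
    | insert a T ha ih =>
      obtain ⟨h, hh⟩ := ih
      obtain ⟨h', h1, h2⟩ := exists_shift h a (hu a).sub_body_mem
      refine ⟨h', fun e => ?_⟩
      by_cases he : e = a
      · subst he
        rw [h1, hh, if_neg ha, if_pos (Finset.mem_insert_self _ _)]
        abel
      · rw [h2 e he, hh]
        simp [he]
  choose h hh using h0
  have key : ∀ (T T' : Finset E) (f : SmoothFun E), SmoothFun.DependsOn f T → T ⊆ T' →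
      h T f = h T' f := by
    intro T T' f hf hT
    -- `ρ` fixes the functions of the variables in `T` and kills the other variables, so after
    -- composition with it the two homomorphisms agree on all coordinates.
    let ρ : SmoothFun E →ₐ[ℝ] SmoothFun E :=
      SmoothFun.subst fun e => if e ∈ T then SmoothFun.proj e else 0
    have hρ : ρ f = f := by
      obtain ⟨g, -, hg⟩ := hf
      refine SmoothFun.ext fun z => ?_
      rw [SmoothFun.subst_apply, hg, hg]
      congr 1
      funext i
      rw [if_pos i.2, SmoothFun.proj_apply]
    have : (h T).comp ρ = (h T').comp ρ := by
      refine SmoothFun.algHom_ext_super (fun e => ?_) fun e => ?_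
      · rw [AlgHom.comp_apply, SmoothFun.subst_proj]
        split_ifs with he
        · rw [hh, if_pos he]; exact hu e
        · rw [map_zero]; exact HasParity.zero _
      · rw [AlgHom.comp_apply, AlgHom.comp_apply, SmoothFun.subst_proj]
        split_ifs with he
        · rw [hh, hh, if_pos he, if_pos (hT he)]
        · rw [map_zero, map_zero]
    have := DFunLike.congr_fun this f
    rwa [AlgHom.comp_apply, AlgHom.comp_apply, hρ] at this
  -- The lift uses on each `f` the homomorphism of some finite set on which `f` depends. By `key`
  -- the choice is irrelevant, so sums and products can be computed in a common larger set.
  choose S hS using fun f : SmoothFun E => SmoothFun.exists_dependsOn f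
  have key' : ∀ (T : Finset E) (f : SmoothFun E), SmoothFun.DependsOn f T →
      h (S f) f = h T f := fun T f hT =>
    (key _ (S f ∪ T) f (hS f) Finset.subset_union_left).trans
      (key _ (S f ∪ T) f hT Finset.subset_union_right).symm
  have hadd : ∀ f g : SmoothFun E, h (S (f + g)) (f + g) = h (S f) f + h (S g) g := by
    intro f g
    rw [key _ (S (f + g) ∪ (S f ∪ S g)) _ (hS _) Finset.subset_union_left,
      key _ (S (f + g) ∪ (S f ∪ S g)) _ (hS f)
        (Finset.subset_union_left.trans Finset.subset_union_right),
      key _ (S (f + g) ∪ (S f ∪ S g)) _ (hS g)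
        (Finset.subset_union_right.trans Finset.subset_union_right), map_add]
  have hmul : ∀ f g : SmoothFun E, h (S (f * g)) (f * g) = h (S f) f * h (S g) g := by
    intro f g
    rw [key _ (S (f * g) ∪ (S f ∪ S g)) _ (hS _) Finset.subset_union_left,
      key _ (S (f * g) ∪ (S f ∪ S g)) _ (hS f)
        (Finset.subset_union_left.trans Finset.subset_union_right),
      key _ (S (f * g) ∪ (S f ∪ S g)) _ (hS g)
        (Finset.subset_union_right.trans Finset.subset_union_right), map_mul]
  refine ⟨{ toFun := fun f => h (S f) f
            map_one' := map_one _
            map_mul' := hmul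
            map_zero' := map_zero _
            map_add' := hadd
            commutes' := fun c => AlgHom.commutes _ _ }, fun e => ?_⟩
  change h (S (SmoothFun.proj e)) (SmoothFun.proj e) = u e
  rw [key' {e} _ ⟨fun y => y ⟨e, Finset.mem_singleton_self e⟩, contDiff_apply ℝ ℝ _,
    fun _ => rfl⟩, hh, if_pos (Finset.mem_singleton_self e)]

theorem coord_even (e : EvenIdx p) : coord p e.1 = SmoothFun.proj e ⊗ₜ 1 := by
  rw [coord, dif_pos e.2]

theorem coord_odd (o : OddIdx p) : coord p o.1 = 1 ⊗ₜ gen o := by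
  rw [coord, dif_neg o.2, gen]

/-- A homomorphism of superalgebras. -/
def IsEven (Θ : SuperFun q →ₐ[ℝ] SuperFun p) : Prop :=
  ∀ f, Θ (parityInv q f) = parityInv p (Θ f)

theorem IsEven.hasParity {Θ : SuperFun q →ₐ[ℝ] SuperFun p} (h : IsEven Θ) {ε : ZMod 2}
    {f : SuperFun q} (hf : HasParity ε f) : HasParity ε (Θ f) := by
  unfold HasParity at *
  rw [← h, hf, map_smul]

theorem IsEven.twist {Θ : SuperFun q →ₐ[ℝ] SuperFun p} (h : IsEven Θ) (ε : ZMod 2)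
    (f : SuperFun q) : Θ (twist q ε f) = ParentBRST.twist p ε (Θ f) := by
  rcases zmod2_cases ε with rfl | rfl
  · simp
  · simpa using h f

theorem IsEven.comp {Θ : SuperFun q →ₐ[ℝ] SuperFun p} (h : IsEven Θ)
    {Θ' : SuperFun r →ₐ[ℝ] SuperFun q} (h' : IsEven Θ') : IsEven (Θ.comp Θ') := fun f => by
  rw [AlgHom.comp_apply, h', h]; rfl

theorem IsEven.id : IsEven (AlgHom.id ℝ (SuperFun p)) := fun _ => rfl

theorem superHom_ext {Θ₁ Θ₂ : SuperFun q →ₐ[ℝ] SuperFun p}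
    (hp : ∀ l, HasParity (q l) (Θ₁ (coord q l)))
    (h : ∀ l, Θ₁ (coord q l) = Θ₂ (coord q l)) : Θ₁ = Θ₂ := by
  refine Algebra.TensorProduct.ext ?_ ?_
  · refine SmoothFun.algHom_ext_super (fun e => ?_) fun e => ?_
    · have := hp e.1
      rwa [coord_even, e.2] at this
    · have := h e.1
      rwa [coord_even] at this
  · refine ExteriorAlgebra.hom_ext (Finsupp.lhom_ext' fun o => LinearMap.ext_ring ?_)
    have := h o.1
    rwa [coord_odd] at this

/-- `Θ` and its conjugate by the parity involutions agree on the coordinates, hence everywhere. -/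
theorem IsEven.of_coord {Θ : SuperFun q →ₐ[ℝ] SuperFun p}
    (hp : ∀ l, HasParity (q l) (Θ (coord q l))) : IsEven Θ := by
  have : ((parityInv p).comp Θ).comp (parityInv q) = Θ := by
    have h : ∀ l, (((parityInv p).comp Θ).comp (parityInv q)) (coord q l) = Θ (coord q l) := by
      intro l
      have h1 : parityInv q (coord q l) = sgn (q l) • coord q l := hasParity_coord l
      have h2 : parityInv p (Θ (coord q l)) = sgn (q l) • Θ (coord q l) := hp l
      rw [AlgHom.comp_apply, AlgHom.comp_apply, h1, map_smul, map_smul, h2, smul_smul,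
        sgn_mul_self, one_smul]
    exact superHom_ext (fun l => by rw [h]; exact hp l) h
  intro f
  have h1 := DFunLike.congr_fun this f
  rw [AlgHom.comp_apply, AlgHom.comp_apply] at h1
  rw [← h1, parityInv_parityInv]

theorem IsEven.ext {Θ₁ Θ₂ : SuperFun q →ₐ[ℝ] SuperFun p} (hp : IsEven Θ₁)
    (h : ∀ l, Θ₁ (coord q l) = Θ₂ (coord q l)) : Θ₁ = Θ₂ :=
  superHom_ext (fun l => hp.hasParity (hasParity_coord l)) h

theorem exists_superSubst (u : L → SuperFun p) (hu : ∀ l, HasParity (q l) (u l)) :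
    ∃ Θ : SuperFun q →ₐ[ℝ] SuperFun p, ∀ l, Θ (coord q l) = u l := by
  obtain ⟨h, hh⟩ := exists_smooth_lift (E := EvenIdx q) (fun e => u e.1) fun e => by
    have := hu e.1
    rwa [e.2] at this
  have hodd : ∀ m : OddIdx q →₀ ℝ,
      HasParity 1 (Finsupp.linearCombination ℝ (fun o : OddIdx q => u o.1) m) := by
    intro m
    rw [Finsupp.linearCombination_apply]
    refine HasParity.sum _ fun o _ => HasParity.smul _ ?_
    have := hu o.1
    rwa [(zmod2_cases (q o.1)).resolve_left o.2] at this
  -- Even values commute with everything, which is what allows `h` to be combined with the lift from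
  -- the exterior algebra.
  have heven : ∀ f, HasParity 0 (h f) := by
    have : (parityInv p).comp h = h := by
      have h2 : ∀ e, HasParity 0 (h (SmoothFun.proj e)) := fun e => by
        have := hu e.1
        rwa [e.2, ← hh] at this
      exact SmoothFun.algHom_ext_super (fun e => hasParity_parityInv (h2 e))
        fun e => HasParity.eq_zero_case.1 (h2 e)
    exact fun f => HasParity.eq_zero_case.2 (DFunLike.congr_fun this f)
  refine ⟨Algebra.TensorProduct.lift h (ExteriorAlgebra.lift ℝ
    ⟨Finsupp.linearCombination ℝ (fun o : OddIdx q => u o.1), fun m => (hodd m).mul_self⟩)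
    fun f a => (heven f).commute _, fun l => ?_⟩
  by_cases hl : q l = 0
  · rw [coord_even ⟨l, hl⟩, Algebra.TensorProduct.lift_tmul, hh, map_one, mul_one]
  · rw [coord_odd ⟨l, hl⟩, Algebra.TensorProduct.lift_tmul, map_one, one_mul, gen,
      ExteriorAlgebra.lift_ι_apply, Finsupp.linearCombination_single, one_smul]

/-- Substitution of superfunctions for the coordinates. -/
noncomputable def superSubst (u : L → SuperFun p) (hu : ∀ l, HasParity (q l) (u l)) :
    SuperFun q →ₐ[ℝ] SuperFun p := (exists_superSubst u hu).choose

@[simp] theorem superSubst_coord (u : L → SuperFun p) (hu : ∀ l, HasParity (q l) (u l)) (l : L) :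
    superSubst u hu (coord q l) = u l := (exists_superSubst u hu).choose_spec l

theorem isEven_superSubst (u : L → SuperFun p) (hu : ∀ l, HasParity (q l) (u l)) :
    IsEven (superSubst u hu) := IsEven.of_coord fun l => by rw [superSubst_coord]; exact hu l

theorem rename_coord (f : L → K) (hf : ∀ l, p (f l) = q l) (l : L) :
    rename f hf (coord q l) = coord p (f l) := by
  by_cases hl : q l = 0
  · rw [coord_even ⟨l, hl⟩, coord_even ⟨f l, (hf l).trans hl⟩, rename,
      Algebra.TensorProduct.map_tmul, map_one]
    rfl
  · rw [coord_odd ⟨l, hl⟩, coord_odd ⟨f l, fun h => hl ((hf l).symm.trans h)⟩, rename,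
      Algebra.TensorProduct.map_tmul, map_one, gen, ExteriorAlgebra.map_apply_ι]
    simp [gen]

theorem isEven_rename (f : L → K) (hf : ∀ l, p (f l) = q l) : IsEven (rename f hf) :=
  IsEven.of_coord fun l => by rw [rename_coord, ← hf]; exact hasParity_coord _

end Subst

/-! ## Superderivations -/

section SDer

variable {K L M : Type*} {p : K → ZMod 2} {q : L → ZMod 2} {r : M → ZMod 2}

/-- `X` is a superderivation of parity `ε` along the homomorphism `Θ`. -/
structure IsSDer (Θ : SuperFun q →ₐ[ℝ] SuperFun p) (ε : ZMod 2)
    (X : SuperFun q →ₗ[ℝ] SuperFun p) : Prop where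
  leibniz : ∀ f g, X (f * g) = X f * Θ g + Θ (twist q ε f) * X g
  parity : ∀ f, X (parityInv q f) = sgn ε • parityInv p (X f)

theorem IsSDer.map_one {Θ : SuperFun q →ₐ[ℝ] SuperFun p} {ε : ZMod 2}
    {X : SuperFun q →ₗ[ℝ] SuperFun p} (hX : IsSDer Θ ε X) : X 1 = 0 := by
  have h := hX.leibniz 1 1
  rw [mul_one, _root_.map_one Θ, _root_.map_one (ParentBRST.twist q ε), _root_.map_one Θ,
    mul_one, one_mul] at h
  exact left_eq_add.1 h

theorem IsSDer.sub {Θ : SuperFun q →ₐ[ℝ] SuperFun p} {ε : ZMod 2}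
    {X Y : SuperFun q →ₗ[ℝ] SuperFun p} (hX : IsSDer Θ ε X) (hY : IsSDer Θ ε Y) :
    IsSDer Θ ε (X - Y) where
  leibniz f g := by
    simp only [LinearMap.sub_apply, hX.leibniz, hY.leibniz, sub_mul, mul_sub]; abel
  parity f := by
    simp only [LinearMap.sub_apply, hX.parity, hY.parity, map_sub, smul_sub]

theorem IsSDer.smul {Θ : SuperFun q →ₐ[ℝ] SuperFun p} {ε : ZMod 2}
    {X : SuperFun q →ₗ[ℝ] SuperFun p} (c : ℝ) (hX : IsSDer Θ ε X) :
    IsSDer Θ ε (c • X) where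
  leibniz f g := by
    simp only [LinearMap.smul_apply, hX.leibniz, smul_add, smul_mul_assoc, mul_smul_comm]
  parity f := by
    simp only [LinearMap.smul_apply, hX.parity, map_smul]
    rw [smul_comm]

theorem IsSDer.zero (Θ : SuperFun q →ₐ[ℝ] SuperFun p) (ε : ZMod 2) : IsSDer Θ ε 0 where
  leibniz f g := by simp
  parity f := by simp

theorem IsSDer.comp_left {Θ : SuperFun q →ₐ[ℝ] SuperFun p} {ε : ZMod 2}
    {X : SuperFun q →ₗ[ℝ] SuperFun p} (hX : IsSDer Θ ε X) {Ξ : SuperFun p →ₐ[ℝ] SuperFun r}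
    (hΞ : IsEven Ξ) : IsSDer (Ξ.comp Θ) ε (Ξ.toLinearMap.comp X) where
  leibniz f g := by
    simp only [LinearMap.comp_apply, AlgHom.toLinearMap_apply, hX.leibniz, map_add, map_mul Ξ,
      AlgHom.comp_apply]
  parity f := by
    simp only [LinearMap.comp_apply, AlgHom.toLinearMap_apply, hX.parity, map_smul]
    rw [hΞ]

theorem IsSDer.comp_right {Θ : SuperFun q →ₐ[ℝ] SuperFun p} {ε : ZMod 2}
    {X : SuperFun q →ₗ[ℝ] SuperFun p} (hX : IsSDer Θ ε X) {Ξ : SuperFun r →ₐ[ℝ] SuperFun q}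
    (hΞ : IsEven Ξ) : IsSDer (Θ.comp Ξ) ε (X.comp Ξ.toLinearMap) where
  leibniz f g := by
    simp only [LinearMap.comp_apply, AlgHom.toLinearMap_apply, hX.leibniz, map_mul Ξ,
      AlgHom.comp_apply, hΞ.twist]
  parity f := by
    simp only [LinearMap.comp_apply, AlgHom.toLinearMap_apply]
    rw [hΞ, hX.parity]

theorem IsSDer.hasParity {Θ : SuperFun q →ₐ[ℝ] SuperFun p} {ε : ZMod 2}
    {X : SuperFun q →ₗ[ℝ] SuperFun p} (hX : IsSDer Θ ε X) {δ : ZMod 2} {f : SuperFun q}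
    (hf : HasParity δ f) : HasParity (δ + ε) (X f) := by
  have h := hX.parity f
  have hf' : parityInv q f = sgn δ • f := hf
  have h2 : sgn ε • X (parityInv q f) = parityInv p (X f) := by
    rw [h, smul_smul, sgn_mul_self, one_smul]
  rw [HasParity, ← h2, hf', map_smul, smul_smul, sgn_add, mul_comm]

theorem IsSDer.twist {Θ : SuperFun q →ₐ[ℝ] SuperFun p} {ε : ZMod 2}
    {X : SuperFun q →ₗ[ℝ] SuperFun p} (hX : IsSDer Θ ε X) (δ : ZMod 2) (f : SuperFun q) :
    X (ParentBRST.twist q δ f) = sgn (δ * ε) • ParentBRST.twist p δ (X f) := by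
  rcases zmod2_cases δ with rfl | rfl
  · simp
  · simpa using hX.parity f

/-- On smooth coefficients a derivation is a homomorphism to the dual numbers, so uniqueness of
homomorphisms applies; monomials in the odd generators follow from the Leibniz rule. Only the
Leibniz rule is assumed, because `IsSDer.of_leibniz` derives the parity condition from this result.
-/
theorem hom_eq_zero_of_coord {Θ : SuperFun q →ₐ[ℝ] SuperFun p} (hΘ : IsEven Θ) {ε : ZMod 2}
    {X : SuperFun q →ₗ[ℝ] SuperFun p}
    (hX : ∀ f g, X (f * g) = X f * Θ g + Θ (twist q ε f) * X g)
    (h : ∀ l, X (coord q l) = 0) : X = 0 := by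
  have hone : X 1 = 0 := by
    have h := hX 1 1
    rw [mul_one, map_one Θ, map_one (twist q ε), map_one Θ, mul_one, one_mul] at h
    exact left_eq_add.1 h
  have htw : ∀ f : SmoothFun (EvenIdx q), twist q ε (f ⊗ₜ 1) = f ⊗ₜ 1 := by
    intro f
    rw [twist_of_hasParity ε (hasParity_tmul_one f), mul_zero, sgn_zero, one_smul]
  have hs : ∀ f : SmoothFun (EvenIdx q), X (f ⊗ₜ 1) = 0 := by
    intro f
    refine eq_zero_of_evalAt fun z => ?_
    let φ : SmoothFun (EvenIdx q) →ₐ[ℝ] Grassmann p :=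
      (evalAt p z).comp (Θ.comp Algebra.TensorProduct.includeLeft)
    have hφ : ∀ f, φ f = evalAt p z (Θ (f ⊗ₜ 1)) := fun _ => rfl
    have hmul : ∀ f g : SmoothFun (EvenIdx q), evalAt p z (X ((f * g) ⊗ₜ 1)) =
        φ f * evalAt p z (X (g ⊗ₜ 1)) + evalAt p z (X (f ⊗ₜ 1)) * φ g := by
      intro f g
      have : ((f * g) ⊗ₜ 1 : SuperFun q) = f ⊗ₜ 1 * g ⊗ₜ 1 := by
        rw [Algebra.TensorProduct.tmul_mul_tmul, mul_one]
      rw [this, hX, htw, map_add, map_mul, map_mul, hφ, hφ, add_comm]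
    -- The sign in the Leibniz rule is trivial on the even elements `f ⊗ 1`, so `X` followed by
    -- evaluation is an ordinary derivation along `φ`. It vanishes once `ψ` is shown to equal its
    -- first component `ψ₀`.
    let ψ : SmoothFun (EvenIdx q) →ₐ[ℝ] DualNumber (Grassmann p) :=
      AlgHom.ofLinearMap
        { toFun := fun f => TrivSqZeroExt.inl (φ f) + TrivSqZeroExt.inr (evalAt p z (X (f ⊗ₜ 1)))
          map_add' := fun f g => by
            ext <;> simp [TensorProduct.add_tmul]
          map_smul' := fun c f => by
            rw [← TensorProduct.smul_tmul']
            ext <;> simp }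
        (by
          have : (1 : SmoothFun (EvenIdx q)) ⊗ₜ[ℝ] (1 : Grassmann q) = (1 : SuperFun q) := rfl
          change TrivSqZeroExt.inl (φ 1) + TrivSqZeroExt.inr (evalAt p z (X (1 ⊗ₜ 1))) = 1
          rw [this, hone, map_one, map_zero]
          ext <;> simp)
        (fun f g => by
          change TrivSqZeroExt.inl (φ (f * g)) +
            TrivSqZeroExt.inr (evalAt p z (X ((f * g) ⊗ₜ 1))) =
            (TrivSqZeroExt.inl (φ f) + TrivSqZeroExt.inr (evalAt p z (X (f ⊗ₜ 1)))) *
            (TrivSqZeroExt.inl (φ g) + TrivSqZeroExt.inr (evalAt p z (X (g ⊗ₜ 1))))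
          rw [hmul, map_mul]
          ext <;> simp)
    let ψ₀ : SmoothFun (EvenIdx q) →ₐ[ℝ] DualNumber (Grassmann p) :=
      (TrivSqZeroExt.inlAlgHom ℝ _ _).comp φ
    have hψ : ψ = ψ₀ := by
      refine SmoothFun.algHom_ext (fun e => ?_) fun e => ?_
      · change TrivSqZeroExt.inl (φ (SmoothFun.proj e)) +
          TrivSqZeroExt.inr (evalAt p z (X (SmoothFun.proj e ⊗ₜ 1))) =
          TrivSqZeroExt.inl (φ (SmoothFun.proj e))
        rw [← coord_even, h]
        simp
      · refine ⟨(body p (Θ (coord q e.1))).1 z, ?_⟩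
        -- The infinitesimal part has square zero, so only the first component, an even
        -- superfunction evaluated at `z`, must be nilpotent up to a constant.
        rw [TrivSqZeroExt.isNilpotent_iff_isNilpotent_fst]
        have hp : HasParity 0 (Θ (coord q e.1)) := by
          have := hΘ.hasParity (hasParity_coord (p := q) e.1)
          rwa [e.2] at this
        have := (isNilpotent_of_mem_closure hp.sub_body_mem).map (evalAt p z)
        rw [map_sub, evalAt_tmul, ← Algebra.algebraMap_eq_smul_one, coord_even] at this
        rw [TrivSqZeroExt.fst_sub]
        convert this using 2
        · change (TrivSqZeroExt.inl (φ (SmoothFun.proj e)) +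
            TrivSqZeroExt.inr (evalAt p z (X (SmoothFun.proj e ⊗ₜ 1))) :
              DualNumber (Grassmann p)).fst = _
          simp [hφ]
        · rw [coord_even]
          rfl
    have := congrArg TrivSqZeroExt.snd (DFunLike.congr_fun hψ f)
    change (TrivSqZeroExt.inl (φ f) + TrivSqZeroExt.inr (evalAt p z (X (f ⊗ₜ 1))) :
      DualNumber (Grassmann p)).snd = (TrivSqZeroExt.inl (φ f) : DualNumber (Grassmann p)).snd
      at this
    simpa using this
  have ho : ∀ l : List (OddIdx q), X (1 ⊗ₜ mono l) = 0 := by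
    intro l
    induction l with
    | nil => exact hone
    | cons o l ih =>
      have : (1 ⊗ₜ mono (o :: l) : SuperFun q) = coord q o.1 * (1 ⊗ₜ mono l) := by
        rw [coord_odd, Algebra.TensorProduct.tmul_mul_tmul, mono_cons, mul_one]
      rw [this, hX, ih, h, zero_mul, mul_zero, add_zero]
  refine LinearMap.ext fun f => ?_
  induction f using SuperFun.mono_induction with
  | zero => simp
  | add x y hx hy => rw [map_add, hx, hy, map_add]
  | tmul f l =>
    have : (f ⊗ₜ mono l : SuperFun q) = f ⊗ₜ 1 * 1 ⊗ₜ mono l := by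
      rw [Algebra.TensorProduct.tmul_mul_tmul, mul_one, one_mul]
    rw [this, hX, hs, ho, zero_mul, mul_zero, add_zero, LinearMap.zero_apply]

/-- Superderivations along the same homomorphism that agree on the coordinates are equal. -/
theorem IsSDer.ext {Θ : SuperFun q →ₐ[ℝ] SuperFun p} (hΘ : IsEven Θ) {ε : ZMod 2}
    {X Y : SuperFun q →ₗ[ℝ] SuperFun p} (hX : IsSDer Θ ε X) (hY : IsSDer Θ ε Y)
    (h : ∀ l, X (coord q l) = Y (coord q l)) : X = Y :=
  sub_eq_zero.1 (hom_eq_zero_of_coord hΘ (hX.sub hY).leibniz fun l => by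
    rw [LinearMap.sub_apply, h, sub_self])

/-- The difference of `X` and its suitably signed conjugate by the parity involutions obeys the
Leibniz rule and vanishes on the coordinates. -/
theorem IsSDer.of_leibniz {Θ : SuperFun q →ₐ[ℝ] SuperFun p} (hΘ : IsEven Θ) {ε : ZMod 2}
    {X : SuperFun q →ₗ[ℝ] SuperFun p}
    (hX : ∀ f g, X (f * g) = X f * Θ g + Θ (ParentBRST.twist q ε f) * X g)
    (h : ∀ l, HasParity (q l + ε) (X (coord q l))) : IsSDer Θ ε X := by
  refine ⟨hX, fun f => ?_⟩
  let Y : SuperFun q →ₗ[ℝ] SuperFun p :=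
    sgn ε • (parityInv p).toLinearMap.comp (X.comp (parityInv q).toLinearMap)
  have hY : ∀ f, Y f = sgn ε • parityInv p (X (parityInv q f)) := fun _ => rfl
  have hXY : X - Y = 0 := by
    refine hom_eq_zero_of_coord hΘ (ε := ε) (fun f g => ?_) fun l => ?_
    · simp only [LinearMap.sub_apply, hY, map_mul (parityInv q), map_mul (parityInv p), hX,
        map_add, smul_add]
      have h1 : parityInv p (Θ (ParentBRST.twist q ε (parityInv q f))) =
          Θ (ParentBRST.twist q ε f) := by
        rw [← hΘ]
        rcases zmod2_cases ε with rfl | rfl <;> simp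
      rw [h1, ← hΘ, parityInv_parityInv, sub_mul, mul_sub, smul_mul_assoc, mul_smul_comm]
      abel
    · have h1 : parityInv q (coord q l) = sgn (q l) • coord q l := hasParity_coord l
      have h2 : parityInv p (X (coord q l)) = sgn (q l + ε) • X (coord q l) := h l
      rw [LinearMap.sub_apply, hY, h1, map_smul, map_smul, h2, smul_smul, smul_smul, sgn_add]
      have h3 : sgn ε * (sgn (q l) * (sgn (q l) * sgn ε)) = 1 := by
        rw [← mul_assoc (sgn (q l)), sgn_mul_self, one_mul, sgn_mul_self]
      rw [← mul_assoc, ← mul_assoc] at h3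
      rw [← mul_assoc, h3, one_smul, sub_self]
  have h1 := LinearMap.congr_fun hXY (parityInv q f)
  rw [LinearMap.sub_apply, hY, parityInv_parityInv, LinearMap.zero_apply, sub_eq_zero] at h1
  exact h1

end SDer

/-! ## Vector fields -/

section VectorField

variable {K L M : Type*} {p : K → ZMod 2} {q : L → ZMod 2}

theorem pd_even_tmul (e : EvenIdx p) (f : SmoothFun (EvenIdx p)) (a : Grassmann p) :
    pd p e.1 (f ⊗ₜ a) = SmoothFun.pderiv e f ⊗ₜ a := by
  rw [pd, dif_pos e.2]; rfl

theorem pd_odd_tmul (o : OddIdx p) (f : SmoothFun (EvenIdx p)) (a : Grassmann p) :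
    pd p o.1 (f ⊗ₜ a) = f ⊗ₜ
      (CliffordAlgebra.contractLeft (Q := (0 : QuadraticForm ℝ (OddIdx p →₀ ℝ)))
      (Finsupp.lapply o) a) := by
  rw [pd, dif_neg o.2]; rfl

theorem twist_tmul_of_ne {k : K} (hk : ¬ p k = 0) (f : SmoothFun (EvenIdx p)) (a : Grassmann p) :
    twist p (p k) (f ⊗ₜ a) = f ⊗ₜ invol a := by
  rw [(zmod2_cases (p k)).resolve_left hk, twist_one, parityInv_tmul]

theorem pd_mul (k : K) (f g : SuperFun p) :
    pd p k (f * g) = pd p k f * g + twist p (p k) f * pd p k g := by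
  induction f using TensorProduct.induction_on with
  | zero => simp
  | add x y hx hy => rw [add_mul, map_add, hx, hy, map_add, map_add, add_mul, add_mul]; abel
  | tmul f a =>
    induction g using TensorProduct.induction_on with
    | zero => simp
    | add x y hx hy => rw [mul_add, map_add, hx, hy, map_add, mul_add, mul_add]; abel
    | tmul g b =>
      by_cases hk : p k = 0
      · have h := fun f a => pd_even_tmul (p := p) ⟨k, hk⟩ f a
        dsimp only at h
        rw [Algebra.TensorProduct.tmul_mul_tmul, h, h, h, SmoothFun.pderiv_mul,
          TensorProduct.add_tmul, hk, twist_zero, Algebra.TensorProduct.tmul_mul_tmul,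
          Algebra.TensorProduct.tmul_mul_tmul]
      · have h := fun f a => pd_odd_tmul (p := p) ⟨k, hk⟩ f a
        dsimp only at h
        rw [twist_tmul_of_ne hk, Algebra.TensorProduct.tmul_mul_tmul, h, h, h, contractLeft_mul,
          TensorProduct.tmul_add, Algebra.TensorProduct.tmul_mul_tmul,
          Algebra.TensorProduct.tmul_mul_tmul]

open Classical in
theorem pd_coord (k l : K) : pd p k (coord p l) = if k = l then 1 else 0 := by
  by_cases hk : p k = 0
  · by_cases hl : p l = 0
    · rw [coord_even ⟨l, hl⟩]
      rw [pd_even_tmul ⟨k, hk⟩, SmoothFun.pderiv_proj]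
      by_cases h : k = l
      · subst h; simp; rfl
      · rw [if_neg (by simpa using h), if_neg h, TensorProduct.zero_tmul]
    · rw [coord_odd ⟨l, hl⟩]
      rw [pd_even_tmul ⟨k, hk⟩, SmoothFun.pderiv_one, TensorProduct.zero_tmul, if_neg]
      rintro rfl; exact hl hk
  · by_cases hl : p l = 0
    · rw [coord_even ⟨l, hl⟩]
      rw [pd_odd_tmul ⟨k, hk⟩, CliffordAlgebra.contractLeft_one, TensorProduct.tmul_zero, if_neg]
      rintro rfl; exact hk hl
    · rw [coord_odd ⟨l, hl⟩]
      rw [pd_odd_tmul ⟨k, hk⟩]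
      have : CliffordAlgebra.contractLeft (Q := (0 : QuadraticForm ℝ (OddIdx p →₀ ℝ)))
          (Finsupp.lapply ⟨k, hk⟩) (gen ⟨l, hl⟩) = if k = l then 1 else 0 := by
        refine (CliffordAlgebra.contractLeft_ι _ _ _).trans ?_
        rw [Finsupp.lapply_apply, Finsupp.single_apply]
        simp only [Subtype.mk.injEq, eq_comm (a := l)]
        split_ifs <;> simp
      rw [this]
      split_ifs
      · rfl
      · rw [TensorProduct.tmul_zero]

theorem finite_support_mul_pd (X : K → SuperFun p) (f : SuperFun p) :
    (Function.support fun k => X k * pd p k f).Finite :=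
  (finite_pd p f).subset fun k hk h0 => hk (by
    have : pd p k f = 0 := h0
    simp only [this, mul_zero])

theorem vectorField_apply (X : K → SuperFun p) (f : SuperFun p) :
    vectorField X f = ∑ᶠ k, X k * pd p k f := rfl

@[simp] theorem vectorField_coord (X : K → SuperFun p) (k : K) :
    vectorField X (coord p k) = X k := by
  classical
  rw [vectorField_apply, finsum_eq_single _ k]
  · rw [pd_coord, if_pos rfl, mul_one]
  · intro l hl
    rw [pd_coord, if_neg hl, mul_zero]

theorem isSDer_vectorField {ε : ZMod 2} (X : K → SuperFun p)
    (hX : ∀ k, HasParity (p k + ε) (X k)) : IsSDer (AlgHom.id ℝ _) ε (vectorField X) := by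
  refine IsSDer.of_leibniz IsEven.id (fun f g => ?_) fun k => ?_
  · simp only [vectorField_apply, AlgHom.id_apply]
    rw [finsum_mul' _ _ (finite_support_mul_pd X f), mul_finsum' _ _ (finite_support_mul_pd X g),
      ← finsum_add_distrib]
    · refine finsum_congr fun k => ?_
      -- Moving `X k` past the twisted `f` produces a second twist by `p k`; the two cancel and
      -- leave the twist by `ε`.
      have h := (hX k).mul_comm (twist p (p k) f)
      rw [← twist_add, add_right_comm, zmod2_add_self, zero_add] at h
      rw [pd_mul, mul_add, ← mul_assoc, ← mul_assoc, h, mul_assoc (twist p ε f)]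
    · exact (finite_support_mul_pd X f).subset fun k hk h0 => hk (by
        simp only [h0, zero_mul])
    · exact (finite_support_mul_pd X g).subset fun k hk h0 => hk (by
        simp only [h0, mul_zero])
  · rw [vectorField_coord]; exact hX k

end VectorField

/-! ## The Poincaré lemma for the Euler vector field -/

section Poincare

variable {K L : Type*} {p : K → ZMod 2} {q : L → ZMod 2}

open Classical in
/-- The Euler vector field in the coordinates outside `Q`. -/
noncomputable def eulerField (p : K → ZMod 2) (Q : K → Prop) : SuperFun p →ₗ[ℝ] SuperFun p :=
  vectorField fun k => if Q k then 0 else coord p k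

open Classical in
theorem isSDer_eulerField (Q : K → Prop) :
    IsSDer (AlgHom.id ℝ (SuperFun p)) 0 (eulerField p Q) :=
  isSDer_vectorField _ fun k => by
    rw [add_zero]
    split_ifs
    · exact HasParity.zero _
    · exact hasParity_coord k

open Classical in
theorem eulerField_coord (Q : K → Prop) (k : K) :
    eulerField p Q (coord p k) = if Q k then 0 else coord p k := by
  rw [eulerField, vectorField_coord]

open Classical in
/-- Multiply the coordinates outside `Q` by `t`. -/
noncomputable def superScale (p : K → ZMod 2) (Q : K → Prop) (t : ℝ) :
    SuperFun p →ₐ[ℝ] SuperFun p :=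
  superSubst (fun k => if Q k then coord p k else t • coord p k) fun k => by
    split_ifs
    · exact hasParity_coord k
    · exact (hasParity_coord k).smul t

open Classical in
theorem superScale_coord (Q : K → Prop) (t : ℝ) (k : K) :
    superScale p Q t (coord p k) = if Q k then coord p k else t • coord p k :=
  superSubst_coord _ _ k

theorem isEven_superScale (Q : K → Prop) (t : ℝ) : IsEven (superScale p Q t) :=
  isEven_superSubst _ _

theorem superScale_smooth (Q : K → Prop) (t : ℝ) (f : SmoothFun (EvenIdx p)) :
    superScale p Q t (f ⊗ₜ 1) = SmoothFun.scale (fun e : EvenIdx p => Q e) t f ⊗ₜ 1 := by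
  classical
  have : (superScale p Q t).comp Algebra.TensorProduct.includeLeft =
      (Algebra.TensorProduct.includeLeft : SmoothFun (EvenIdx p) →ₐ[ℝ] SuperFun p).comp
        (SmoothFun.scale (fun e : EvenIdx p => Q e) t) := by
    have h : ∀ e : EvenIdx p, (superScale p Q t) (SmoothFun.proj e ⊗ₜ 1) =
        if Q e then coord p e.1 else t • coord p e.1 := by
      intro e
      rw [← coord_even, superScale_coord]
    refine SmoothFun.algHom_ext_super (fun e => ?_) fun e => ?_
    · rw [AlgHom.comp_apply, Algebra.TensorProduct.includeLeft_apply]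
      exact (isEven_superScale Q t).hasParity (hasParity_tmul_one _)
    · rw [AlgHom.comp_apply, Algebra.TensorProduct.includeLeft_apply, h, AlgHom.comp_apply,
        SmoothFun.scale, SmoothFun.subst_proj, Algebra.TensorProduct.includeLeft_apply]
      split_ifs
      · rw [coord_even]
      · rw [coord_even, ← TensorProduct.smul_tmul']
  exact DFunLike.congr_fun this f

theorem eulerField_smooth (Q : K → Prop) {f : SmoothFun (EvenIdx p)} {T : Finset (EvenIdx p)}
    (hT : SmoothFun.DependsOn f T) :
    eulerField p Q (f ⊗ₜ 1) = SmoothFun.euler (fun e : EvenIdx p => Q e) T f ⊗ₜ 1 := by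
  classical
  have h : ∀ k, k ∉ T.image Subtype.val →
      (if Q k then 0 else coord p k) * pd p k (f ⊗ₜ 1) = 0 := by
    intro k hk
    by_cases hp : p k = 0
    · have h1 : (⟨k, hp⟩ : EvenIdx p) ∉ T := fun h => hk (Finset.mem_image_of_mem _ h)
      have h2 := pd_even_tmul (p := p) ⟨k, hp⟩ f 1
      dsimp only at h2
      rw [h2, SmoothFun.pderiv_eq_zero hT h1, TensorProduct.zero_tmul, mul_zero]
    · have h2 := pd_odd_tmul (p := p) ⟨k, hp⟩ f 1
      dsimp only at h2
      rw [h2, CliffordAlgebra.contractLeft_one, TensorProduct.tmul_zero, mul_zero]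
  rw [eulerField, vectorField_apply, finsum_eq_sum_of_support_subset (s := T.image Subtype.val) _
    fun k hk => by by_contra hc; exact hk (h k hc)]
  rw [Finset.sum_image (fun _ _ _ _ h => Subtype.ext h), SmoothFun.euler, Finset.sum_filter,
    TensorProduct.sum_tmul]
  refine Finset.sum_congr rfl fun e _ => ?_
  rw [pd_even_tmul, ite_not]
  split_ifs
  · rw [zero_mul, TensorProduct.zero_tmul]
  · rw [coord_even, Algebra.TensorProduct.tmul_mul_tmul, mul_one]

open Classical in
/-- The number of generators outside `Q` in a list. -/
noncomputable def weight (Q : K → Prop) (l : List (OddIdx p)) : ℕ :=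
  l.countP fun o => ¬ Q o.1

theorem eulerField_mono (Q : K → Prop) (l : List (OddIdx p)) :
    eulerField p Q (1 ⊗ₜ mono l) = (weight Q l : ℝ) • (1 ⊗ₜ mono l) := by
  classical
  induction l with
  | nil =>
    have : (1 ⊗ₜ mono [] : SuperFun p) = 1 := rfl
    rw [this, (isSDer_eulerField Q).map_one]
    simp [weight]
  | cons o l ih =>
    have : (1 ⊗ₜ mono (o :: l) : SuperFun p) = coord p o.1 * (1 ⊗ₜ mono l) := by
      rw [coord_odd, Algebra.TensorProduct.tmul_mul_tmul, mono_cons, mul_one]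
    rw [this, (isSDer_eulerField Q).leibniz, ih, eulerField_coord, twist_zero, AlgHom.id_apply,
      AlgHom.id_apply, mul_smul_comm]
    have hw : weight Q (o :: l) = weight Q l + if Q o.1 then 0 else 1 := by
      simp only [weight, List.countP_cons]
      by_cases h : Q o.1 <;> simp [h]
    rw [hw]
    split_ifs
    · rw [zero_mul, zero_add, add_zero]
    · rw [Nat.cast_add, Nat.cast_one, add_smul, one_smul, add_comm]

theorem superScale_mono (Q : K → Prop) (t : ℝ) (l : List (OddIdx p)) :
    superScale p Q t (1 ⊗ₜ mono l) = t ^ weight Q l • (1 ⊗ₜ mono l) := by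
  classical
  induction l with
  | nil =>
    have : (1 ⊗ₜ mono [] : SuperFun p) = 1 := rfl
    rw [this, map_one]
    simp [weight]
  | cons o l ih =>
    have : (1 ⊗ₜ mono (o :: l) : SuperFun p) = coord p o.1 * (1 ⊗ₜ mono l) := by
      rw [coord_odd, Algebra.TensorProduct.tmul_mul_tmul, mono_cons, mul_one]
    rw [this, map_mul, ih, superScale_coord, mul_smul_comm]
    have hw : weight Q (o :: l) = weight Q l + if Q o.1 then 0 else 1 := by
      simp only [weight, List.countP_cons]
      by_cases h : Q o.1 <;> simp [h]
    rw [hw]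
    split_ifs
    · rw [add_zero]
    · rw [smul_mul_assoc, smul_smul, pow_succ]

theorem tmul_mono_eq (f : SmoothFun (EvenIdx p)) (a : Grassmann p) :
    (f ⊗ₜ a : SuperFun p) = f ⊗ₜ 1 * 1 ⊗ₜ a := by
  rw [Algebra.TensorProduct.tmul_mul_tmul, mul_one, one_mul]

theorem eulerField_tmul_mono (Q : K → Prop) {f : SmoothFun (EvenIdx p)} {T : Finset (EvenIdx p)}
    (hT : SmoothFun.DependsOn f T) (l : List (OddIdx p)) : eulerField p Q (f ⊗ₜ mono l) =
      (SmoothFun.euler (fun e : EvenIdx p => Q e) T f + (weight Q l : ℝ) • f) ⊗ₜ mono l := by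
  rw [tmul_mono_eq, (isSDer_eulerField Q).leibniz, eulerField_smooth Q hT, eulerField_mono,
    twist_zero, AlgHom.id_apply, AlgHom.id_apply, ← tmul_mono_eq, mul_smul_comm, ← tmul_mono_eq,
    TensorProduct.add_tmul, ← TensorProduct.smul_tmul']

theorem superScale_tmul_mono (Q : K → Prop) (t : ℝ) (f : SmoothFun (EvenIdx p))
    (l : List (OddIdx p)) : superScale p Q t (f ⊗ₜ mono l) =
      (t ^ weight Q l • SmoothFun.scale (fun e : EvenIdx p => Q e) t f) ⊗ₜ mono l := by
  rw [tmul_mono_eq, map_mul, superScale_smooth, superScale_mono, mul_smul_comm, ← tmul_mono_eq,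
    ← TensorProduct.smul_tmul']

/-- The homomorphism that puts the coordinates outside `Q` to zero. -/
noncomputable abbrev restrictTo (p : K → ZMod 2) (Q : K → Prop) : SuperFun p →ₐ[ℝ] SuperFun p :=
  superScale p Q 0

open Classical in
theorem restrictTo_coord (Q : K → Prop) (k : K) :
    restrictTo p Q (coord p k) = if Q k then coord p k else 0 := by
  rw [restrictTo, superScale_coord, zero_smul]

/-- On `f ⊗ mono l` the vector field acts on the coefficient as `euler + weight Q l`, which
`SmoothFun.DependsOn.exists_euler_eq` inverts. Its factor `0 ^ j` matches the fact that putting the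
coordinates outside `Q` to zero kills every monomial of positive weight. -/
theorem exists_eulerField_eq (Q : K → Prop) (f : SuperFun p) :
    ∃ k, eulerField p Q k = f - restrictTo p Q f := by
  induction f using SuperFun.mono_induction with
  | zero => exact ⟨0, by simp⟩
  | add x y hx hy =>
    obtain ⟨k, hk⟩ := hx
    obtain ⟨k', hk'⟩ := hy
    exact ⟨k + k', by rw [map_add, hk, hk', map_add]; abel⟩
  | tmul f l =>
    obtain ⟨T, hT⟩ := SmoothFun.exists_dependsOn f
    obtain ⟨k, hkT, hk⟩ := hT.exists_euler_eq (fun e : EvenIdx p => Q e) (weight Q l)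
    refine ⟨k ⊗ₜ mono l, ?_⟩
    rw [eulerField_tmul_mono Q hkT, hk, superScale_tmul_mono, TensorProduct.sub_tmul]

theorem exists_eulerField_eq_of_hasParity (Q : K → Prop) {ε : ZMod 2} {f : SuperFun p}
    (hf : HasParity ε f) (h0 : restrictTo p Q f = 0) :
    ∃ k, HasParity ε k ∧ eulerField p Q k = f := by
  obtain ⟨k, hk⟩ := exists_eulerField_eq Q f
  rw [h0, sub_zero] at hk
  -- The component of `k` of parity `ε`; it is still a solution because the Euler vector field is
  -- even.
  refine ⟨(1 / 2 : ℝ) • (k + sgn ε • parityInv p k), ?_, ?_⟩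
  · refine HasParity.smul _ ?_
    rw [HasParity, map_add, map_smul, parityInv_parityInv, smul_add, smul_smul, sgn_mul_self,
      one_smul, add_comm]
  · have hf' : parityInv p f = sgn ε • f := hf
    rw [map_smul, map_add, map_smul, (isSDer_eulerField Q).parity, hk, hf', sgn_zero, one_smul,
      smul_smul, sgn_mul_self, one_smul, ← two_smul ℝ, smul_smul, one_div,
      inv_mul_cancel₀ two_ne_zero, one_smul]

/-- The functional `b` makes the scaling flow real-valued, so that one-variable calculus applies
without a topology on the Grassmann algebra. -/
theorem hasDerivAt_superScale (Q : K → Prop) (z : EvenIdx p → ℝ) (b : Grassmann p →ₗ[ℝ] ℝ)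
    (f : SuperFun p) (t : ℝ) : ∃ d,
      HasDerivAt (fun s => b (evalAt p z (superScale p Q s f))) d t ∧
        t * d = b (evalAt p z (superScale p Q t (eulerField p Q f))) := by
  induction f using SuperFun.mono_induction with
  | zero => exact ⟨0, by simpa using hasDerivAt_const t (0 : ℝ), by simp⟩
  | add x y hx hy =>
    obtain ⟨d, hd, h⟩ := hx
    obtain ⟨d', hd', h'⟩ := hy
    refine ⟨d + d', ?_, ?_⟩
    · refine (hd.add hd').congr_of_eventuallyEq (Filter.Eventually.of_forall fun s => ?_)
      simp only [map_add, Pi.add_apply]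
    · rw [mul_add, h, h']
      simp only [map_add]
  | tmul f l =>
    obtain ⟨T, hT⟩ := SmoothFun.exists_dependsOn f
    obtain ⟨d, hd, h⟩ := hT.hasDerivAt_scale (fun e : EvenIdx p => Q e) z t
    have h1 : ∀ (g : SmoothFun (EvenIdx p)) s, b (evalAt p z (superScale p Q s (g ⊗ₜ mono l))) =
        s ^ weight Q l * g.1 (scalePt (fun e : EvenIdx p => Q e) 0 s z) * b (mono l) := by
      intro g s
      rw [superScale_tmul_mono, evalAt_tmul, map_smul, smul_eq_mul, ← SmoothFun.scale_apply]
      rfl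
    simp only [h1, eulerField_tmul_mono Q hT]
    refine ⟨_, ((hasDerivAt_pow (weight Q l) t).mul hd).mul_const _, ?_⟩
    have h2 : (SmoothFun.euler (fun e : EvenIdx p => Q e) T f + (weight Q l : ℝ) • f).1
        (scalePt (fun e : EvenIdx p => Q e) 0 t z) = t * d +
        (weight Q l : ℝ) * f.1 (scalePt (fun e : EvenIdx p => Q e) 0 t z) := by
      rw [h]; rfl
    rw [h2]
    rcases Nat.eq_zero_or_pos (weight Q l) with h0 | h0
    · rw [h0]; simp; ring
    · obtain ⟨j, hj⟩ := Nat.exists_eq_succ_of_ne_zero h0.ne'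
      rw [hj]
      simp only [Nat.succ_eq_add_one, Nat.add_sub_cancel, pow_succ]
      ring

theorem superScale_one (Q : K → Prop) : superScale p Q 1 = AlgHom.id ℝ _ := by
  classical
  refine (isEven_superScale Q 1).ext fun k => ?_
  rw [superScale_coord, one_smul, ite_self]; rfl

/-- A function annihilated by the Euler vector field does not depend on the coordinates
outside `Q`. -/
theorem restrictTo_of_eulerField_eq_zero (Q : K → Prop) {f : SuperFun p}
    (h : eulerField p Q f = 0) : restrictTo p Q f = f := by
  refine ext_evalAt fun z => ?_
  refine (Module.forall_dual_apply_eq_zero_iff ℝ _).1 (fun b => ?_) |> sub_eq_zero.1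
  choose d hd hd' using fun t => hasDerivAt_superScale Q z b f t
  have hcont : Continuous fun s => b (evalAt p z (superScale p Q s f)) :=
    continuous_iff_continuousAt.2 fun t => (hd t).continuousAt
  -- Along the scaling flow `f` is constant for `t > 0`, and by continuity down to `t = 0`. The
  -- endpoints are the restriction and the identity.
  have hderiv : ∀ t ∈ Set.Ioo (0 : ℝ) 1,
      HasDerivAt (fun s => b (evalAt p z (superScale p Q s f))) 0 t := by
    intro t ht
    have h1 := hd' t
    rw [h, map_zero, map_zero, map_zero] at h1
    have := (mul_eq_zero.1 h1).resolve_left ht.1.ne'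
    rw [← this]; exact hd t
  obtain ⟨c, hc, hc'⟩ := exists_hasDerivAt_eq_slope _ (fun _ => 0) zero_lt_one
    hcont.continuousOn hderiv
  rw [sub_zero, div_one, superScale_one] at hc'
  rw [map_sub, ← neg_sub, neg_eq_zero]
  exact hc'.symm

/-- Such an `f` is the Euler vector field applied to some `k`, hence a sum of coordinates outside
`Q` times derivatives of `k`. Supercommutativity moves the coordinate to the right, as ideals are
left ideals here. -/
theorem mem_span_coord_of_restrictTo_eq_zero (Q : K → Prop) {f : SuperFun p}
    (h0 : restrictTo p Q f = 0) : f ∈ Ideal.span {g | ∃ k, ¬ Q k ∧ g = coord p k} := by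
  classical
  obtain ⟨k, hk⟩ := exists_eulerField_eq Q f
  rw [h0, sub_zero] at hk
  rw [← hk, eulerField, vectorField_apply]
  refine finsum_induction (· ∈ Ideal.span {g | ∃ k, ¬ Q k ∧ g = coord p k}) (zero_mem _)
    (fun _ _ => add_mem) fun l => ?_
  split_ifs with hl
  · rw [zero_mul]; exact zero_mem _
  · rw [(hasParity_coord l).mul_comm]
    exact Ideal.mul_mem_left _ _ (Ideal.subset_span ⟨l, hl, rfl⟩)

end Poincare

/-! ## Functions of some of the coordinates only -/

section OnlyIn

variable {K L M : Type*} {p : K → ZMod 2} {q : L → ZMod 2} {r : M → ZMod 2}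

/-- The superfunctions that depend on the coordinates in `Q` only. -/
noncomputable def onlyIn (p : K → ZMod 2) (Q : K → Prop) : Subalgebra ℝ (SuperFun p) :=
  AlgHom.equalizer (restrictTo p Q) (AlgHom.id ℝ _)

theorem mem_onlyIn {Q : K → Prop} {f : SuperFun p} :
    f ∈ onlyIn p Q ↔ restrictTo p Q f = f := Iff.rfl

theorem coord_mem_onlyIn {Q : K → Prop} {k : K} (hk : Q k) : coord p k ∈ onlyIn p Q := by
  rw [mem_onlyIn, restrictTo_coord, if_pos hk]

theorem isEven_restrictTo (Q : K → Prop) : IsEven (restrictTo p Q) := isEven_superScale Q 0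

/-- Composition with `restrictTo` sends the other coordinates to zero, so that agreement on all
coordinates becomes available. -/
theorem hom_eq_of_onlyIn {Q : K → Prop} {Θ₁ Θ₂ : SuperFun p →ₐ[ℝ] SuperFun q} (h₁ : IsEven Θ₁)
    (h : ∀ k, Q k → Θ₁ (coord p k) = Θ₂ (coord p k)) {f : SuperFun p} (hf : f ∈ onlyIn p Q) :
    Θ₁ f = Θ₂ f := by
  have : Θ₁.comp (restrictTo p Q) = Θ₂.comp (restrictTo p Q) := by
    refine (h₁.comp (isEven_restrictTo Q)).ext fun k => ?_
    rw [AlgHom.comp_apply, AlgHom.comp_apply, restrictTo_coord]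
    split_ifs with hk
    · exact h k hk
    · rw [map_zero, map_zero]
  have h2 := DFunLike.congr_fun this f
  rwa [AlgHom.comp_apply, AlgHom.comp_apply, mem_onlyIn.1 hf] at h2

theorem der_eq_of_onlyIn {Q : K → Prop} {Θ₁ Θ₂ : SuperFun p →ₐ[ℝ] SuperFun q} (h₁ : IsEven Θ₁)
    (h : ∀ k, Q k → Θ₁ (coord p k) = Θ₂ (coord p k)) {ε : ZMod 2}
    {X Y : SuperFun p →ₗ[ℝ] SuperFun q} (hX : IsSDer Θ₁ ε X) (hY : IsSDer Θ₂ ε Y)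
    (hXY : ∀ k, Q k → X (coord p k) = Y (coord p k)) {f : SuperFun p} (hf : f ∈ onlyIn p Q) :
    X f = Y f := by
  have h0 : Θ₁.comp (restrictTo p Q) = Θ₂.comp (restrictTo p Q) :=
    AlgHom.ext fun g => hom_eq_of_onlyIn h₁ h (f := restrictTo p Q g) (by
      rw [mem_onlyIn]
      have : (restrictTo p Q).comp (restrictTo p Q) = restrictTo p Q := by
        refine ((isEven_restrictTo Q).comp (isEven_restrictTo Q)).ext fun k => ?_
        rw [AlgHom.comp_apply, restrictTo_coord]
        split_ifs with hk
        · rw [restrictTo_coord, if_pos hk]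
        · rw [map_zero]
      exact DFunLike.congr_fun this g)
  have h1 := hX.comp_right (isEven_restrictTo Q)
  have h2 := hY.comp_right (isEven_restrictTo Q)
  rw [← h0] at h2
  have := h1.ext (h₁.comp (isEven_restrictTo Q)) h2 fun k => by
    rw [LinearMap.comp_apply, LinearMap.comp_apply, AlgHom.toLinearMap_apply, restrictTo_coord]
    split_ifs with hk
    · exact hXY k hk
    · rw [map_zero, map_zero]
  have h3 := LinearMap.congr_fun this f
  rwa [LinearMap.comp_apply, LinearMap.comp_apply, AlgHom.toLinearMap_apply,
    mem_onlyIn.1 hf] at h3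

/-- Membership is the equation between `Θ f` and its restriction, so it is an instance of uniqueness
of homomorphisms. The version for derivations below is why `der_eq_of_onlyIn` admits two different
homomorphisms. -/
theorem hom_mem_onlyIn {Q : K → Prop} {Q' : L → Prop} {Θ : SuperFun p →ₐ[ℝ] SuperFun q}
    (hΘ : IsEven Θ) (h : ∀ k, Q k → Θ (coord p k) ∈ onlyIn q Q') {f : SuperFun p}
    (hf : f ∈ onlyIn p Q) : Θ f ∈ onlyIn q Q' :=
  hom_eq_of_onlyIn (Θ₁ := (restrictTo q Q').comp Θ) ((isEven_restrictTo Q').comp hΘ)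
    (fun k hk => h k hk) hf

theorem restrictTo_mem (Q : K → Prop) (f : SuperFun p) : restrictTo p Q f ∈ onlyIn p Q := by
  have h : (restrictTo p Q).comp (restrictTo p Q) = restrictTo p Q := by
    refine ((isEven_restrictTo Q).comp (isEven_restrictTo Q)).ext fun k => ?_
    rw [AlgHom.comp_apply, restrictTo_coord]
    split_ifs with hk
    · rw [restrictTo_coord, if_pos hk]
    · rw [map_zero]
  exact DFunLike.congr_fun h f

theorem onlyIn_mono {Q Q' : K → Prop} (h : ∀ k, Q k → Q' k) {f : SuperFun p}
    (hf : f ∈ onlyIn p Q) : f ∈ onlyIn p Q' :=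
  hom_mem_onlyIn (Θ := AlgHom.id ℝ _) IsEven.id (fun k hk => coord_mem_onlyIn (h k hk)) hf

theorem der_mem_onlyIn {Q : K → Prop} {Q' : L → Prop} {Θ : SuperFun p →ₐ[ℝ] SuperFun q}
    (hΘ : IsEven Θ) {ε : ZMod 2} {X : SuperFun p →ₗ[ℝ] SuperFun q} (hX : IsSDer Θ ε X)
    (h : ∀ k, Q k → Θ (coord p k) ∈ onlyIn q Q')
    (h' : ∀ k, Q k → X (coord p k) ∈ onlyIn q Q') {f : SuperFun p}
    (hf : f ∈ onlyIn p Q) : X f ∈ onlyIn q Q' :=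
  der_eq_of_onlyIn ((isEven_restrictTo Q').comp hΘ) (fun k hk => h k hk)
    (hX.comp_left (isEven_restrictTo Q')) hX (fun k hk => h' k hk) hf

theorem eulerField_restrictTo (Q Q' : K → Prop) (f : SuperFun p) :
    eulerField p Q (restrictTo p Q' f) = restrictTo p Q' (eulerField p Q f) := by
  classical
  have := ((isSDer_eulerField (p := p) Q).comp_right (isEven_restrictTo Q')).ext
    (IsEven.id.comp (isEven_restrictTo Q'))
    ((isSDer_eulerField Q).comp_left (isEven_restrictTo Q')) fun k => by
      rw [LinearMap.comp_apply, LinearMap.comp_apply, AlgHom.toLinearMap_apply, restrictTo_coord,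
        eulerField_coord]
      by_cases h : Q' k <;> by_cases h' : Q k <;>
        simp [h, h', eulerField_coord, restrictTo_coord]
  exact LinearMap.congr_fun this f

end OnlyIn

/-! ## Supercommutators -/

section SuperComm

variable {K L M : Type*} {p : K → ZMod 2} {q : L → ZMod 2} {r : M → ZMod 2}

theorem IsSDer.superComm {ε δ : ZMod 2} {X Y : SuperFun p →ₗ[ℝ] SuperFun p}
    (hX : IsSDer (AlgHom.id ℝ _) ε X) (hY : IsSDer (AlgHom.id ℝ _) δ Y) :
    IsSDer (AlgHom.id ℝ _) (ε + δ) (X ∘ₗ Y - sgn (ε * δ) • Y ∘ₗ X) where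
  leibniz f g := by
    simp only [LinearMap.sub_apply, LinearMap.smul_apply, LinearMap.comp_apply, hX.leibniz,
      hY.leibniz, AlgHom.id_apply, map_add]
    have h1 : ParentBRST.twist p ε (Y f) = sgn (ε * δ) • Y (ParentBRST.twist p ε f) := by
      rw [hY.twist, smul_smul, sgn_mul_self, one_smul]
    have h2 : X (ParentBRST.twist p δ f) = sgn (ε * δ) • ParentBRST.twist p δ (X f) := by
      rw [hX.twist, mul_comm]
    have h3 : ParentBRST.twist p (ε + δ) f = ParentBRST.twist p ε (ParentBRST.twist p δ f) :=
      twist_add _ _ _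
    have h4 : ParentBRST.twist p δ (ParentBRST.twist p ε f) =
        ParentBRST.twist p ε (ParentBRST.twist p δ f) := by
      rw [← twist_add, ← twist_add, add_comm]
    rw [h1, h2, h3, h4]
    simp only [smul_add, sub_mul, mul_sub, smul_mul_assoc, mul_smul_comm]
    abel
  parity f := by
    simp only [LinearMap.sub_apply, LinearMap.smul_apply, LinearMap.comp_apply, hX.parity,
      hY.parity, map_smul, map_sub, smul_sub, smul_smul, sgn_add]
    congr 2 <;> ring

theorem IsSDer.superComm_of_coord {ε δ : ZMod 2} {X Y Z : SuperFun p →ₗ[ℝ] SuperFun p}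
    (hX : IsSDer (AlgHom.id ℝ _) ε X) (hY : IsSDer (AlgHom.id ℝ _) δ Y)
    (hZ : IsSDer (AlgHom.id ℝ _) (ε + δ) Z)
    (h : ∀ k, X (Y (coord p k)) - sgn (ε * δ) • Y (X (coord p k)) = Z (coord p k))
    (f : SuperFun p) : X (Y f) - sgn (ε * δ) • Y (X f) = Z f :=
  LinearMap.congr_fun ((hX.superComm hY).ext IsEven.id hZ h) f

theorem IsSDer.comm_of_coord {ε : ZMod 2} {X Y : SuperFun p →ₗ[ℝ] SuperFun p}
    (hX : IsSDer (AlgHom.id ℝ _) ε X) (hY : IsSDer (AlgHom.id ℝ _) 0 Y)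
    (h : ∀ k, X (Y (coord p k)) = Y (X (coord p k))) (f : SuperFun p) : X (Y f) = Y (X f) := by
  have := hX.superComm_of_coord hY (IsSDer.zero _ _) (fun k => by
    rw [h, mul_zero, sgn_zero, one_smul, sub_self, LinearMap.zero_apply]) f
  rwa [mul_zero, sgn_zero, one_smul, LinearMap.zero_apply, sub_eq_zero] at this

theorem IsSDer.anticomm {X Y : SuperFun p →ₗ[ℝ] SuperFun p}
    (hX : IsSDer (AlgHom.id ℝ _) 1 X) (hY : IsSDer (AlgHom.id ℝ _) 1 Y) :
    IsSDer (AlgHom.id ℝ _) 0 (X ∘ₗ Y + Y ∘ₗ X) := by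
  have h := hX.superComm hY
  have h2 : X ∘ₗ Y - sgn (1 * 1) • Y ∘ₗ X = X ∘ₗ Y + Y ∘ₗ X := LinearMap.ext fun f => by
    rw [LinearMap.sub_apply, LinearMap.smul_apply, LinearMap.add_apply, mul_one, sgn_one,
      neg_one_smul, sub_neg_eq_add]
  rwa [h2] at h

theorem IsSDer.sq {X : SuperFun p →ₗ[ℝ] SuperFun p}
    (hX : IsSDer (AlgHom.id ℝ _) 1 X) : IsSDer (AlgHom.id ℝ _) 0 (X ∘ₗ X) := by
  have := (hX.anticomm hX).smul (1 / 2)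
  rwa [← two_smul ℝ, smul_smul, one_div, inv_mul_cancel₀ two_ne_zero, one_smul] at this

theorem IsSDer.comm {ε : ZMod 2} {X Y : SuperFun p →ₗ[ℝ] SuperFun p}
    (hX : IsSDer (AlgHom.id ℝ _) ε X) (hY : IsSDer (AlgHom.id ℝ _) 0 Y) :
    IsSDer (AlgHom.id ℝ _) ε (X ∘ₗ Y - Y ∘ₗ X) := by
  have := hX.superComm hY
  rwa [mul_zero, sgn_zero, one_smul, add_zero] at this

theorem intertwine_of_coord {Θ : SuperFun p →ₐ[ℝ] SuperFun q} (hΘ : IsEven Θ) {ε : ZMod 2}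
    {X : SuperFun p →ₗ[ℝ] SuperFun p} {Y : SuperFun q →ₗ[ℝ] SuperFun q}
    (hX : IsSDer (AlgHom.id ℝ _) ε X) (hY : IsSDer (AlgHom.id ℝ _) ε Y)
    (h : ∀ k, Θ (X (coord p k)) = Y (Θ (coord p k))) (f : SuperFun p) : Θ (X f) = Y (Θ f) :=
  LinearMap.congr_fun ((hX.comp_left hΘ).ext hΘ (hY.comp_right hΘ) h) f

theorem IsSDer.conj {Φ : SuperFun p ≃ₐ[ℝ] SuperFun q} (hΦ : IsEven (Φ : SuperFun p →ₐ[ℝ] SuperFun q))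
    (hΦ' : IsEven (Φ.symm : SuperFun q →ₐ[ℝ] SuperFun p)) {ε : ZMod 2}
    {X : SuperFun p →ₗ[ℝ] SuperFun p} (hX : IsSDer (AlgHom.id ℝ _) ε X) :
    IsSDer (AlgHom.id ℝ _) ε
      (Φ.toLinearMap ∘ₗ X ∘ₗ Φ.symm.toLinearMap : SuperFun q →ₗ[ℝ] SuperFun q) := by
  have := (hX.comp_right hΦ').comp_left hΦ
  have h2 : (Φ : SuperFun p →ₐ[ℝ] SuperFun q).comp
      ((AlgHom.id ℝ _).comp (Φ.symm : SuperFun q →ₐ[ℝ] SuperFun p)) = AlgHom.id ℝ _ :=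
    AlgHom.ext fun f => Φ.apply_symm_apply f
  rw [h2] at this
  exact this

theorem isEven_symm {Φ : SuperFun p ≃ₐ[ℝ] SuperFun q}
    (hΦ : IsEven (Φ : SuperFun p →ₐ[ℝ] SuperFun q)) :
    IsEven (Φ.symm : SuperFun q →ₐ[ℝ] SuperFun p) := fun f => by
  apply Φ.injective
  have h := hΦ (Φ.symm f)
  change Φ (parityInv p (Φ.symm f)) = parityInv q (Φ (Φ.symm f)) at h
  change Φ (Φ.symm _) = Φ (parityInv p (Φ.symm f))
  rw [h, Φ.apply_symm_apply, Φ.apply_symm_apply]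

end SuperComm

/-! ## Jets -/

section JetLemmas

variable {F G : Type*} {n : ℕ} {p : F → ZMod 2} {q : G → ZMod 2}

theorem isSDer_totalD (p : F → ZMod 2) (μ : Fin n) :
    IsSDer (AlgHom.id ℝ (LocalFun n p)) 0 (totalD p μ) := by
  refine isSDer_vectorField _ ?_
  rintro (ν | k)
  · change HasParity 0 (if ν = μ then (1 : LocalFun n p) else 0)
    split_ifs
    · exact HasParity.one
    · exact HasParity.zero _
  · simp only [Sum.elim_inr, add_zero]
    exact hasParity_coord (p := jetParity n p) (Sum.inr (k.1, k.2 + Pi.single μ 1))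

theorem totalD_xCoord (p : F → ZMod 2) (μ ν : Fin n) :
    totalD p μ (xCoord p ν) = if ν = μ then 1 else 0 :=
  vectorField_coord _ _

theorem totalD_jetCoord (p : F → ZMod 2) (μ : Fin n) (A : F) (m : Fin n → ℕ) :
    totalD p μ (jetCoord p A m) = jetCoord p A (m + Pi.single μ 1) :=
  vectorField_coord _ _

theorem totalD_totalD_xCoord (p : F → ZMod 2) (μ ν κ : Fin n) :
    totalD p μ (totalD p ν (xCoord p κ)) = 0 := by
  rw [totalD_xCoord]
  split_ifs
  · exact (isSDer_totalD p μ).map_one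
  · rw [map_zero]

theorem totalD_comm (p : F → ZMod 2) (μ ν : Fin n) (f : LocalFun n p) :
    totalD p μ (totalD p ν f) = totalD p ν (totalD p μ f) := by
  refine (isSDer_totalD p μ).comm_of_coord (isSDer_totalD p ν) ?_ f
  rintro (κ | k)
  · rw [totalD_totalD_xCoord, totalD_totalD_xCoord]
  · change totalD p μ (totalD p ν (jetCoord p k.1 k.2)) =
      totalD p ν (totalD p μ (jetCoord p k.1 k.2))
    rw [totalD_jetCoord, totalD_jetCoord, totalD_jetCoord, totalD_jetCoord, add_right_comm]

/-- By commutativity one factor `a i` moves to the front for each occurrence of `i` in the list. -/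
theorem prod_map_pow_add_single {M : Type*} [Monoid M] {ι : Type*} [DecidableEq ι] (a : ι → M)
    (ha : ∀ i j, Commute (a i) (a j)) (m : ι → ℕ) (i : ι) (l : List ι) :
    (l.map fun j => a j ^ (m + Pi.single i 1 : ι → ℕ) j).prod =
      a i ^ l.count i * (l.map fun j => a j ^ m j).prod := by
  induction l with
  | nil => simp
  | cons j l ih =>
    rw [List.map_cons, List.prod_cons, ih, List.map_cons, List.prod_cons, List.count_cons]
    by_cases h : j = i
    · subst h
      simp only [Pi.add_apply, Pi.single_eq_same, beq_self_eq_true, if_true]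
      rw [← mul_assoc, ← mul_assoc, ← pow_add, ← pow_add]
      congr 2
      omega
    · have : (j == i) = false := by simpa using h
      simp only [Pi.add_apply, Pi.single_eq_of_ne h, add_zero, this, Bool.false_eq_true, if_false]
      rw [← mul_assoc, ← mul_assoc, ((ha j i).pow_pow _ _).eq]

@[simp] theorem totalDs_zero (p : F → ZMod 2) (f : LocalFun n p) : totalDs p 0 f = f := by
  simp [totalDs]

theorem totalDs_add_single (p : F → ZMod 2) (m : Fin n → ℕ) (μ : Fin n) (f : LocalFun n p) :
    totalDs p (m + Pi.single μ 1) f = totalD p μ (totalDs p m f) := by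
  rw [totalDs, prod_map_pow_add_single (totalD p) (fun i j => LinearMap.ext (totalD_comm p i j)),
    List.count_eq_one_of_mem (List.nodup_finRange n) (List.mem_finRange μ), pow_one]
  rfl

theorem multiIdx_induction {P : (Fin n → ℕ) → Prop} (zero : P 0)
    (add : ∀ m μ, P m → P (m + Pi.single μ 1)) (m : Fin n → ℕ) : P m := by
  obtain ⟨N, hN⟩ : ∃ N, ∑ μ, m μ = N := ⟨_, rfl⟩
  induction N generalizing m with
  | zero =>
    have : m = 0 := funext fun μ => by
      have := Finset.sum_eq_zero_iff.1 hN μ (Finset.mem_univ μ)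
      simpa using this
    rwa [this]
  | succ N ih =>
    obtain ⟨μ, -, hμ⟩ : ∃ μ ∈ Finset.univ, m μ ≠ 0 := by
      by_contra! h
      rw [Finset.sum_eq_zero h] at hN
      omega
    have hm : m = (m - Pi.single μ 1) + Pi.single μ 1 := by
      funext ν
      by_cases h : ν = μ
      · subst h; simp; omega
      · simp [Pi.single_eq_of_ne h]
    rw [hm]
    refine add _ _ (ih _ ?_)
    have : ∑ ν, m ν = ∑ ν, (m - Pi.single μ 1 : Fin n → ℕ) ν + ∑ ν, (Pi.single μ 1 : Fin n → ℕ) ν := by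
      rw [← Finset.sum_add_distrib]
      exact Finset.sum_congr rfl fun ν _ => congrFun hm ν
    rw [Finset.sum_pi_single' ] at this
    simp only [Finset.mem_univ, if_true] at this
    omega

theorem totalDs_jetCoord (p : F → ZMod 2) (A : F) (m m' : Fin n → ℕ) :
    totalDs p m (jetCoord p A m') = jetCoord p A (m' + m) := by
  induction m using multiIdx_induction with
  | zero => rw [totalDs_zero, add_zero]
  | add m μ ih => rw [totalDs_add_single, ih, totalD_jetCoord, add_assoc]

theorem jetCoord_eq_totalDs (p : F → ZMod 2) (A : F) (m : Fin n → ℕ) :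
    jetCoord p A m = totalDs p m (jetCoord p A 0) := by rw [totalDs_jetCoord, zero_add]

theorem hasParity_totalD {ε : ZMod 2} {f : LocalFun n p} (hf : HasParity ε f) (μ : Fin n) :
    HasParity ε (totalD p μ f) := by
  have := (isSDer_totalD p μ).hasParity hf
  rwa [add_zero] at this

theorem hasParity_totalDs {ε : ZMod 2} {f : LocalFun n p} (hf : HasParity ε f)
    (m : Fin n → ℕ) : HasParity ε (totalDs p m f) := by
  induction m using multiIdx_induction with
  | zero => rwa [totalDs_zero]
  | add m μ ih => rw [totalDs_add_single]; exact hasParity_totalD ih μ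

theorem map_totalDs {T : LocalFun n p →ₗ[ℝ] LocalFun n q}
    (h : ∀ μ f, T (totalD p μ f) = totalD q μ (T f)) (m : Fin n → ℕ) (f : LocalFun n p) :
    T (totalDs p m f) = totalDs q m (T f) := by
  induction m using multiIdx_induction with
  | zero => rw [totalDs_zero, totalDs_zero]
  | add m μ ih => rw [totalDs_add_single, h, ih, totalDs_add_single]

theorem isSDer_evol {ε : ZMod 2} {S : F → LocalFun n p} (hS : ∀ A, HasParity (p A + ε) (S A)) :
    IsSDer (AlgHom.id ℝ (LocalFun n p)) ε (evol S) := by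
  refine isSDer_vectorField _ ?_
  rintro (ν | k)
  · exact HasParity.zero _
  · exact hasParity_totalDs (hS k.1) k.2

theorem evol_xCoord (S : F → LocalFun n p) (μ : Fin n) : evol S (xCoord p μ) = 0 :=
  vectorField_coord _ _

theorem evol_jetCoord (S : F → LocalFun n p) (A : F) (m : Fin n → ℕ) :
    evol S (jetCoord p A m) = totalDs p m (S A) :=
  vectorField_coord _ _

theorem evol_jetCoord_zero (S : F → LocalFun n p) (A : F) :
    evol S (jetCoord p A 0) = S A := by rw [evol_jetCoord, totalDs_zero]

theorem der_totalD_xCoord {ε : ZMod 2} {X : LocalFun n p →ₗ[ℝ] LocalFun n p}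
    (hX : IsSDer (AlgHom.id ℝ (LocalFun n p)) ε X) (μ ν : Fin n) :
    X (totalD p μ (xCoord p ν)) = 0 := by
  rw [totalD_xCoord]
  split_ifs
  · exact hX.map_one
  · rw [map_zero]

/-- A superderivation that annihilates the base coordinates commutes with the total derivatives
if it does so on the jet coordinates. -/
theorem IsSDer.comm_totalD {ε : ZMod 2} {X : LocalFun n p →ₗ[ℝ] LocalFun n p}
    (hX : IsSDer (AlgHom.id ℝ (LocalFun n p)) ε X) (hx : ∀ ν, X (xCoord p ν) = 0) (μ : Fin n)
    (h : ∀ A m, X (jetCoord p A (m + Pi.single μ 1)) = totalD p μ (X (jetCoord p A m)))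
    (f : LocalFun n p) : X (totalD p μ f) = totalD p μ (X f) := by
  refine hX.comm_of_coord (isSDer_totalD p μ) ?_ f
  rintro (κ | k)
  · refine (der_totalD_xCoord hX μ κ).trans ?_
    rw [hx, map_zero]
  · refine Eq.trans (congrArg X (totalD_jetCoord p μ k.1 k.2)) (h k.1 k.2)

theorem evol_totalD {ε : ZMod 2} {S : F → LocalFun n p} (hS : ∀ A, HasParity (p A + ε) (S A))
    (μ : Fin n) (f : LocalFun n p) : evol S (totalD p μ f) = totalD p μ (evol S f) :=
  (isSDer_evol hS).comm_totalD (evol_xCoord S) μ (fun A m => by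
    rw [evol_jetCoord, evol_jetCoord, totalDs_add_single]) f

/-- The local functions of the fields in `Q` only. -/
noncomputable abbrev fieldsIn (n : ℕ) (p : F → ZMod 2) (Q : F → Prop) :
    Subalgebra ℝ (LocalFun n p) :=
  onlyIn (jetParity n p) (Sum.elim (fun _ => True) fun k => Q k.1)

theorem xCoord_mem_fieldsIn (Q : F → Prop) (μ : Fin n) : xCoord p μ ∈ fieldsIn n p Q :=
  coord_mem_onlyIn (p := jetParity n p) (k := Sum.inl μ) trivial

theorem jetCoord_mem_fieldsIn {Q : F → Prop} {A : F} (hA : Q A) (m : Fin n → ℕ) :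
    jetCoord p A m ∈ fieldsIn n p Q :=
  coord_mem_onlyIn (p := jetParity n p) (k := Sum.inr (A, m)) hA

theorem fieldsIn_mono {Q Q' : F → Prop} (h : ∀ A, Q A → Q' A) {f : LocalFun n p}
    (hf : f ∈ fieldsIn n p Q) : f ∈ fieldsIn n p Q' :=
  onlyIn_mono (by rintro (μ | k) hk; exacts [trivial, h _ hk]) hf

theorem totalD_mem_fieldsIn {Q : F → Prop} {f : LocalFun n p} (hf : f ∈ fieldsIn n p Q)
    (μ : Fin n) : totalD p μ f ∈ fieldsIn n p Q := by
  refine der_mem_onlyIn IsEven.id (isSDer_totalD p μ) (fun k hk => coord_mem_onlyIn hk) ?_ hf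
  rintro (κ | k) hk
  · change totalD p μ (xCoord p κ) ∈ _
    rw [totalD_xCoord]
    split_ifs
    · exact one_mem _
    · exact zero_mem _
  · change totalD p μ (jetCoord p k.1 k.2) ∈ _
    rw [totalD_jetCoord]
    exact jetCoord_mem_fieldsIn (Q := Q) (A := k.1) hk _

theorem totalDs_mem_fieldsIn {Q : F → Prop} {f : LocalFun n p} (hf : f ∈ fieldsIn n p Q)
    (m : Fin n → ℕ) : totalDs p m f ∈ fieldsIn n p Q := by
  induction m using multiIdx_induction with
  | zero => rwa [totalDs_zero]
  | add m μ ih => rw [totalDs_add_single]; exact totalD_mem_fieldsIn ih μ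

/-! ## Changes of fields -/

/-- The homomorphism that substitutes the local functions `u b` for the fields `b`. -/
noncomputable def fieldSubst (u : G → LocalFun n p) (hu : ∀ b, HasParity (q b) (u b)) :
    LocalFun n q →ₐ[ℝ] LocalFun n p :=
  superSubst (Sum.elim (xCoord p) fun k => totalDs p k.2 (u k.1)) (by
    rintro (μ | k)
    · exact hasParity_coord (p := jetParity n p) (Sum.inl μ)
    · exact hasParity_totalDs (hu k.1) k.2)

theorem isEven_fieldSubst (u : G → LocalFun n p) (hu : ∀ b, HasParity (q b) (u b)) :
    IsEven (fieldSubst u hu) := isEven_superSubst _ _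

theorem fieldSubst_xCoord (u : G → LocalFun n p) (hu : ∀ b, HasParity (q b) (u b)) (μ : Fin n) :
    fieldSubst u hu (xCoord q μ) = xCoord p μ := superSubst_coord _ _ _

theorem fieldSubst_jetCoord (u : G → LocalFun n p) (hu : ∀ b, HasParity (q b) (u b)) (b : G)
    (m : Fin n → ℕ) : fieldSubst u hu (jetCoord q b m) = totalDs p m (u b) :=
  superSubst_coord _ _ _

theorem hom_totalD {Θ : LocalFun n q →ₐ[ℝ] LocalFun n p} (hΘ : IsEven Θ)
    (hx : ∀ μ, Θ (xCoord q μ) = xCoord p μ) {u : G → LocalFun n p}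
    (hu : ∀ b m, Θ (jetCoord q b m) = totalDs p m (u b)) (μ : Fin n) (f : LocalFun n q) :
    Θ (totalD q μ f) = totalD p μ (Θ f) := by
  refine intertwine_of_coord hΘ (isSDer_totalD q μ) (isSDer_totalD p μ) ?_ f
  rintro (κ | k)
  · change Θ (totalD q μ (xCoord q κ)) = totalD p μ (Θ (xCoord q κ))
    rw [hx, totalD_xCoord, totalD_xCoord]
    split_ifs
    · exact map_one Θ
    · exact map_zero Θ
  · change Θ (totalD q μ (jetCoord q k.1 k.2)) = totalD p μ (Θ (jetCoord q k.1 k.2))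
    rw [totalD_jetCoord, hu, hu, totalDs_add_single]

theorem fieldSubst_totalD (u : G → LocalFun n p) (hu : ∀ b, HasParity (q b) (u b)) (μ : Fin n)
    (f : LocalFun n q) : fieldSubst u hu (totalD q μ f) = totalD p μ (fieldSubst u hu f) :=
  hom_totalD (isEven_fieldSubst u hu) (fieldSubst_xCoord u hu) (fieldSubst_jetCoord u hu) μ f

theorem IsFieldChange.of_inverse {u : G → LocalFun n p} (hu : ∀ b, HasParity (q b) (u b))
    {Ξ : LocalFun n p →ₐ[ℝ] LocalFun n q} (h₁ : ∀ f, fieldSubst u hu (Ξ f) = f)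
    (h₂ : ∀ f, Ξ (fieldSubst u hu f) = f) :
    IsFieldChange u (AlgEquiv.ofAlgHom (fieldSubst u hu) Ξ (AlgHom.ext h₁) (AlgHom.ext h₂)) where
  map_parityInv f := isEven_fieldSubst u hu f
  map_coord l := superSubst_coord _ _ l

section

variable {u : G → LocalFun n p} {Φ : LocalFun n q ≃ₐ[ℝ] LocalFun n p}

theorem IsFieldChange.isEven (h : IsFieldChange u Φ) :
    IsEven (Φ.toAlgHom : LocalFun n q →ₐ[ℝ] LocalFun n p) := h.map_parityInv

theorem IsFieldChange.isEven_symm (h : IsFieldChange u Φ) :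
    IsEven (Φ.symm.toAlgHom : LocalFun n p →ₐ[ℝ] LocalFun n q) := ParentBRST.isEven_symm h.isEven

theorem IsFieldChange.xCoord (h : IsFieldChange u Φ) (μ : Fin n) :
    Φ (ParentBRST.xCoord q μ) = ParentBRST.xCoord p μ := h.map_coord (Sum.inl μ)

theorem IsFieldChange.jetCoord (h : IsFieldChange u Φ) (b : G) (m : Fin n → ℕ) :
    Φ (ParentBRST.jetCoord q b m) = totalDs p m (u b) := h.map_coord (Sum.inr (b, m))

theorem IsFieldChange.jetCoord_zero (h : IsFieldChange u Φ) (b : G) :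
    Φ (ParentBRST.jetCoord q b 0) = u b := by rw [h.jetCoord, totalDs_zero]

theorem IsFieldChange.hasParity (h : IsFieldChange u Φ) (b : G) : HasParity (q b) (u b) := by
  rw [← h.jetCoord_zero b]
  exact h.isEven.hasParity (hasParity_coord (p := jetParity n q) (Sum.inr (b, 0)))

theorem IsFieldChange.totalD (h : IsFieldChange u Φ) (μ : Fin n) (f : LocalFun n q) :
    Φ (ParentBRST.totalD q μ f) = ParentBRST.totalD p μ (Φ f) :=
  hom_totalD (Θ := (Φ.toAlgHom : LocalFun n q →ₐ[ℝ] LocalFun n p)) h.isEven h.xCoord h.jetCoord μ f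

theorem IsFieldChange.totalDs (h : IsFieldChange u Φ) (m : Fin n → ℕ) (f : LocalFun n q) :
    Φ (ParentBRST.totalDs q m f) = ParentBRST.totalDs p m (Φ f) :=
  map_totalDs (T := Φ.toLinearMap) h.totalD m f

theorem IsFieldChange.symm_totalD (h : IsFieldChange u Φ) (μ : Fin n) (f : LocalFun n p) :
    Φ.symm (ParentBRST.totalD p μ f) = ParentBRST.totalD q μ (Φ.symm f) := by
  rw [AlgEquiv.symm_apply_eq, h.totalD, Φ.apply_symm_apply]

theorem IsFieldChange.symm_totalDs (h : IsFieldChange u Φ) (m : Fin n → ℕ) (f : LocalFun n p) :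
    Φ.symm (ParentBRST.totalDs p m f) = ParentBRST.totalDs q m (Φ.symm f) := by
  rw [AlgEquiv.symm_apply_eq, h.totalDs, Φ.apply_symm_apply]

theorem IsFieldChange.symm_apply (h : IsFieldChange u Φ) (b : G) :
    Φ.symm (u b) = ParentBRST.jetCoord q b 0 := by
  rw [AlgEquiv.symm_apply_eq, h.jetCoord_zero]

theorem IsFieldChange.symm_xCoord (h : IsFieldChange u Φ) (μ : Fin n) :
    Φ.symm (ParentBRST.xCoord p μ) = ParentBRST.xCoord q μ := by
  rw [AlgEquiv.symm_apply_eq, h.xCoord]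

theorem IsFieldChange.trans {H : Type*} {r : H → ZMod 2} {t : H → LocalFun n q}
    {T : LocalFun n r ≃ₐ[ℝ] LocalFun n q} (h : IsFieldChange u Φ) (hT : IsFieldChange t T) :
    IsFieldChange (fun b => Φ (t b)) (T.trans Φ) where
  map_parityInv f := by
    change Φ (T _) = parityInv _ (Φ (T f))
    rw [hT.map_parityInv, h.map_parityInv]
  map_coord := by
    rintro (μ | k)
    · change Φ (T (ParentBRST.xCoord r μ)) = _
      rw [hT.xCoord, h.xCoord]; rfl
    · change Φ (T (ParentBRST.jetCoord r k.1 k.2)) = _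
      rw [hT.jetCoord, h.totalDs]; rfl

theorem IsFieldChange.refl (n : ℕ) (q : G → ZMod 2) :
    IsFieldChange (n := n) (fun b => ParentBRST.jetCoord q b 0)
      (AlgEquiv.refl : LocalFun n q ≃ₐ[ℝ] LocalFun n q) where
  map_parityInv f := rfl
  map_coord := by
    rintro (μ | k)
    · rfl
    · exact jetCoord_eq_totalDs q k.1 k.2

end

-- A shear: each correction involves only fields outside `B`, which are left fixed, so the inverse
-- subtracts the same correction.
open Classical in
theorem exists_elementary_fieldChange (B : G → Prop) (c : G → ℝ) (hc : ∀ b, c b ≠ 0)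
    (g : G → LocalFun n q) (hg : ∀ b, HasParity (q b) (g b))
    (hgB : ∀ b, B b → g b ∈ fieldsIn n q fun b => ¬ B b) :
    ∃ T : LocalFun n q ≃ₐ[ℝ] LocalFun n q,
      IsFieldChange (fun b => if B b then c b • jetCoord q b 0 + g b else jetCoord q b 0) T ∧
      ∀ b, T.symm (jetCoord q b 0) =
        if B b then (c b)⁻¹ • (jetCoord q b 0 - g b) else jetCoord q b 0 := by
  have hj : ∀ b, HasParity (q b) (jetCoord (n := n) q b 0) := fun b =>
    hasParity_coord (p := jetParity n q) (Sum.inr (b, 0))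
  have hu : ∀ b, HasParity (q b)
      (if B b then c b • jetCoord q b 0 + g b else jetCoord (n := n) q b 0) := fun b => by
    split_ifs
    · exact ((hj b).smul _).add (hg b)
    · exact hj b
  have hv : ∀ b, HasParity (q b)
      (if B b then (c b)⁻¹ • (jetCoord q b 0 - g b) else jetCoord (n := n) q b 0) := fun b => by
    split_ifs
    · exact ((hj b).sub (hg b)).smul _
    · exact hj b
  have fix : ∀ (v : G → LocalFun n q) (hv : ∀ b, HasParity (q b) (v b)),
      (∀ b, ¬ B b → v b = jetCoord q b 0) → ∀ f ∈ fieldsIn n q fun b => ¬ B b,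
      fieldSubst v hv f = f := by
    intro v hv h f hf
    refine hom_eq_of_onlyIn (Θ₂ := AlgHom.id ℝ _) (isEven_fieldSubst v hv) ?_ hf
    rintro (μ | k) hk
    · exact fieldSubst_xCoord v hv μ
    · change fieldSubst v hv (jetCoord q k.1 k.2) = jetCoord q k.1 k.2
      rw [fieldSubst_jetCoord, h _ hk, ← jetCoord_eq_totalDs]
  have inv : ∀ (v : G → LocalFun n q) (hv : ∀ b, HasParity (q b) (v b)) (v' : G → LocalFun n q)
      (hv' : ∀ b, HasParity (q b) (v' b)), (∀ b, fieldSubst v hv (v' b) = jetCoord q b 0) →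
      ∀ f, fieldSubst v hv (fieldSubst v' hv' f) = f := by
    intro v hv v' hv' h f
    refine DFunLike.congr_fun (IsEven.ext
      (Θ₁ := (fieldSubst v hv).comp (fieldSubst v' hv')) (Θ₂ := AlgHom.id ℝ _)
      ((isEven_fieldSubst v hv).comp (isEven_fieldSubst v' hv')) ?_) f
    rintro (μ | k)
    · change fieldSubst v hv (fieldSubst v' hv' (xCoord q μ)) = xCoord q μ
      rw [fieldSubst_xCoord, fieldSubst_xCoord]
    · change fieldSubst v hv (fieldSubst v' hv' (jetCoord q k.1 k.2)) = jetCoord q k.1 k.2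
      rw [fieldSubst_jetCoord]
      refine (map_totalDs (T := (fieldSubst v hv).toLinearMap)
        (fieldSubst_totalD v hv) k.2 (v' k.1)).trans ?_
      change totalDs q k.2 (fieldSubst v hv (v' k.1)) = _
      rw [h, ← jetCoord_eq_totalDs]
  refine ⟨_, IsFieldChange.of_inverse hu (Ξ := fieldSubst _ hv) (inv _ _ _ _ fun b => ?_)
    (inv _ _ _ _ fun b => ?_), fun b => ?_⟩
  · by_cases hb : B b
    · rw [if_pos hb, map_smul, map_sub, fix _ hu (fun b hb => if_neg hb) _ (hgB b hb),
        fieldSubst_jetCoord, totalDs_zero, if_pos hb, add_sub_cancel_right, smul_smul,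
        inv_mul_cancel₀ (hc b), one_smul]
    · rw [if_neg hb, fieldSubst_jetCoord, totalDs_zero, if_neg hb]
  · by_cases hb : B b
    · rw [if_pos hb, map_add, map_smul, fix _ hv (fun b hb => if_neg hb) _ (hgB b hb),
        fieldSubst_jetCoord, totalDs_zero, if_pos hb, smul_smul, mul_inv_cancel₀ (hc b), one_smul,
        sub_add_cancel]
    · rw [if_neg hb, fieldSubst_jetCoord, totalDs_zero, if_neg hb]
  · change fieldSubst _ hv (jetCoord q b 0) = _
    rw [fieldSubst_jetCoord, totalDs_zero]

theorem hom_mem_fieldsIn {Θ : LocalFun n q →ₐ[ℝ] LocalFun n p} (hΘ : IsEven Θ)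
    (hx : ∀ μ, Θ (xCoord q μ) = xCoord p μ) {u : G → LocalFun n p}
    (hu : ∀ b m, Θ (jetCoord q b m) = totalDs p m (u b)) {Q : G → Prop} {Q' : F → Prop}
    (hQ : ∀ b, Q b → u b ∈ fieldsIn n p Q') {f : LocalFun n q} (hf : f ∈ fieldsIn n q Q) :
    Θ f ∈ fieldsIn n p Q' := by
  refine hom_mem_onlyIn hΘ ?_ hf
  rintro (μ | k) hk
  · change Θ (xCoord q μ) ∈ _
    rw [hx]; exact xCoord_mem_fieldsIn Q' μ
  · change Θ (jetCoord q k.1 k.2) ∈ _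
    rw [hu]; exact totalDs_mem_fieldsIn (hQ _ hk) _

theorem IsFieldChange.mem_fieldsIn {u : G → LocalFun n p} {Φ : LocalFun n q ≃ₐ[ℝ] LocalFun n p}
    (h : IsFieldChange u Φ) {Q : G → Prop} {Q' : F → Prop}
    (hQ : ∀ b, Q b → u b ∈ fieldsIn n p Q') {f : LocalFun n q} (hf : f ∈ fieldsIn n q Q) :
    Φ f ∈ fieldsIn n p Q' :=
  hom_mem_fieldsIn (Θ := (Φ.toAlgHom : LocalFun n q →ₐ[ℝ] LocalFun n p)) h.isEven h.xCoord h.jetCoord hQ hf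

theorem IsFieldChange.symm_mem_fieldsIn {u : G → LocalFun n q}
    {Φ : LocalFun n q ≃ₐ[ℝ] LocalFun n q}
    (h : IsFieldChange u Φ) {Q Q' : G → Prop}
    (hQ : ∀ b, Q b → Φ.symm (ParentBRST.jetCoord q b 0) ∈ fieldsIn n q Q') {f : LocalFun n q}
    (hf : f ∈ fieldsIn n q Q) : Φ.symm f ∈ fieldsIn n q Q' :=
  hom_mem_fieldsIn (Θ := (Φ.symm.toAlgHom : LocalFun n q →ₐ[ℝ] LocalFun n q)) h.isEven_symm h.symm_xCoord
    (u := fun b => Φ.symm (ParentBRST.jetCoord q b 0)) (fun b m => by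
      change Φ.symm _ = _
      rw [jetCoord_eq_totalDs, h.symm_totalDs]) hQ hf

theorem IsFieldChange.apply_eq_self {u : G → LocalFun n q} {Φ : LocalFun n q ≃ₐ[ℝ] LocalFun n q}
    (h : IsFieldChange u Φ) {Q : G → Prop} (hQ : ∀ b, Q b → u b = ParentBRST.jetCoord q b 0)
    {f : LocalFun n q} (hf : f ∈ fieldsIn n q Q) : Φ f = f := by
  refine hom_eq_of_onlyIn (Θ₁ := (Φ.toAlgHom : LocalFun n q →ₐ[ℝ] LocalFun n q))
    (Θ₂ := AlgHom.id ℝ _) h.isEven ?_ hf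
  rintro (μ | k) hk
  · exact h.xCoord μ
  · change Φ (ParentBRST.jetCoord q k.1 k.2) = ParentBRST.jetCoord q k.1 k.2
    rw [h.jetCoord, hQ _ hk, ← jetCoord_eq_totalDs]

/-- A change of fields which is triangular with respect to a bounded rank. -/
theorem exists_triangular_fieldChange (rank : G → ℕ) (c : G → ℝ) (hc : ∀ b, c b ≠ 0)
    (g : G → LocalFun n q) (hg : ∀ b, HasParity (q b) (g b))
    (hgr : ∀ b, g b ∈ fieldsIn n q fun b' => rank b' < rank b) {N : ℕ} (hN : ∀ b, rank b < N) :
    ∃ T : LocalFun n q ≃ₐ[ℝ] LocalFun n q,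
      IsFieldChange (fun b => c b • jetCoord q b 0 + g b) T ∧
      ∀ k, ∀ f ∈ fieldsIn n q fun b => rank b < k,
        T.symm f ∈ fieldsIn n q fun b => rank b < k := by
  classical
  -- The induction changes only the fields of rank below `N`, one rank at a time; at the bound all
  -- have been changed.
  suffices h : ∀ N : ℕ, ∃ T : LocalFun n q ≃ₐ[ℝ] LocalFun n q,
      IsFieldChange (fun b => if rank b < N then c b • jetCoord q b 0 + g b
        else jetCoord q b 0) T ∧
      ∀ k, ∀ f ∈ fieldsIn n q fun b => rank b < k,
        T.symm f ∈ fieldsIn n q fun b => rank b < k by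
    obtain ⟨T, hT, hT'⟩ := h N
    simp only [hN, if_true] at hT
    exact ⟨T, hT, hT'⟩
  intro N
  induction N with
  | zero =>
    refine ⟨AlgEquiv.refl, ?_, fun k f hf => hf⟩
    simp only [Nat.not_lt_zero, if_false]
    exact IsFieldChange.refl n q
  | succ N ih =>
    obtain ⟨T, hT, hT'⟩ := ih
    obtain ⟨E, hE, hE'⟩ := exists_elementary_fieldChange (fun b => rank b = N) c hc g hg
      fun b hb => fieldsIn_mono (fun b' hb' => by omega) (hgr b)
    refine ⟨T.trans E, ?_, fun k f hf => ?_⟩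
    -- The shear `E` in rank `N` fixes all functions of fields of lower rank, in particular the new
    -- fields obtained so far.
    · have key : (fun b => if rank b < N + 1 then c b • jetCoord q b 0 + g b
          else jetCoord q b 0) = fun b => E (if rank b < N then c b • jetCoord q b 0 + g b
          else jetCoord q b 0) := by
        funext b
        rcases lt_trichotomy (rank b) N with h | h | h
        · rw [if_pos h, if_pos (by omega)]
          refine (hE.apply_eq_self (Q := fun b => rank b < N)
            (fun b' hb' => if_neg (Nat.ne_of_lt hb')) ?_).symm
          exact add_mem (Subalgebra.smul_mem _
            (jetCoord_mem_fieldsIn (Q := fun b => rank b < N) h 0) _)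
            (fieldsIn_mono (fun b' hb' => lt_trans hb' h) (hgr b))
        · rw [if_neg (by omega : ¬ rank b < N), if_pos (by omega), hE.jetCoord_zero, if_pos h]
        · rw [if_neg (by omega : ¬ rank b < N), if_neg (by omega), hE.jetCoord_zero,
            if_neg (by omega)]
      rw [key]
      exact hE.trans hT
    · refine hT' k _ (hE.symm_mem_fieldsIn (Q := fun b => rank b < k) (fun b hb => ?_) hf)
      rw [hE']
      split_ifs
      · exact Subalgebra.smul_mem _ (sub_mem
          (jetCoord_mem_fieldsIn (Q := fun b => rank b < k) hb 0)
          (fieldsIn_mono (fun b' hb' => lt_trans hb' hb) (hgr b))) _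
      · exact jetCoord_mem_fieldsIn (Q := fun b => rank b < k) hb 0

end JetLemmas

/-! ## Skew-symmetric multi-indices -/

section IdxSign

variable {n : ℕ}

theorem idxSign_mul_self (N : Finset (Fin n)) (ν : Fin n) : idxSign N ν * idxSign N ν = 1 := by
  rw [idxSign, ← mul_pow, neg_one_mul, neg_neg, one_pow]

theorem idxSign_insert {N : Finset (Fin n)} {κ : Fin n} (hκ : κ ∉ N) (ν : Fin n) :
    idxSign (insert κ N) ν = (if κ < ν then -1 else 1) * idxSign N ν := by
  rw [idxSign, idxSign, Finset.filter_insert]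
  split_ifs with h
  · rw [Finset.card_insert_of_notMem fun h' => hκ (Finset.mem_filter.1 h').1, pow_succ, mul_comm]
  · rw [one_mul]

theorem idxSign_insert_self {N : Finset (Fin n)} {ν : Fin n} (hν : ν ∉ N) :
    idxSign (insert ν N) ν = idxSign N ν := by
  rw [idxSign_insert hν, if_neg (lt_irrefl ν), one_mul]

/-- Exactly one of `κ < ν` and `ν < κ` holds, so exactly one side acquires an extra sign. This is
why the `∂/∂θ^ν` anticommute. -/
theorem idxSign_insert_swap {N : Finset (Fin n)} {κ ν : Fin n} (hκ : κ ∉ N) (hν : ν ∉ N)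
    (h : κ ≠ ν) : idxSign N ν * idxSign (insert ν N) κ =
      -(idxSign N κ * idxSign (insert κ N) ν) := by
  rw [idxSign_insert hκ, idxSign_insert hν]
  rcases lt_or_gt_of_ne h with h | h
  · rw [if_neg h.not_gt, if_pos h]; ring
  · rw [if_neg h.not_gt, if_pos h]; ring

theorem idxSign_eq_one {N : Finset (Fin n)} {ν : Fin n} (h : ∀ κ ∈ N, ν < κ) :
    idxSign N ν = 1 := by
  rw [idxSign, Finset.filter_eq_empty_iff.2 fun κ hκ => (h κ hκ).not_gt, Finset.card_empty,
    pow_zero]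

end IdxSign

/-! ## Superfields

The fields `G` are the components of superfields `K`, one component for each skew-symmetric
multi-index. -/

/-- An identification of the fields `G` with the `θ`-components of superfields `K`; `∂/∂θ^ν` acts
on the components with the sign `sign`. -/
structure Superfields (n : ℕ) {K G : Type*} (pK : K → ZMod 2) (pG : G → ZMod 2) where
  equiv : K × Finset (Fin n) ≃ G
  parity_eq : ∀ k N, pG (equiv (k, N)) = pK k + (N.card : ZMod 2)
  sign : K → ℝ
  sign_mul_self : ∀ k, sign k * sign k = 1

namespace Superfields

variable {n : ℕ} {K G : Type*} {pK : K → ZMod 2} {pG : G → ZMod 2} (P : Superfields n pK pG)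

/-- The number of indices of a component. -/
def rank (b : G) : ℕ := (P.equiv.symm b).2.card

/-- The odd vector field `∂/∂θ^ν`. -/
noncomputable def theta (ν : Fin n) : Module.End ℝ (LocalFun n pG) :=
  vectorField (Sum.elim (fun _ => 0) fun k =>
    if ν ∈ (P.equiv.symm k.1).2 then 0
    else (P.sign (P.equiv.symm k.1).1 * idxSign (P.equiv.symm k.1).2 ν) •
      jetCoord pG (P.equiv ((P.equiv.symm k.1).1, insert ν (P.equiv.symm k.1).2)) k.2)

/-- The lowest components as functions. -/
noncomputable def bar : SuperFun (restParity n pK) →ₐ[ℝ] LocalFun n pG :=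
  rename (Sum.map id fun k => (P.equiv (k, ∅), 0)) (by
    rintro (μ | k)
    · rfl
    · exact (P.parity_eq k ∅).trans (by rw [Finset.card_empty, Nat.cast_zero, add_zero]; rfl))

/-- `∂/∂θ^{ν₁} ⋯ ∂/∂θ^{ν_k}` for `N = {ν₁ < ⋯ < ν_k}`. -/
noncomputable def thetas (N : Finset (Fin n)) : Module.End ℝ (LocalFun n pG) :=
  ((N.sort (· ≤ ·)).map P.theta).prod

@[simp] theorem rank_equiv (k : K) (N : Finset (Fin n)) : P.rank (P.equiv (k, N)) = N.card := by
  rw [rank, Equiv.symm_apply_apply]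

theorem rank_lt (b : G) : P.rank b < n + 1 :=
  Nat.lt_succ_of_le ((Finset.card_le_univ _).trans (Fintype.card_fin n).le)

theorem forall_field {C : G → Prop} (h : ∀ k N, C (P.equiv (k, N))) (b : G) : C b := by
  rw [← P.equiv.apply_symm_apply b]; exact h _ _

theorem theta_xCoord (ν μ : Fin n) : P.theta ν (xCoord pG μ) = 0 := vectorField_coord _ _

theorem theta_jetCoord (ν : Fin n) (k : K) (N : Finset (Fin n)) (m : Fin n → ℕ) :
    P.theta ν (jetCoord pG (P.equiv (k, N)) m) = if ν ∈ N then 0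
      else (P.sign k * idxSign N ν) • jetCoord pG (P.equiv (k, insert ν N)) m := by
  refine (vectorField_coord _ _).trans ?_
  simp only [Sum.elim_inr, Equiv.symm_apply_apply]

theorem bar_xCoord (μ : Fin n) : P.bar (coord _ (Sum.inl μ)) = xCoord pG μ := rename_coord _ _ _

theorem bar_coord (k : K) : P.bar (coord _ (Sum.inr k)) = jetCoord pG (P.equiv (k, ∅)) 0 :=
  rename_coord _ _ _

theorem isEven_bar : IsEven P.bar := isEven_rename _ _

theorem hasParity_jetCoord (k : K) (N : Finset (Fin n)) (m : Fin n → ℕ) :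
    HasParity (pK k + (N.card : ZMod 2)) (jetCoord pG (P.equiv (k, N)) m) := by
  have := hasParity_coord (p := jetParity n pG) (Sum.inr (P.equiv (k, N), m))
  rwa [show jetParity n pG (Sum.inr (P.equiv (k, N), m)) = pK k + (N.card : ZMod 2) from
    P.parity_eq k N] at this

theorem isSDer_theta (ν : Fin n) : IsSDer (AlgHom.id ℝ (LocalFun n pG)) 1 (P.theta ν) := by
  refine isSDer_vectorField _ ?_
  rintro (μ | ⟨b, m⟩)
  · exact HasParity.zero _
  · change HasParity (pG b + 1) (if ν ∈ (P.equiv.symm b).2 then (0 : LocalFun n pG)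
      else (P.sign (P.equiv.symm b).1 * idxSign (P.equiv.symm b).2 ν) •
      jetCoord pG (P.equiv ((P.equiv.symm b).1, insert ν (P.equiv.symm b).2)) m)
    obtain ⟨⟨k, N⟩, rfl⟩ := P.equiv.surjective b
    rw [Equiv.symm_apply_apply]
    split_ifs with h
    · exact HasParity.zero _
    · refine HasParity.smul _ ?_
      have := P.hasParity_jetCoord k (insert ν N) m
      rw [Finset.card_insert_of_notMem h, Nat.cast_succ, ← add_assoc] at this
      rwa [P.parity_eq]

theorem theta_totalD (ν μ : Fin n) (f : LocalFun n pG) :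
    P.theta ν (totalD pG μ f) = totalD pG μ (P.theta ν f) := by
  refine (P.isSDer_theta ν).comm_totalD (P.theta_xCoord ν) μ ?_ f
  refine P.forall_field fun k N m => ?_
  rw [theta_jetCoord, theta_jetCoord]
  split_ifs
  · rw [map_zero]
  · rw [map_smul, totalD_jetCoord]

theorem theta_totalDs (ν : Fin n) (m : Fin n → ℕ) (f : LocalFun n pG) :
    P.theta ν (totalDs pG m f) = totalDs pG m (P.theta ν f) :=
  map_totalDs (T := P.theta ν) (P.theta_totalD ν) m f

theorem theta_theta_jetCoord (μ ν : Fin n) (k : K) (N : Finset (Fin n)) (m : Fin n → ℕ) :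
    P.theta μ (P.theta ν (jetCoord pG (P.equiv (k, N)) m)) =
      -P.theta ν (P.theta μ (jetCoord pG (P.equiv (k, N)) m)) := by
  rw [theta_jetCoord, theta_jetCoord]
  by_cases hν : ν ∈ N <;> by_cases hμ : μ ∈ N
  · rw [if_pos hν, if_pos hμ, map_zero, map_zero, neg_zero]
  · rw [if_pos hν, if_neg hμ, map_zero, map_smul, theta_jetCoord,
      if_pos (Finset.mem_insert_of_mem hν), smul_zero, neg_zero]
  · rw [if_neg hν, if_pos hμ, map_zero, map_smul, theta_jetCoord,
      if_pos (Finset.mem_insert_of_mem hμ), smul_zero, neg_zero]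
  · rw [if_neg hν, if_neg hμ, map_smul, map_smul, theta_jetCoord, theta_jetCoord]
    by_cases h : μ = ν
    · subst h
      rw [if_pos (Finset.mem_insert_self _ _), smul_zero, neg_zero]
    · rw [if_neg (by simp [h, hμ]), if_neg (by simp [Ne.symm h, hν]), Finset.insert_comm ν μ,
        smul_smul, smul_smul, ← neg_smul]
      congr 1
      linear_combination (P.sign k * P.sign k) * idxSign_insert_swap hμ hν h

theorem theta_anticomm (μ ν : Fin n) (f : LocalFun n pG) :
    P.theta μ (P.theta ν f) = -P.theta ν (P.theta μ f) := by
  have h := (P.isSDer_theta μ).superComm_of_coord (P.isSDer_theta ν) (IsSDer.zero _ _) ?_ f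
  · rwa [mul_one, sgn_one, neg_one_smul, sub_neg_eq_add, LinearMap.zero_apply,
      add_eq_zero_iff_eq_neg] at h
  · rw [mul_one, sgn_one]
    rintro (κ | ⟨b, m⟩)
    · change P.theta μ (P.theta ν (xCoord pG κ)) - (-1 : ℝ) • P.theta ν (P.theta μ (xCoord pG κ)) = 0
      rw [theta_xCoord, theta_xCoord, map_zero, map_zero, smul_zero, sub_zero]
    · change P.theta μ (P.theta ν (jetCoord pG b m)) -
        (-1 : ℝ) • P.theta ν (P.theta μ (jetCoord pG b m)) = 0
      obtain ⟨⟨k, N⟩, rfl⟩ := P.equiv.surjective b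
      rw [theta_theta_jetCoord, neg_one_smul, sub_neg_eq_add, neg_add_cancel]

theorem theta_theta_self (ν : Fin n) (f : LocalFun n pG) : P.theta ν (P.theta ν f) = 0 := by
  have h := P.theta_anticomm ν ν f
  have h2 : (2 : ℝ) • P.theta ν (P.theta ν f) = 0 := by
    rw [two_smul]; nth_rewrite 1 [h]; exact neg_add_cancel _
  exact (smul_eq_zero.1 h2).resolve_left two_ne_zero

@[simp] theorem thetas_empty (f : LocalFun n pG) : P.thetas ∅ f = f := by simp [thetas]

theorem thetas_insert_min {ν : Fin n} {N : Finset (Fin n)} (h : ∀ κ ∈ N, ν < κ)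
    (f : LocalFun n pG) : P.thetas (insert ν N) f = P.theta ν (P.thetas N f) := by
  rw [thetas, Finset.sort_insert _ (fun κ hκ => (h κ hκ).le) fun hν => lt_irrefl _ (h ν hν),
    List.map_cons, List.prod_cons]
  rfl

/-- The new factor anticommutes past the smaller indices to its sorted place, collecting `idxSign N
ν`, or meets its own copy there and gives zero. -/
theorem theta_thetas (ν : Fin n) (N : Finset (Fin n)) (f : LocalFun n pG) :
    P.theta ν (P.thetas N f) =
      if ν ∈ N then 0 else idxSign N ν • P.thetas (insert ν N) f := by
  induction N using Finset.induction_on_min with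
  | empty =>
    rw [if_neg (Finset.notMem_empty ν), P.thetas_insert_min (by simp), idxSign_eq_one (by simp),
      one_smul]
  | insert a N ha ih =>
    have haN : a ∉ N := fun h => lt_irrefl _ (ha a h)
    rw [P.thetas_insert_min ha]
    rcases lt_trichotomy ν a with h | rfl | h
    · have h' : ∀ κ ∈ insert a N, ν < κ := by
        intro κ hκ
        rcases Finset.mem_insert.1 hκ with rfl | hκ
        · exact h
        · exact h.trans (ha κ hκ)
      rw [if_neg fun hν => lt_irrefl _ (h' ν hν), P.thetas_insert_min h', idxSign_eq_one h',
        one_smul, P.thetas_insert_min ha]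
    · rw [if_pos (Finset.mem_insert_self _ _), theta_theta_self]
    · rw [theta_anticomm, ih]
      by_cases hν : ν ∈ N
      · rw [if_pos hν, if_pos (Finset.mem_insert_of_mem hν), map_zero, neg_zero]
      · rw [if_neg hν, if_neg (by simp [hν, h.ne']), map_smul, idxSign_insert haN, if_pos h,
          Finset.insert_comm, ← P.thetas_insert_min (N := insert ν N), neg_one_mul, neg_smul]
        intro κ hκ
        rcases Finset.mem_insert.1 hκ with rfl | hκ
        · exact h
        · exact ha κ hκ

theorem hasParity_thetas {ε : ZMod 2} {f : LocalFun n pG} (hf : HasParity ε f)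
    (N : Finset (Fin n)) : HasParity (ε + (N.card : ZMod 2)) (P.thetas N f) := by
  induction N using Finset.induction_on_min with
  | empty => rwa [Finset.card_empty, Nat.cast_zero, add_zero, thetas_empty]
  | insert a N ha ih =>
    have haN : a ∉ N := fun h => lt_irrefl _ (ha a h)
    rw [P.thetas_insert_min ha, Finset.card_insert_of_notMem haN, Nat.cast_succ, ← add_assoc]
    exact (P.isSDer_theta a).hasParity ih

theorem thetas_bar_coord (k : K) (N : Finset (Fin n)) :
    P.thetas N (P.bar (coord _ (Sum.inr k))) =
      P.sign k ^ N.card • jetCoord pG (P.equiv (k, N)) 0 := by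
  induction N using Finset.induction_on_min with
  | empty => rw [thetas_empty, bar_coord, Finset.card_empty, pow_zero, one_smul]
  | insert a N ha ih =>
    have haN : a ∉ N := fun h => lt_irrefl _ (ha a h)
    rw [P.thetas_insert_min ha, ih, map_smul, theta_jetCoord, if_neg haN, idxSign_eq_one ha,
      smul_smul, mul_one, Finset.card_insert_of_notMem haN, pow_succ]

theorem sign_pow_mul_self (k : K) (j : ℕ) : P.sign k ^ j * P.sign k ^ j = 1 := by
  rw [← mul_pow, P.sign_mul_self, one_pow]

/-- Everything is generated from the lowest components by `∂/∂θ^ν` and total derivatives. This form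
is what reduces statements about all jet coordinates to the lowest ones. -/
theorem jetCoord_eq (k : K) (N : Finset (Fin n)) (m : Fin n → ℕ) :
    jetCoord pG (P.equiv (k, N)) m =
      P.sign k ^ N.card • totalDs pG m (P.thetas N (P.bar (coord _ (Sum.inr k)))) := by
  rw [thetas_bar_coord, map_smul, smul_smul, sign_pow_mul_self, one_smul, ← jetCoord_eq_totalDs]

theorem theta_mem_fieldsIn {r : ℕ} {f : LocalFun n pG}
    (hf : f ∈ fieldsIn n pG fun b => P.rank b < r) (ν : Fin n) :
    P.theta ν f ∈ fieldsIn n pG fun b => P.rank b < r + 1 := by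
  refine der_mem_onlyIn IsEven.id (P.isSDer_theta ν)
    (fun k hk => coord_mem_onlyIn ?_) ?_ hf
  · rcases k with μ | k
    · trivial
    · exact Nat.lt_succ_of_lt hk
  · rintro (μ | ⟨b, m⟩) hb
    · change P.theta ν (xCoord pG μ) ∈ _
      rw [theta_xCoord]; exact zero_mem _
    · change P.theta ν (jetCoord pG b m) ∈ _
      obtain ⟨⟨k, N⟩, rfl⟩ := P.equiv.surjective b
      rw [theta_jetCoord]
      split_ifs with h
      · exact zero_mem _
      · refine Subalgebra.smul_mem _ (jetCoord_mem_fieldsIn (Q := fun b => P.rank b < r + 1) ?_ m) _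
        have hb' : P.rank (P.equiv (k, N)) < r := hb
        change P.rank _ < r + 1
        rw [rank_equiv] at hb' ⊢
        rw [Finset.card_insert_of_notMem h]
        omega

theorem bar_mem_fieldsIn (f : SuperFun (restParity n pK)) :
    P.bar f ∈ fieldsIn n pG fun b => P.rank b < 1 := by
  refine hom_mem_onlyIn (Q := fun _ => True) P.isEven_bar ?_ ?_
  · rintro (μ | k) -
    · rw [bar_xCoord]; exact xCoord_mem_fieldsIn (p := pG) (Q := fun b => P.rank b < 1) μ
    · rw [bar_coord]
      refine jetCoord_mem_fieldsIn (Q := fun b => P.rank b < 1) ?_ 0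
      rw [rank_equiv]; simp
  · refine DFunLike.congr_fun (IsEven.ext (Θ₂ := AlgHom.id ℝ _) (isEven_restrictTo _) fun k => ?_) f
    rw [restrictTo_coord, if_pos trivial]; rfl

theorem thetas_mem_fieldsIn {r : ℕ} {f : LocalFun n pG}
    (hf : f ∈ fieldsIn n pG fun b => P.rank b < r) (N : Finset (Fin n)) :
    P.thetas N f ∈ fieldsIn n pG fun b => P.rank b < r + N.card := by
  induction N using Finset.induction_on_min with
  | empty => rwa [Finset.card_empty, thetas_empty]
  | insert a N ha ih =>
    have haN : a ∉ N := fun h => lt_irrefl _ (ha a h)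
    rw [P.thetas_insert_min ha, Finset.card_insert_of_notMem haN]
    exact P.theta_mem_fieldsIn ih a

theorem thetas_bar_mem_fieldsIn (f : SuperFun (restParity n pK)) (N : Finset (Fin n)) :
    P.thetas N (P.bar f) ∈ fieldsIn n pG fun b => P.rank b < N.card + 1 := by
  rw [add_comm]; exact P.thetas_mem_fieldsIn (P.bar_mem_fieldsIn f) N

/-- The components of functions of the superfields in `Q` are functions of the components of
these superfields. -/
theorem thetas_bar_mem_fieldsIn_of_onlyIn {Q : K → Prop} {f : SuperFun (restParity n pK)}
    (hf : f ∈ onlyIn (restParity n pK) (Sum.elim (fun _ => True) Q)) (N : Finset (Fin n)) :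
    P.thetas N (P.bar f) ∈ fieldsIn n pG fun b => Q (P.equiv.symm b).1 := by
  induction N using Finset.induction_on_min with
  | empty =>
    rw [thetas_empty]
    refine hom_mem_onlyIn P.isEven_bar ?_ hf
    rintro (μ | k) hk
    · rw [bar_xCoord]; exact xCoord_mem_fieldsIn (p := pG) (Q := fun b => Q (P.equiv.symm b).1) μ
    · rw [bar_coord]
      refine jetCoord_mem_fieldsIn (Q := fun b => Q (P.equiv.symm b).1) ?_ 0
      rw [Equiv.symm_apply_apply]; exact hk
  | insert a N ha ih =>
    rw [P.thetas_insert_min ha]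
    refine der_mem_onlyIn IsEven.id (P.isSDer_theta a) (fun k hk => coord_mem_onlyIn hk) ?_ ih
    rintro (μ | ⟨b, m⟩) hb
    · change P.theta a (xCoord pG μ) ∈ _
      rw [theta_xCoord]; exact zero_mem _
    · change P.theta a (jetCoord pG b m) ∈ _
      obtain ⟨⟨k, N⟩, rfl⟩ := P.equiv.surjective b
      rw [theta_jetCoord]
      split_ifs with h
      · exact zero_mem _
      · refine Subalgebra.smul_mem _
          (jetCoord_mem_fieldsIn (Q := fun b => Q (P.equiv.symm b).1) ?_ m) _
        have hb' : Q (P.equiv.symm (P.equiv (k, N))).1 := hb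
        change Q _
        rw [Equiv.symm_apply_apply] at hb' ⊢
        exact hb'

/-- A superderivation that is compatible with the total derivatives and with the `∂/∂θ^ν`
vanishes if it vanishes on the lowest components. -/
theorem eq_zero_of_lowest {δ : ZMod 2} {X : LocalFun n pG →ₗ[ℝ] LocalFun n pG}
    (hX : IsSDer (AlgHom.id ℝ (LocalFun n pG)) δ X) (hx : ∀ μ, X (xCoord pG μ) = 0)
    (hD : ∀ μ f, X (totalD pG μ f) = totalD pG μ (X f)) (c : ℝ)
    (hθ : ∀ ν f, X (P.theta ν f) = c • P.theta ν (X f))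
    (h : ∀ k, X (jetCoord pG (P.equiv (k, ∅)) 0) = 0) (f : LocalFun n pG) : X f = 0 := by
  have hN : ∀ k N, X (P.thetas N (P.bar (coord _ (Sum.inr k)))) = 0 := by
    intro k N
    induction N using Finset.induction_on_min with
    | empty => rw [thetas_empty, bar_coord, h]
    | insert a N ha ih => rw [P.thetas_insert_min ha, hθ, ih, map_zero, smul_zero]
  refine LinearMap.congr_fun (hX.ext IsEven.id (IsSDer.zero _ _) ?_) f
  rintro (μ | ⟨b, m⟩)
  · exact hx μ
  · change X (jetCoord pG b m) = 0
    obtain ⟨⟨k, N⟩, rfl⟩ := P.equiv.surjective b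
    rw [jetCoord_eq, map_smul, map_totalDs hD, hN, map_zero, smul_zero]

end Superfields

/-! ### Prolongation of maps of the lowest components to all components. -/

namespace Superfields

variable {n : ℕ} {K K' K'' G G' G'' : Type*} {pK : K → ZMod 2} {pG : G → ZMod 2}
  {pK' : K' → ZMod 2} {pG' : G' → ZMod 2} {pK'' : K'' → ZMod 2} {pG'' : G'' → ZMod 2}
  (P : Superfields n pK pG) (P' : Superfields n pK' pG') (P'' : Superfields n pK'' pG'')

/-- The images of the fields under the prolongation of a map of the lowest components. -/
noncomputable def prolongField (Θ : SuperFun (restParity n pK) →ₐ[ℝ] SuperFun (restParity n pK'))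
    (b : G) : LocalFun n pG' :=
  P.sign (P.equiv.symm b).1 ^ (P.equiv.symm b).2.card •
    P'.thetas (P.equiv.symm b).2 (P'.bar (Θ (coord _ (Sum.inr (P.equiv.symm b).1))))

theorem prolongField_equiv (Θ : SuperFun (restParity n pK) →ₐ[ℝ] SuperFun (restParity n pK'))
    (k : K) (N : Finset (Fin n)) : P.prolongField P' Θ (P.equiv (k, N)) =
      P.sign k ^ N.card • P'.thetas N (P'.bar (Θ (coord _ (Sum.inr k)))) := by
  rw [prolongField, Equiv.symm_apply_apply]

theorem hasParity_prolongField
    {Θ : SuperFun (restParity n pK) →ₐ[ℝ] SuperFun (restParity n pK')} (hΘ : IsEven Θ) (b : G) :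
    HasParity (pG b) (P.prolongField P' Θ b) := by
  obtain ⟨⟨k, N⟩, rfl⟩ := P.equiv.surjective b
  rw [prolongField_equiv, P.parity_eq]
  exact (P'.hasParity_thetas (P'.isEven_bar.hasParity
    (hΘ.hasParity (hasParity_coord (Sum.inr k)))) N).smul _

/-- The homomorphism of local functions induced by a homomorphism of functions of the lowest
components. -/
noncomputable def prolong (Θ : SuperFun (restParity n pK) →ₐ[ℝ] SuperFun (restParity n pK'))
    (hΘ : IsEven Θ) : LocalFun n pG →ₐ[ℝ] LocalFun n pG' :=
  fieldSubst (P.prolongField P' Θ) (P.hasParity_prolongField P' hΘ)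

section

variable {Θ : SuperFun (restParity n pK) →ₐ[ℝ] SuperFun (restParity n pK')} (hΘ : IsEven Θ)

theorem isEven_prolong : IsEven (P.prolong P' Θ hΘ) := isEven_fieldSubst _ _

theorem prolong_xCoord (μ : Fin n) : P.prolong P' Θ hΘ (xCoord pG μ) = xCoord pG' μ :=
  fieldSubst_xCoord _ _ _

theorem prolong_totalD (μ : Fin n) (f : LocalFun n pG) :
    P.prolong P' Θ hΘ (totalD pG μ f) = totalD pG' μ (P.prolong P' Θ hΘ f) :=
  fieldSubst_totalD _ _ _ _

theorem prolong_totalDs (m : Fin n → ℕ) (f : LocalFun n pG) :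
    P.prolong P' Θ hΘ (totalDs pG m f) = totalDs pG' m (P.prolong P' Θ hΘ f) :=
  map_totalDs (T := (P.prolong P' Θ hΘ).toLinearMap) (P.prolong_totalD P' hΘ) m f

theorem prolong_jetCoord (k : K) (N : Finset (Fin n)) : P.prolong P' Θ hΘ
    (jetCoord pG (P.equiv (k, N)) 0) =
      P.sign k ^ N.card • P'.thetas N (P'.bar (Θ (coord _ (Sum.inr k)))) := by
  rw [prolong, fieldSubst_jetCoord, totalDs_zero, prolongField_equiv]

theorem prolong_thetas_bar_coord (k : K) (N : Finset (Fin n)) : P.prolong P' Θ hΘ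
    (P.thetas N (P.bar (coord _ (Sum.inr k)))) =
      P'.thetas N (P'.bar (Θ (coord _ (Sum.inr k)))) := by
  rw [thetas_bar_coord, map_smul, prolong_jetCoord, smul_smul, sign_pow_mul_self, one_smul]

/-- On coordinates written as in `jetCoord_eq`, `∂/∂θ^ν` only inserts an index with the sign
`idxSign`. This rule is the same for `P` and `P'`; the signs of the components have cancelled. -/
theorem prolong_theta (ν : Fin n) (f : LocalFun n pG) :
    P.prolong P' Θ hΘ (P.theta ν f) = P'.theta ν (P.prolong P' Θ hΘ f) := by
  refine intertwine_of_coord (P.isEven_prolong P' hΘ) (P.isSDer_theta ν) (P'.isSDer_theta ν) ?_ f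
  rintro (μ | ⟨b, m⟩)
  · change P.prolong P' Θ hΘ (P.theta ν (xCoord pG μ)) =
      P'.theta ν (P.prolong P' Θ hΘ (xCoord pG μ))
    rw [prolong_xCoord, theta_xCoord, theta_xCoord, map_zero]
  · change P.prolong P' Θ hΘ (P.theta ν (jetCoord pG b m)) =
      P'.theta ν (P.prolong P' Θ hΘ (jetCoord pG b m))
    obtain ⟨⟨k, N⟩, rfl⟩ := P.equiv.surjective b
    rw [jetCoord_eq, map_smul, map_smul, map_smul, map_smul, theta_totalDs, prolong_totalDs,
      prolong_totalDs, theta_totalDs, prolong_thetas_bar_coord, theta_thetas, theta_thetas]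
    split_ifs
    · rw [map_zero]
    · rw [map_smul, prolong_thetas_bar_coord]

theorem prolong_thetas (N : Finset (Fin n)) (f : LocalFun n pG) :
    P.prolong P' Θ hΘ (P.thetas N f) = P'.thetas N (P.prolong P' Θ hΘ f) := by
  induction N using Finset.induction_on_min with
  | empty => rw [thetas_empty, thetas_empty]
  | insert a N ha ih => rw [P.thetas_insert_min ha, P'.thetas_insert_min ha, prolong_theta, ih]

theorem prolong_bar (hx : ∀ μ, Θ (coord _ (Sum.inl μ)) = coord _ (Sum.inl μ))
    (f : SuperFun (restParity n pK)) :
    P.prolong P' Θ hΘ (P.bar f) = P'.bar (Θ f) := by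
  refine DFunLike.congr_fun (IsEven.ext (Θ₁ := (P.prolong P' Θ hΘ).comp P.bar)
    (Θ₂ := P'.bar.comp Θ) ((P.isEven_prolong P' hΘ).comp P.isEven_bar) ?_) f
  rintro (μ | k)
  · rw [AlgHom.comp_apply, AlgHom.comp_apply, hx, bar_xCoord, bar_xCoord, prolong_xCoord]
  · have := P.prolong_thetas_bar_coord P' hΘ k ∅
    rwa [thetas_empty, thetas_empty] at this

theorem prolong_mem_fieldsIn {r : ℕ} {f : LocalFun n pG}
    (hf : f ∈ fieldsIn n pG fun b => P.rank b < r) :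
    P.prolong P' Θ hΘ f ∈ fieldsIn n pG' fun b => P'.rank b < r := by
  refine hom_mem_fieldsIn (P.isEven_prolong P' hΘ) (P.prolong_xCoord P' hΘ)
    (fieldSubst_jetCoord _ _) (P.forall_field fun k N hk => ?_) hf
  rw [prolongField_equiv]
  rw [rank_equiv] at hk
  exact Subalgebra.smul_mem _
    (fieldsIn_mono (fun b hb => by omega) (P'.thetas_bar_mem_fieldsIn _ N)) _

theorem prolong_prolong (hx : ∀ μ, Θ (coord _ (Sum.inl μ)) = coord _ (Sum.inl μ))
    {Ξ : SuperFun (restParity n pK') →ₐ[ℝ] SuperFun (restParity n pK)} (hΞ : IsEven Ξ)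
    (hx' : ∀ μ, Ξ (coord _ (Sum.inl μ)) = coord _ (Sum.inl μ)) (h : ∀ f, Ξ (Θ f) = f)
    (f : LocalFun n pG) : P'.prolong P Ξ hΞ (P.prolong P' Θ hΘ f) = f := by
  refine DFunLike.congr_fun (IsEven.ext
    (Θ₁ := (P'.prolong P Ξ hΞ).comp (P.prolong P' Θ hΘ)) (Θ₂ := AlgHom.id ℝ _)
    ((P'.isEven_prolong P hΞ).comp (P.isEven_prolong P' hΘ)) ?_) f
  rintro (μ | ⟨b, m⟩)
  · change P'.prolong P Ξ hΞ (P.prolong P' Θ hΘ (xCoord pG μ)) = xCoord pG μ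
    rw [prolong_xCoord, prolong_xCoord]
  · change P'.prolong P Ξ hΞ (P.prolong P' Θ hΘ (jetCoord pG b m)) = jetCoord pG b m
    obtain ⟨⟨k, N⟩, rfl⟩ := P.equiv.surjective b
    rw [jetCoord_eq, map_smul, map_smul, prolong_totalDs, prolong_totalDs, prolong_thetas,
      prolong_thetas, prolong_bar _ _ _ hx, prolong_bar _ _ _ hx', h]

end

/-- A change of coordinates of the lowest components induces a change of fields. -/
theorem exists_prolong_fieldChange
    (Θ : SuperFun (restParity n pK) ≃ₐ[ℝ] SuperFun (restParity n pK'))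
    (hΘ : IsEven (Θ.toAlgHom : SuperFun (restParity n pK) →ₐ[ℝ] SuperFun (restParity n pK')))
    (hx : ∀ μ, Θ (coord _ (Sum.inl μ)) = coord _ (Sum.inl μ)) :
    ∃ Φ : LocalFun n pG ≃ₐ[ℝ] LocalFun n pG',
      IsFieldChange (P.prolongField P' Θ.toAlgHom) Φ ∧
      (∀ N f, Φ (P.thetas N (P.bar f)) = P'.thetas N (P'.bar (Θ f))) ∧
      ∀ (r : ℕ), ∀ f ∈ fieldsIn n pG' fun b => P'.rank b < r,
        Φ.symm f ∈ fieldsIn n pG fun b => P.rank b < r := by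
  have hΘ' : IsEven (Θ.symm.toAlgHom :
      SuperFun (restParity n pK') →ₐ[ℝ] SuperFun (restParity n pK)) := isEven_symm hΘ
  have hx' : ∀ μ, Θ.symm (coord _ (Sum.inl μ)) = coord _ (Sum.inl μ) := fun μ => by
    rw [AlgEquiv.symm_apply_eq, hx]
  refine ⟨_, IsFieldChange.of_inverse (P.hasParity_prolongField P' hΘ)
    (Ξ := P'.prolong P Θ.symm.toAlgHom hΘ')
    (P'.prolong_prolong P hΘ' hx' hΘ hx Θ.apply_symm_apply)
    (P.prolong_prolong P' hΘ hx hΘ' hx' Θ.symm_apply_apply), fun N f => ?_, fun r f hf => ?_⟩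
  · change P.prolong P' Θ.toAlgHom hΘ _ = _
    rw [prolong_thetas, prolong_bar _ _ _ hx]
    rfl
  · exact P'.prolong_mem_fieldsIn P hΘ' hf

end Superfields

/-! ## The parent theory -/

section Parent

variable {n : ℕ} {F : Type*}

/-- The parent fields `Ψ^A_{(λ)[ν]}` as components of the superfields `(A, λ)`. -/
noncomputable def parentSuperfields (n : ℕ) (p : F → ZMod 2) :
    Superfields n (fun k : F × (Fin n → ℕ) => p k.1) (parentParity n p) where
  equiv := Equiv.prodAssoc F (Fin n → ℕ) (Finset (Fin n))
  parity_eq _ _ := rfl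
  sign k := sgn (p k.1)
  sign_mul_self _ := sgn_mul_self _

variable {p : F → ZMod 2} {S : F → LocalFun n p}

theorem isSDer_thetaD (p : F → ZMod 2) (ν : Fin n) :
    IsSDer (AlgHom.id ℝ (LocalFun n (parentParity n p))) 1 (thetaD p ν) :=
  (parentSuperfields n p).isSDer_theta ν

theorem thetaD_xCoord (p : F → ZMod 2) (ν μ : Fin n) :
    thetaD p ν (xCoord (parentParity n p) μ) = 0 := (parentSuperfields n p).theta_xCoord ν μ

theorem thetaD_jetCoord (p : F → ZMod 2) (ν : Fin n) (A : F) (l : Fin n → ℕ)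
    (N : Finset (Fin n)) (m : Fin n → ℕ) :
    thetaD p ν (jetCoord (parentParity n p) (A, l, N) m) = if ν ∈ N then 0
      else (sgn (p A) * idxSign N ν) • jetCoord (parentParity n p) (A, l, insert ν N) m :=
  (parentSuperfields n p).theta_jetCoord ν (A, l) N m

theorem thetaD_totalD (p : F → ZMod 2) (ν μ : Fin n) (f : LocalFun n (parentParity n p)) :
    thetaD p ν (totalD _ μ f) = totalD _ μ (thetaD p ν f) :=
  (parentSuperfields n p).theta_totalD ν μ f

theorem thetaD_thetaDs (p : F → ZMod 2) (ν : Fin n) (N : Finset (Fin n))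
    (f : LocalFun n (parentParity n p)) : thetaD p ν (thetaDs p N f) =
      if ν ∈ N then 0 else idxSign N ν • thetaDs p (insert ν N) f :=
  (parentSuperfields n p).theta_thetas ν N f

theorem hasParity_thetaDs {ε : ZMod 2} {f : LocalFun n (parentParity n p)}
    (hf : HasParity ε f) (N : Finset (Fin n)) :
    HasParity (ε + (N.card : ZMod 2)) (thetaDs p N f) :=
  (parentSuperfields n p).hasParity_thetas hf N

theorem isEven_bar (p : F → ZMod 2) : IsEven (bar (n := n) p) := isEven_rename _ _

theorem bar_xCoord (p : F → ZMod 2) (μ : Fin n) :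
    bar p (xCoord p μ) = xCoord (parentParity n p) μ := rename_coord _ _ _

theorem bar_jetCoord (p : F → ZMod 2) (A : F) (l : Fin n → ℕ) :
    bar p (jetCoord p A l) = jetCoord (parentParity n p) (A, l, ∅) 0 := rename_coord _ _ _

theorem hasParity_parentCoord (p : F → ZMod 2) (B : ParentField n F) (m : Fin n → ℕ) :
    HasParity (p B.1 + (B.2.2.card : ZMod 2)) (jetCoord (parentParity n p) B m) :=
  hasParity_coord (p := jetParity n (parentParity n p)) (Sum.inr (B, m))

/-- The sum of a term of `dF` and the corresponding term of `-sigmaF`. -/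
noncomputable def shiftTerm (p : F → ZMod 2) (A : F) (l : Fin n → ℕ) (m : Fin n → ℕ)
    (ν : Fin n) (N : Finset (Fin n)) : LocalFun n (parentParity n p) :=
  jetCoord _ (A, l, N) (m + Pi.single ν 1) - jetCoord _ (A, l + Pi.single ν 1, N) m

theorem thetaD_shiftTerm (p : F → ZMod 2) (κ : Fin n) (A : F) (l m : Fin n → ℕ) (ν : Fin n)
    (N : Finset (Fin n)) : thetaD p κ (shiftTerm p A l m ν N) = if κ ∈ N then 0
      else (sgn (p A) * idxSign N κ) • shiftTerm p A l m ν (insert κ N) := by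
  rw [shiftTerm, map_sub, thetaD_jetCoord, thetaD_jetCoord]
  split_ifs
  · rw [sub_zero]
  · rw [shiftTerm, smul_sub]

theorem parentS_eq (S : F → LocalFun n p) (A : F) (l : Fin n → ℕ) (N : Finset (Fin n)) :
    parentS S (A, l, N) =
      ∑ ν ∈ N, (sgn (p A) * idxSign N ν) • shiftTerm p A l 0 ν (N.erase ν) +
      sgn ((N.card : ZMod 2) * (p A + 1)) • thetaDs p N (bar p (totalDs p l (S A))) := by
  simp only [parentS, dF, sigmaF, sBar, shiftTerm, smul_sub, Finset.sum_sub_distrib, zero_add]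

theorem hasParity_shiftTerm (p : F → ZMod 2) (A : F) (l m : Fin n → ℕ) (ν : Fin n)
    (N : Finset (Fin n)) : HasParity (p A + (N.card : ZMod 2)) (shiftTerm p A l m ν N) :=
  (hasParity_parentCoord p (A, l, N) _).sub (hasParity_parentCoord p (A, _, N) _)

theorem hasParity_parentS (hS : ∀ A, HasParity (p A + 1) (S A)) (B : ParentField n F) :
    HasParity (parentParity n p B + 1) (parentS S B) := by
  obtain ⟨A, l, N⟩ := B
  change HasParity (p A + (N.card : ZMod 2) + 1) _
  rw [parentS_eq]
  refine HasParity.add (HasParity.sum _ fun ν hν => HasParity.smul _ ?_) (HasParity.smul _ ?_)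
  · have h := hasParity_shiftTerm p A l 0 ν (N.erase ν)
    have h2 : (N.card : ZMod 2) = ((N.erase ν).card : ZMod 2) + 1 := by
      rw [← Finset.card_erase_add_one hν, Nat.cast_succ]
    rwa [h2, add_assoc, add_assoc, zmod2_add_self, add_zero]
  · rw [add_right_comm]
    exact hasParity_thetaDs ((isEven_bar p).hasParity (hasParity_totalDs (hS A) l)) N

/-- The relation between exterior multiplication by `ν` and contraction: their anticommutator is the
identity for equal indices and zero otherwise. If `ν` is in `N` only `κ = ν` survives in the second
sum. If not, `κ = ν` in the first sum gives the result and the other terms cancel in pairs. -/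
theorem sum_shift_anticomm {V : Type*} [AddCommGroup V] [Module ℝ V] {s : ℝ} (hs : s * s = 1)
    (C : Fin n → Finset (Fin n) → V) (θ : V →ₗ[ℝ] V) (ν : Fin n)
    (hθ : ∀ κ N, θ (C κ N) = if ν ∈ N then 0 else (s * idxSign N ν) • C κ (insert ν N))
    (N : Finset (Fin n)) :
    (if ν ∈ N then 0 else (s * idxSign N ν) •
      ∑ κ ∈ insert ν N, (s * idxSign (insert ν N) κ) • C κ ((insert ν N).erase κ)) +
      θ (∑ κ ∈ N, (s * idxSign N κ) • C κ (N.erase κ)) = C ν N := by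
  rw [map_sum]
  by_cases hν : ν ∈ N
  · have h := idxSign_insert_self (Finset.notMem_erase ν N)
    rw [Finset.insert_erase hν] at h
    rw [if_pos hν, zero_add, Finset.sum_eq_single ν, map_smul, hθ,
      if_neg (Finset.notMem_erase ν N), Finset.insert_erase hν, smul_smul, ← h]
    · rw [show s * idxSign N ν * (s * idxSign N ν) = (s * s) * (idxSign N ν * idxSign N ν) by ring,
        hs, idxSign_mul_self, one_mul, one_smul]
    · intro κ _ hκ
      rw [map_smul, hθ, if_pos (Finset.mem_erase.2 ⟨hκ.symm, hν⟩), smul_zero]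
    · exact fun h => absurd hν h
  · rw [if_neg hν, Finset.sum_insert hν, smul_add, idxSign_insert_self hν, smul_smul,
      Finset.erase_insert hν, show s * idxSign N ν * (s * idxSign N ν) =
        (s * s) * (idxSign N ν * idxSign N ν) by ring, hs, idxSign_mul_self, one_mul, one_smul,
      add_assoc, Finset.smul_sum, ← Finset.sum_add_distrib, Finset.sum_eq_zero, add_zero]
    intro κ hκ
    have hne : ν ≠ κ := fun h => hν (h ▸ hκ)
    have hν' : ν ∉ N.erase κ := fun h => hν (Finset.mem_of_mem_erase h)
    rw [map_smul, hθ, if_neg hν', Finset.erase_insert_of_ne hne,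
      smul_smul, smul_smul, ← add_smul]
    convert zero_smul ℝ _
    obtain ⟨M, hM, rfl⟩ : ∃ M, κ ∉ M ∧ N = insert κ M :=
      ⟨N.erase κ, Finset.notMem_erase κ N, (Finset.insert_erase hκ).symm⟩
    rw [Finset.erase_insert hM] at hν' ⊢
    rw [Finset.insert_comm, idxSign_insert_self (N := insert ν M) (by simp [hne.symm, hM]),
      idxSign_insert_self hM]
    have h1 := idxSign_insert_swap hM hν' hne.symm
    rcases lt_or_gt_of_ne hne with h | h
    · rw [idxSign_insert hM, if_neg h.not_gt, idxSign_insert hν', if_pos h]; ring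
    · rw [idxSign_insert hM, if_pos h, idxSign_insert hν', if_neg h.not_gt]; ring

theorem isSDer_parent (hS : ∀ A, HasParity (p A + 1) (S A)) :
    IsSDer (AlgHom.id ℝ (LocalFun n (parentParity n p))) 1 (evol (parentS S)) :=
  isSDer_evol (hasParity_parentS hS)

/-- The anticommutator of the parent differential with `∂/∂θ^ν`. -/
noncomputable def thetaShift (S : F → LocalFun n p) (ν : Fin n) :
    LocalFun n (parentParity n p) →ₗ[ℝ] LocalFun n (parentParity n p) :=
  evol (parentS S) ∘ₗ thetaD p ν + thetaD p ν ∘ₗ evol (parentS S)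

theorem thetaShift_apply (S : F → LocalFun n p) (ν : Fin n)
    (f : LocalFun n (parentParity n p)) : thetaShift S ν f =
      evol (parentS S) (thetaD p ν f) + thetaD p ν (evol (parentS S) f) := rfl

theorem isSDer_thetaShift (hS : ∀ A, HasParity (p A + 1) (S A)) (ν : Fin n) :
    IsSDer (AlgHom.id ℝ (LocalFun n (parentParity n p))) 0 (thetaShift S ν) :=
  (isSDer_parent hS).anticomm (isSDer_thetaD p ν)

theorem thetaShift_totalD (hS : ∀ A, HasParity (p A + 1) (S A)) (ν μ : Fin n)
    (f : LocalFun n (parentParity n p)) :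
    thetaShift S ν (totalD _ μ f) = totalD _ μ (thetaShift S ν f) := by
  rw [thetaShift_apply, thetaShift_apply, thetaD_totalD, evol_totalD (hasParity_parentS hS),
    evol_totalD (hasParity_parentS hS), thetaD_totalD, map_add]

theorem thetaShift_xCoord (S : F → LocalFun n p) (ν μ : Fin n) :
    thetaShift S ν (xCoord _ μ) = 0 := by
  rw [thetaShift_apply, thetaD_xCoord, evol_xCoord, map_zero, map_zero, add_zero]

/-- The signs of `sBar` for `j` and `j + 1` indices are related so that `s̄` anticommutes with
`∂/∂θ^ν`. -/
theorem sgn_parent_cancel (a : ZMod 2) (j : ℕ) :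
    sgn a * sgn (((j + 1 : ℕ) : ZMod 2) * (a + 1)) + sgn ((j : ZMod 2) * (a + 1)) = 0 := by
  rw [Nat.cast_succ, add_mul, sgn_add, one_mul, sgn_add, sgn_one]
  linear_combination (-sgn ((j : ZMod 2) * (a + 1))) * sgn_mul_self a

/-- The `s̄` parts cancel by the choice of signs, and `d^F - σ^F` contributes through
`sum_shift_anticomm`. The number of indices in `N` is unchanged, on which the filtration argument
rests. -/
theorem thetaShift_jetCoord (hS : ∀ A, HasParity (p A + 1) (S A)) (ν : Fin n) (A : F)
    (l : Fin n → ℕ) (N : Finset (Fin n)) (m : Fin n → ℕ) :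
    thetaShift S ν (jetCoord _ (A, l, N) m) = shiftTerm p A l m ν N := by
  suffices h : thetaShift S ν (jetCoord _ (A, l, N) 0) = shiftTerm p A l 0 ν N by
    rw [jetCoord_eq_totalDs, map_totalDs (thetaShift_totalD hS ν), h, shiftTerm, map_sub,
      totalDs_jetCoord, totalDs_jetCoord, shiftTerm, zero_add, zero_add, add_comm m]
  rw [thetaShift_apply, thetaD_jetCoord, evol_jetCoord_zero,
    ← sum_shift_anticomm (sgn_mul_self (p A)) (shiftTerm p A l 0) (thetaD p ν) ν
      (fun κ N => thetaD_shiftTerm p ν A l 0 κ N) N, parentS_eq, map_add, map_smul,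
    thetaD_thetaDs]
  split_ifs with h
  · rw [map_zero, smul_zero, add_zero]
  · rw [map_smul, evol_jetCoord_zero, parentS_eq, Finset.card_insert_of_notMem h, smul_add,
      add_add_add_comm, add_eq_left, smul_smul, smul_smul, ← add_smul]
    convert zero_smul ℝ _
    linear_combination idxSign N ν * sgn_parent_cancel (p A) N.card

theorem thetaShift_thetaD (hS : ∀ A, HasParity (p A + 1) (S A)) (ν κ : Fin n)
    (f : LocalFun n (parentParity n p)) :
    thetaShift S ν (thetaD p κ f) = thetaD p κ (thetaShift S ν f) := by
  refine ((isSDer_thetaD p κ).comm_of_coord (isSDer_thetaShift hS ν) ?_ f).symm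
  rintro (μ | ⟨⟨A, l, N⟩, m⟩)
  · change thetaD p κ (thetaShift S ν (xCoord _ μ)) = thetaShift S ν (thetaD p κ (xCoord _ μ))
    rw [thetaShift_xCoord, thetaD_xCoord, map_zero, map_zero]
  · change thetaD p κ (thetaShift S ν (jetCoord _ (A, l, N) m)) =
      thetaShift S ν (thetaD p κ (jetCoord _ (A, l, N) m))
    rw [thetaShift_jetCoord hS, thetaD_shiftTerm, thetaD_jetCoord]
    split_ifs
    · rw [map_zero]
    · rw [map_smul, thetaShift_jetCoord hS]

theorem thetaShift_comm (hS : ∀ A, HasParity (p A + 1) (S A)) (ν κ : Fin n)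
    (f : LocalFun n (parentParity n p)) :
    thetaShift S ν (thetaShift S κ f) = thetaShift S κ (thetaShift S ν f) := by
  refine (isSDer_thetaShift hS ν).comm_of_coord (isSDer_thetaShift hS κ) ?_ f
  rintro (μ | ⟨⟨A, l, N⟩, m⟩)
  · change thetaShift S ν (thetaShift S κ (xCoord _ μ)) =
      thetaShift S κ (thetaShift S ν (xCoord _ μ))
    rw [thetaShift_xCoord, thetaShift_xCoord, map_zero, map_zero]
  · change thetaShift S ν (thetaShift S κ (jetCoord _ (A, l, N) m)) =
      thetaShift S κ (thetaShift S ν (jetCoord _ (A, l, N) m))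
    rw [thetaShift_jetCoord hS, thetaShift_jetCoord hS, shiftTerm, shiftTerm, map_sub, map_sub,
      thetaShift_jetCoord hS, thetaShift_jetCoord hS, thetaShift_jetCoord hS,
      thetaShift_jetCoord hS, shiftTerm, shiftTerm, shiftTerm, shiftTerm,
      add_right_comm m, add_right_comm l]
    abel

theorem parent_bar (hS : ∀ A, HasParity (p A + 1) (S A)) (f : LocalFun n p) :
    evol (parentS S) (bar p f) = bar p (evol S f) := by
  refine LinearMap.congr_fun (((isSDer_parent hS).comp_right (isEven_bar p)).ext
    (IsEven.id.comp (isEven_bar p)) ((isSDer_evol hS).comp_left (isEven_bar p)) ?_) f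
  rintro (μ | ⟨A, l⟩)
  · change evol (parentS S) (bar p (xCoord p μ)) = bar p (evol S (xCoord p μ))
    rw [bar_xCoord, evol_xCoord, evol_xCoord, map_zero]
  · change evol (parentS S) (bar p (jetCoord p A l)) = bar p (evol S (jetCoord p A l))
    rw [bar_jetCoord, evol_jetCoord_zero, evol_jetCoord, parentS_eq, Finset.sum_empty, zero_add,
      Finset.card_empty, Nat.cast_zero, zero_mul, sgn_zero, one_smul]
    exact (parentSuperfields n p).thetas_empty _

/-- On functions of the `Ψ^A_{(λ)}` and `x`, the `y`-derivative together with the explicit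
`x`-dependence is the total derivative of the original theory; the explicit part cancels in the
difference. -/
theorem thetaShift_bar (hS : ∀ A, HasParity (p A + 1) (S A)) (ν : Fin n) (f : LocalFun n p) :
    thetaShift S ν (bar p f) = totalD _ ν (bar p f) - bar p (totalD p ν f) := by
  refine LinearMap.congr_fun (((isSDer_thetaShift hS ν).comp_right (isEven_bar p)).ext
    (IsEven.id.comp (isEven_bar p))
    (((isSDer_totalD (parentParity n p) ν).comp_right (isEven_bar p)).sub
      ((isSDer_totalD p ν).comp_left (isEven_bar p))) ?_) f
  rintro (μ | ⟨A, l⟩)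
  · change thetaShift S ν (bar p (xCoord p μ)) =
      totalD _ ν (bar p (xCoord p μ)) - bar p (totalD p ν (xCoord p μ))
    rw [bar_xCoord, thetaShift_xCoord, totalD_xCoord, totalD_xCoord]
    split_ifs
    · rw [map_one, sub_self]
    · rw [map_zero, sub_self]
  · change thetaShift S ν (bar p (jetCoord p A l)) =
      totalD _ ν (bar p (jetCoord p A l)) - bar p (totalD p ν (jetCoord p A l))
    rw [totalD_jetCoord, bar_jetCoord, bar_jetCoord, totalD_jetCoord, thetaShift_jetCoord hS]
    rfl

theorem parent_thetaD (S : F → LocalFun n p) (ν : Fin n) (f : LocalFun n (parentParity n p)) :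
    evol (parentS S) (thetaD p ν f) = thetaShift S ν f - thetaD p ν (evol (parentS S) f) := by
  rw [thetaShift_apply, add_sub_cancel_right]

/-- The commutator anticommutes with every `∂/∂θ^κ`, because the shifts commute with one another. So
it suffices to look at the lowest components, where `[s, ∂_ν] = 0` holds in the original theory. -/
theorem thetaShift_parent (hS : ∀ A, HasParity (p A + 1) (S A)) (ν : Fin n)
    (f : LocalFun n (parentParity n p)) :
    evol (parentS S) (thetaShift S ν f) = thetaShift S ν (evol (parentS S) f) := by
  rw [← sub_eq_zero]
  refine (parentSuperfields n p).eq_zero_of_lowest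
    ((isSDer_parent hS).comm (isSDer_thetaShift hS ν)) (fun μ => ?_) (fun μ g => ?_) (-1)
    (fun κ g => ?_) (fun k => ?_) f
  · rw [LinearMap.sub_apply, LinearMap.comp_apply, LinearMap.comp_apply, thetaShift_xCoord,
      evol_xCoord, map_zero, map_zero, sub_zero]
  · rw [LinearMap.sub_apply, LinearMap.comp_apply, LinearMap.comp_apply, LinearMap.sub_apply,
      LinearMap.comp_apply, LinearMap.comp_apply, thetaShift_totalD hS,
      evol_totalD (hasParity_parentS hS), evol_totalD (hasParity_parentS hS),
      thetaShift_totalD hS, map_sub]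
  · change evol (parentS S) (thetaShift S ν (thetaD p κ g)) -
      thetaShift S ν (evol (parentS S) (thetaD p κ g)) =
      (-1 : ℝ) • thetaD p κ (evol (parentS S) (thetaShift S ν g) -
        thetaShift S ν (evol (parentS S) g))
    rw [parent_thetaD, thetaShift_thetaD hS, parent_thetaD, map_sub, thetaShift_thetaD hS, map_sub,
      neg_one_smul, thetaShift_comm hS ν κ]
    abel
  · obtain ⟨A, l⟩ := k
    change evol (parentS S) (thetaShift S ν (jetCoord _ (A, l, ∅) 0)) -
      thetaShift S ν (evol (parentS S) (jetCoord _ (A, l, ∅) 0)) = 0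
    rw [← bar_jetCoord, thetaShift_bar hS, parent_bar hS, thetaShift_bar hS, map_sub,
      evol_totalD (hasParity_parentS hS), parent_bar hS, parent_bar hS, evol_totalD hS, sub_self]

/-- The commutator of `(s^P)^2` with `∂/∂θ^κ` is that of `s^P` with the shift, hence zero. On the
lowest components the square is that of the original differential. -/
theorem parent_nilpotent (hS : IsBRST S) (f : LocalFun n (parentParity n p)) :
    evol (parentS S) (evol (parentS S) f) = 0 := by
  refine (parentSuperfields n p).eq_zero_of_lowest (isSDer_parent hS.odd).sq (fun μ => ?_)
    (fun μ g => ?_) 1 (fun κ g => ?_) (fun k => ?_) f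
  · rw [LinearMap.comp_apply, evol_xCoord, map_zero]
  · rw [LinearMap.comp_apply, LinearMap.comp_apply, evol_totalD (hasParity_parentS hS.odd),
      evol_totalD (hasParity_parentS hS.odd)]
  · change evol (parentS S) (evol (parentS S) (thetaD p κ g)) =
      (1 : ℝ) • thetaD p κ (evol (parentS S) (evol (parentS S) g))
    rw [parent_thetaD, map_sub, parent_thetaD, thetaShift_parent hS.odd, one_smul]
    abel
  · obtain ⟨A, l⟩ := k
    change evol (parentS S) (evol (parentS S) (jetCoord _ (A, l, ∅) 0)) = 0
    rw [← bar_jetCoord, parent_bar hS.odd, parent_bar hS.odd, hS.nilpotent, map_zero]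

theorem thetaShift_mem_fieldsIn (hS : ∀ A, HasParity (p A + 1) (S A)) {r : ℕ} (ν : Fin n)
    {f : LocalFun n (parentParity n p)}
    (hf : f ∈ fieldsIn n _ fun b => (parentSuperfields n p).rank b < r) :
    thetaShift S ν f ∈ fieldsIn n _ fun b => (parentSuperfields n p).rank b < r := by
  refine der_mem_onlyIn IsEven.id (isSDer_thetaShift hS ν) (fun k hk => coord_mem_onlyIn hk) ?_ hf
  rintro (μ | ⟨⟨A, l, N⟩, m⟩) h
  · change thetaShift S ν (xCoord _ μ) ∈ _
    rw [thetaShift_xCoord]; exact zero_mem _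
  · change thetaShift S ν (jetCoord _ (A, l, N) m) ∈ _
    rw [thetaShift_jetCoord hS]
    exact sub_mem
      (jetCoord_mem_fieldsIn (Q := fun b => (parentSuperfields n p).rank b < r) (A := (A, l, N)) h _)
      (jetCoord_mem_fieldsIn (Q := fun b => (parentSuperfields n p).rank b < r)
        (A := (A, l + Pi.single ν 1, N)) h _)

/-- Up to functions of components with fewer indices, the parent differential acts on descendants
as the original differential. -/
theorem parent_thetaDs_bar (hS : ∀ A, HasParity (p A + 1) (S A)) (N : Finset (Fin n))
    (f : LocalFun n p) :
    evol (parentS S) (thetaDs p N (bar p f)) - (-1 : ℝ) ^ N.card • thetaDs p N (bar p (evol S f)) ∈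
      fieldsIn n _ fun b => (parentSuperfields n p).rank b < N.card := by
  induction N using Finset.induction_on_min with
  | empty =>
    have h : ∀ g, thetaDs p ∅ g = g := (parentSuperfields n p).thetas_empty
    rw [h, h, parent_bar hS, Finset.card_empty, pow_zero, one_smul, sub_self]
    exact zero_mem _
  | insert a N ha ih =>
    have haN : a ∉ N := fun h => lt_irrefl _ (ha a h)
    have h : ∀ g, thetaDs p (insert a N) g = thetaD p a (thetaDs p N g) :=
      (parentSuperfields n p).thetas_insert_min ha
    -- Moving `s^P` past one more `∂/∂θ^a` gives the shift, which keeps the rank at most `N.card`,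
    -- minus `∂/∂θ^a` of the previous error, whose rank it raises by at most one.
    have key : evol (parentS S) (thetaDs p (insert a N) (bar p f)) -
        (-1 : ℝ) ^ (insert a N).card • thetaDs p (insert a N) (bar p (evol S f)) =
        thetaShift S a (thetaDs p N (bar p f)) - thetaD p a (evol (parentS S)
          (thetaDs p N (bar p f)) - (-1 : ℝ) ^ N.card • thetaDs p N (bar p (evol S f))) := by
      rw [h, h, parent_thetaD, Finset.card_insert_of_notMem haN, pow_succ, map_sub, map_smul,
        mul_neg_one, neg_smul]
      abel
    rw [key, Finset.card_insert_of_notMem haN]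
    exact sub_mem (thetaShift_mem_fieldsIn hS a
      ((parentSuperfields n p).thetas_bar_mem_fieldsIn f N))
      ((parentSuperfields n p).theta_mem_fieldsIn ih a)

end Parent

theorem mem_onlyIn_of_forall {K : Type*} {p : K → ZMod 2} {Q : K → Prop} (h : ∀ k, Q k)
    (f : SuperFun p) : f ∈ onlyIn p Q := by
  refine DFunLike.congr_fun (IsEven.ext (Θ₂ := AlgHom.id ℝ _) (isEven_restrictTo _) fun k => ?_) f
  rw [restrictTo_coord, if_pos (h k)]; rfl

/-! ## Splittings of the fields -/

section Split

variable {n : ℕ} {F W R : Type*} {p : F → ZMod 2} {pw : W → ZMod 2} {pφ : R → ZMod 2}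

/-- The jet coordinates of the fields `φ^i`, and the base coordinates, among the coordinates of
the jet space of fields `w^a, v^a, φ^i`. -/
def IsRestCoord (n : ℕ) (W R : Type*) : Jet n (W ⊕ W ⊕ R) → Prop :=
  Sum.elim (fun _ => True) fun k =>
    Sum.elim (fun _ => False) (Sum.elim (fun _ => False) fun _ => True) k.1

/-- Set the fields `w^a, v^a` to zero. -/
noncomputable def projRest (n : ℕ) (pw : W → ZMod 2) (pφ : R → ZMod 2) :
    LocalFun n (splitParity pw pφ) →ₐ[ℝ] LocalFun n (splitParity pw pφ) :=
  restrictTo (jetParity n (splitParity pw pφ)) (IsRestCoord n W R)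

theorem isEven_projRest : IsEven (projRest n pw pφ) := isEven_restrictTo _

theorem projRest_xCoord (μ : Fin n) :
    projRest n pw pφ (xCoord _ μ) = xCoord _ μ :=
  (restrictTo_coord _ _).trans (if_pos trivial)

theorem projRest_w (a : W) (m : Fin n → ℕ) :
    projRest n pw pφ (jetCoord _ (Sum.inl a) m) = 0 :=
  (restrictTo_coord _ _).trans (if_neg id)

theorem projRest_v (a : W) (m : Fin n → ℕ) :
    projRest n pw pφ (jetCoord _ (Sum.inr (Sum.inl a)) m) = 0 :=
  (restrictTo_coord _ _).trans (if_neg id)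

theorem projRest_rest (i : R) (m : Fin n → ℕ) :
    projRest n pw pφ (jetCoord _ (Sum.inr (Sum.inr i)) m) =
      jetCoord _ (Sum.inr (Sum.inr i)) m :=
  (restrictTo_coord _ _).trans (if_pos trivial)

theorem projRest_totalD (μ : Fin n) (f : LocalFun n (splitParity pw pφ)) :
    projRest n pw pφ (totalD _ μ f) = totalD _ μ (projRest n pw pφ f) := by
  refine hom_totalD isEven_projRest projRest_xCoord
    (u := fun b => projRest n pw pφ (jetCoord _ b 0)) ?_ μ f
  rintro (a | a | i) m
  · rw [projRest_w, projRest_w, map_zero]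
  · rw [projRest_v, projRest_v, map_zero]
  · rw [projRest_rest, projRest_rest, ← jetCoord_eq_totalDs]

theorem projRest_totalDs (m : Fin n → ℕ) (f : LocalFun n (splitParity pw pφ)) :
    projRest n pw pφ (totalDs _ m f) = totalDs _ m (projRest n pw pφ f) :=
  map_totalDs (T := (projRest n pw pφ).toLinearMap) projRest_totalD m f

theorem isEven_inclRestJet : IsEven (inclRestJet n pw pφ) := isEven_rename _ _

theorem inclRestJet_xCoord (μ : Fin n) : inclRestJet n pw pφ (xCoord _ μ) = xCoord _ μ :=
  rename_coord _ _ _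

theorem inclRestJet_jetCoord (i : R) (m : Fin n → ℕ) :
    inclRestJet n pw pφ (jetCoord _ i m) = jetCoord _ (Sum.inr (Sum.inr i)) m :=
  rename_coord _ _ _

/-- `projRest` factors through the local functions of the `φ^i`. -/
theorem exists_inclRestJet_eq (n : ℕ) (pw : W → ZMod 2) (pφ : R → ZMod 2) :
    ∃ π : LocalFun n (splitParity pw pφ) →ₐ[ℝ] LocalFun n pφ, IsEven π ∧
      ∀ f, inclRestJet n pw pφ (π f) = projRest n pw pφ f := by
  have hu : ∀ b, HasParity (splitParity pw pφ b)
      ((Sum.elim 0 (Sum.elim 0 fun i => jetCoord pφ i 0) : W ⊕ W ⊕ R → LocalFun n pφ) b) := by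
    rintro (a | a | i)
    · exact HasParity.zero _
    · exact HasParity.zero _
    · exact hasParity_coord (p := jetParity n pφ) (Sum.inr (i, 0))
  refine ⟨fieldSubst _ hu, isEven_fieldSubst _ hu, fun f => DFunLike.congr_fun
    (IsEven.ext (Θ₁ := (inclRestJet n pw pφ).comp (fieldSubst _ hu))
      (isEven_inclRestJet.comp (isEven_fieldSubst _ hu)) ?_) f⟩
  rintro (μ | ⟨a | a | i, m⟩)
  · change inclRestJet n pw pφ (fieldSubst _ hu (xCoord _ μ)) = projRest n pw pφ (xCoord _ μ)
    rw [fieldSubst_xCoord, inclRestJet_xCoord, projRest_xCoord]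
  · change inclRestJet n pw pφ (fieldSubst _ hu (jetCoord _ (Sum.inl a) m)) =
      projRest n pw pφ (jetCoord _ (Sum.inl a) m)
    rw [fieldSubst_jetCoord, projRest_w, Sum.elim_inl, Pi.zero_apply, map_zero, map_zero]
  · change inclRestJet n pw pφ (fieldSubst _ hu (jetCoord _ (Sum.inr (Sum.inl a)) m)) =
      projRest n pw pφ (jetCoord _ (Sum.inr (Sum.inl a)) m)
    rw [fieldSubst_jetCoord, projRest_v, Sum.elim_inr, Sum.elim_inl, Pi.zero_apply, map_zero,
      map_zero]
  · change inclRestJet n pw pφ (fieldSubst _ hu (jetCoord _ (Sum.inr (Sum.inr i)) m)) =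
      projRest n pw pφ (jetCoord _ (Sum.inr (Sum.inr i)) m)
    rw [fieldSubst_jetCoord, projRest_rest, Sum.elim_inr, Sum.elim_inr, ← jetCoord_eq_totalDs,
      inclRestJet_jetCoord]

theorem projRest_inclRestJet (f : LocalFun n pφ) :
    projRest n pw pφ (inclRestJet n pw pφ f) = inclRestJet n pw pφ f := by
  refine DFunLike.congr_fun (IsEven.ext (Θ₁ := (projRest n pw pφ).comp (inclRestJet n pw pφ))
    (isEven_projRest.comp isEven_inclRestJet) ?_) f
  rintro (μ | ⟨i, m⟩)
  · change projRest n pw pφ (inclRestJet n pw pφ (xCoord _ μ)) = inclRestJet n pw pφ (xCoord _ μ)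
    rw [inclRestJet_xCoord, projRest_xCoord]
  · change projRest n pw pφ (inclRestJet n pw pφ (jetCoord _ i m)) =
      inclRestJet n pw pφ (jetCoord _ i m)
    rw [inclRestJet_jetCoord, projRest_rest]

/-- In the new coordinates this is the ideal of the `w, v` and all their derivatives, that is, the
kernel of putting them to zero. Equality of ideals thus becomes a comparison of homomorphisms. -/
theorem mem_eqIdeal_sup_iff {w v : W → LocalFun n p} {φ : R → LocalFun n p}
    {Φ : LocalFun n (splitParity pw pφ) ≃ₐ[ℝ] LocalFun n p}
    (h : IsFieldChange (Sum.elim w (Sum.elim v φ)) Φ) (f : LocalFun n p) :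
    f ∈ eqIdeal w ⊔ eqIdeal v ↔ projRest n pw pφ (Φ.symm f) = 0 := by
  have hw : ∀ a m, Φ (jetCoord _ (Sum.inl a) m) = totalDs p m (w a) := fun a m => h.jetCoord _ m
  have hv : ∀ a m, Φ (jetCoord _ (Sum.inr (Sum.inl a)) m) = totalDs p m (v a) :=
    fun a m => h.jetCoord _ m
  constructor
  · intro hf
    have key : eqIdeal w ⊔ eqIdeal v ≤
        RingHom.ker ((projRest n pw pφ).comp (Φ.symm.toAlgHom)) := by
      refine sup_le (Ideal.span_le.2 ?_) (Ideal.span_le.2 ?_)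
      · rintro _ ⟨⟨a, m⟩, rfl⟩
        change projRest n pw pφ (Φ.symm (totalDs p m (w a))) = 0
        rw [← hw, Φ.symm_apply_apply, projRest_w]
      · rintro _ ⟨⟨a, m⟩, rfl⟩
        change projRest n pw pφ (Φ.symm (totalDs p m (v a))) = 0
        rw [← hv, Φ.symm_apply_apply, projRest_v]
    exact key hf
  · intro hf
    have h1 := mem_span_coord_of_restrictTo_eq_zero _ hf
    have key : Ideal.span {g | ∃ k, ¬ IsRestCoord n W R k ∧
        g = coord (jetParity n (splitParity pw pφ)) k} ≤
        Ideal.comap Φ (eqIdeal w ⊔ eqIdeal v) := by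
      refine Ideal.span_le.2 ?_
      rintro _ ⟨μ | ⟨a | a | i, m⟩, hk, rfl⟩
      · exact absurd trivial hk
      · change Φ (jetCoord _ (Sum.inl a) m) ∈ eqIdeal w ⊔ eqIdeal v
        rw [hw]
        exact (le_sup_left : eqIdeal w ≤ _) (Ideal.subset_span ⟨(a, m), rfl⟩)
      · change Φ (jetCoord _ (Sum.inr (Sum.inl a)) m) ∈ eqIdeal w ⊔ eqIdeal v
        rw [hv]
        exact (le_sup_right : eqIdeal v ≤ _) (Ideal.subset_span ⟨(a, m), rfl⟩)
      · exact absurd trivial hk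
    have h2 := key h1
    rw [Ideal.mem_comap, Φ.apply_symm_apply] at h2
    exact h2

theorem exists_shift_fieldChange (rank : W ⊕ W ⊕ R → ℕ) {N : ℕ} (hN : ∀ b, rank b < N)
    (g : R → LocalFun n (splitParity pw pφ)) (hg : ∀ i, HasParity (pφ i) (g i))
    (hgr : ∀ i, g i ∈ fieldsIn n (splitParity pw pφ) fun b => rank b < rank (Sum.inr (Sum.inr i))) :
    ∃ T : LocalFun n (splitParity pw pφ) ≃ₐ[ℝ] LocalFun n (splitParity pw pφ),
      IsFieldChange (Sum.elim (fun a => jetCoord _ (Sum.inl a) 0)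
        (Sum.elim (fun a => jetCoord _ (Sum.inr (Sum.inl a)) 0)
          fun i => jetCoord _ (Sum.inr (Sum.inr i)) 0 + g i)) T ∧
      (∀ k, ∀ f ∈ fieldsIn n _ fun b => rank b < k, T.symm f ∈ fieldsIn n _ fun b => rank b < k) ∧
      ∀ k, ∀ f ∈ fieldsIn n _ fun b => rank b < k, T f ∈ fieldsIn n _ fun b => rank b < k := by
  obtain ⟨T, hT, hT'⟩ := exists_triangular_fieldChange rank (fun _ => 1) (fun _ => one_ne_zero)
    (Sum.elim 0 (Sum.elim 0 g)) (by
      rintro (a | a | i)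
      · exact HasParity.zero _
      · exact HasParity.zero _
      · exact hg i) (by
      rintro (a | a | i)
      · exact zero_mem _
      · exact zero_mem _
      · exact hgr i) hN
  refine ⟨T, ?_, hT', fun k f hf => hT.mem_fieldsIn (Q := fun b => rank b < k) (fun b hb => ?_) hf⟩
  · convert hT using 1
    funext b
    rcases b with a | a | i
    · change jetCoord _ (Sum.inl a) 0 = (1 : ℝ) • jetCoord _ (Sum.inl a) 0 + 0
      rw [one_smul, add_zero]
    · change jetCoord _ (Sum.inr (Sum.inl a)) 0 =
        (1 : ℝ) • jetCoord _ (Sum.inr (Sum.inl a)) 0 + 0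
      rw [one_smul, add_zero]
    · change jetCoord _ (Sum.inr (Sum.inr i)) 0 + g i =
        (1 : ℝ) • jetCoord _ (Sum.inr (Sum.inr i)) 0 + g i
      rw [one_smul]
  · refine add_mem (Subalgebra.smul_mem _
      (jetCoord_mem_fieldsIn (Q := fun b => rank b < k) hb 0) _) ?_
    rcases b with a | a | i
    · exact zero_mem _
    · exact zero_mem _
    · exact fieldsIn_mono (fun b' hb' => lt_trans hb' hb) (hgr i)

end Split

/-! ## Decoupling of contractible pairs -/

section Decouple

variable {n : ℕ} {W R : Type*} {pw : W → ZMod 2} {pφ : R → ZMod 2}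

/-- The odd vector field that sends `v^a` to `w^a` and annihilates the `w^a` and the `φ^i`. -/
noncomputable def homotopy (n : ℕ) (pw : W → ZMod 2) (pφ : R → ZMod 2) :
    Module.End ℝ (LocalFun n (splitParity pw pφ)) :=
  evol (Sum.elim 0 (Sum.elim (fun a => jetCoord _ (Sum.inl a) 0) 0))

theorem hasParity_homotopy_aux (b : W ⊕ W ⊕ R) : HasParity (splitParity pw pφ b + 1)
    ((Sum.elim 0 (Sum.elim (fun a => jetCoord _ (Sum.inl a) 0) 0) :
      W ⊕ W ⊕ R → LocalFun n (splitParity pw pφ)) b) := by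
  rcases b with a | a | i
  · exact HasParity.zero _
  · change HasParity (pw a + 1 + 1) (jetCoord (splitParity pw pφ) (Sum.inl a) 0)
    rw [add_assoc, zmod2_add_self, add_zero]
    exact hasParity_coord (p := jetParity n (splitParity pw pφ)) (Sum.inr (Sum.inl a, 0))
  · exact HasParity.zero _

theorem isSDer_homotopy :
    IsSDer (AlgHom.id ℝ (LocalFun n (splitParity pw pφ))) 1 (homotopy n pw pφ) :=
  isSDer_evol hasParity_homotopy_aux

theorem homotopy_xCoord (μ : Fin n) : homotopy n pw pφ (xCoord _ μ) = 0 := evol_xCoord _ μ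

theorem homotopy_totalD (μ : Fin n) (f : LocalFun n (splitParity pw pφ)) :
    homotopy n pw pφ (totalD _ μ f) = totalD _ μ (homotopy n pw pφ f) :=
  evol_totalD hasParity_homotopy_aux μ f

theorem homotopy_w (a : W) (m : Fin n → ℕ) :
    homotopy n pw pφ (jetCoord _ (Sum.inl a) m) = 0 :=
  (evol_jetCoord _ _ _).trans (map_zero _)

theorem homotopy_v (a : W) (m : Fin n → ℕ) :
    homotopy n pw pφ (jetCoord _ (Sum.inr (Sum.inl a)) m) = jetCoord _ (Sum.inl a) m :=
  (evol_jetCoord _ _ _).trans (jetCoord_eq_totalDs _ _ _).symm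

theorem homotopy_rest (i : R) (m : Fin n → ℕ) :
    homotopy n pw pφ (jetCoord _ (Sum.inr (Sum.inr i)) m) = 0 :=
  (evol_jetCoord _ _ _).trans (map_zero _)

theorem homotopy_of_projRest {f : LocalFun n (splitParity pw pφ)} (hf : projRest n pw pφ f = f) :
    homotopy n pw pφ f = 0 := by
  refine der_eq_of_onlyIn (Θ₂ := AlgHom.id ℝ _) (Q := IsRestCoord n W R) IsEven.id
    (fun _ _ => rfl) isSDer_homotopy (IsSDer.zero _ _) ?_ hf
  rintro (μ | ⟨a | a | i, m⟩) hk
  · exact homotopy_xCoord μ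
  · exact absurd hk id
  · exact absurd hk id
  · exact homotopy_rest i m

/-- Replacing `v^a` by `w^a` does not raise the rank. -/
theorem homotopy_mem_fieldsIn {rank : W ⊕ W ⊕ R → ℕ}
    (hrank : ∀ a, rank (Sum.inl a) ≤ rank (Sum.inr (Sum.inl a))) {k : ℕ}
    {f : LocalFun n (splitParity pw pφ)} (hf : f ∈ fieldsIn n _ fun b => rank b < k) :
    homotopy n pw pφ f ∈ fieldsIn n _ fun b => rank b < k := by
  refine der_mem_onlyIn IsEven.id isSDer_homotopy (fun k hk => coord_mem_onlyIn hk) ?_ hf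
  rintro (μ | ⟨a | a | i, m⟩) hk
  · change homotopy n pw pφ (xCoord _ μ) ∈ _
    rw [homotopy_xCoord]; exact zero_mem _
  · change homotopy n pw pφ (jetCoord _ _ _) ∈ _
    rw [homotopy_w]; exact zero_mem _
  · change homotopy n pw pφ (jetCoord _ _ _) ∈ _
    rw [homotopy_v]
    exact jetCoord_mem_fieldsIn (Q := fun b => rank b < k) ((hrank a).trans_lt hk) m
  · change homotopy n pw pφ (jetCoord _ _ _) ∈ _
    rw [homotopy_rest]; exact zero_mem _

/-- The vector field that counts the `w^a` and `v^a`. -/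
noncomputable def pairEuler (n : ℕ) (pw : W → ZMod 2) (pφ : R → ZMod 2) :
    Module.End ℝ (LocalFun n (splitParity pw pφ)) :=
  eulerField (jetParity n (splitParity pw pφ)) (IsRestCoord n W R)

theorem isSDer_pairEuler :
    IsSDer (AlgHom.id ℝ (LocalFun n (splitParity pw pφ))) 0 (pairEuler n pw pφ) :=
  isSDer_eulerField (p := jetParity n (splitParity pw pφ)) (IsRestCoord n W R)

theorem pairEuler_xCoord (μ : Fin n) : pairEuler n pw pφ (xCoord _ μ) = 0 :=
  (eulerField_coord _ _).trans (if_pos trivial)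

theorem pairEuler_w (a : W) (m : Fin n → ℕ) :
    pairEuler n pw pφ (jetCoord _ (Sum.inl a) m) = jetCoord _ (Sum.inl a) m :=
  (eulerField_coord _ _).trans (if_neg id)

theorem pairEuler_v (a : W) (m : Fin n → ℕ) :
    pairEuler n pw pφ (jetCoord _ (Sum.inr (Sum.inl a)) m) =
      jetCoord _ (Sum.inr (Sum.inl a)) m :=
  (eulerField_coord _ _).trans (if_neg id)

theorem pairEuler_rest (i : R) (m : Fin n → ℕ) :
    pairEuler n pw pφ (jetCoord _ (Sum.inr (Sum.inr i)) m) = 0 :=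
  (eulerField_coord _ _).trans (if_pos trivial)

/-- In coordinates `w^a, v^a, φ^i`, a vector field that preserves the `w^a` and `v^a` and
annihilates the `φ^i` of rank below `k` counts the `w^a` and `v^a` in functions of the fields of
rank below `k`. -/
theorem apply_pairEuler_of_rank_lt
    {L : LocalFun n (splitParity pw pφ) →ₗ[ℝ] LocalFun n (splitParity pw pφ)}
    (hL : IsSDer (AlgHom.id ℝ _) 0 L) (hx : ∀ μ, L (xCoord _ μ) = 0)
    (hD : ∀ μ f, L (totalD _ μ f) = totalD _ μ (L f))
    (hw : ∀ a, L (jetCoord _ (Sum.inl a) 0) = jetCoord _ (Sum.inl a) 0)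
    (hv : ∀ a, L (jetCoord _ (Sum.inr (Sum.inl a)) 0) = jetCoord _ (Sum.inr (Sum.inl a)) 0)
    {φ : R → LocalFun n (splitParity pw pφ)}
    {T : LocalFun n (splitParity pw pφ) ≃ₐ[ℝ] LocalFun n (splitParity pw pφ)}
    (hT : IsFieldChange (Sum.elim (fun a => jetCoord _ (Sum.inl a) 0)
        (Sum.elim (fun a => jetCoord _ (Sum.inr (Sum.inl a)) 0) φ)) T)
    {rank : W ⊕ W ⊕ R → ℕ} {k : ℕ}
    (hφ : ∀ i, rank (Sum.inr (Sum.inr i)) < k → L (φ i) = 0)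
    {f : LocalFun n (splitParity pw pφ)} (hf : f ∈ fieldsIn n _ fun b => rank b < k) :
    L (T f) = T (pairEuler n pw pφ f) := by
  have hLs : ∀ m f, L (totalDs _ m f) = totalDs _ m (L f) := map_totalDs hD
  refine der_eq_of_onlyIn (Θ₁ := T.toAlgHom) (Θ₂ := T.toAlgHom) hT.isEven (fun _ _ => rfl)
    (hL.comp_right hT.isEven) (isSDer_pairEuler.comp_left hT.isEven) ?_ hf
  rintro (μ | ⟨a | a | i, m⟩) hk
  · change L (T (xCoord _ μ)) = T (pairEuler n pw pφ (xCoord _ μ))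
    rw [hT.xCoord, hx, pairEuler_xCoord, map_zero]
  · change L (T (jetCoord _ _ m)) = T (pairEuler n pw pφ (jetCoord _ _ m))
    rw [pairEuler_w, hT.jetCoord, hLs, Sum.elim_inl, hw]
  · change L (T (jetCoord _ _ m)) = T (pairEuler n pw pφ (jetCoord _ _ m))
    rw [pairEuler_v, hT.jetCoord, hLs, Sum.elim_inr, Sum.elim_inl, hv]
  · change L (T (jetCoord _ _ m)) = T (pairEuler n pw pφ (jetCoord _ _ m))
    rw [pairEuler_rest, hT.jetCoord, hLs, Sum.elim_inr, Sum.elim_inr, hφ i hk, map_zero, map_zero]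

/-- Every value of the homotopy is linear in the `w^a` and their derivatives, and these are
unaffected by a correction of the `φ^i`. So it vanishes at `w = v = 0` whatever the remaining fields
are. -/
theorem projRest_symm_homotopy {φ : R → LocalFun n (splitParity pw pφ)}
    {T : LocalFun n (splitParity pw pφ) ≃ₐ[ℝ] LocalFun n (splitParity pw pφ)}
    (hT : IsFieldChange (Sum.elim (fun a => jetCoord _ (Sum.inl a) 0)
        (Sum.elim (fun a => jetCoord _ (Sum.inr (Sum.inl a)) 0) φ)) T)
    (f : LocalFun n (splitParity pw pφ)) :
    projRest n pw pφ (T.symm (homotopy n pw pφ f)) = 0 := by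
  have hS : IsEven ((projRest n pw pφ).comp T.symm.toAlgHom) :=
    isEven_projRest.comp hT.isEven_symm
  refine LinearMap.congr_fun ((isSDer_homotopy.comp_left hS).ext (hS.comp IsEven.id)
    (IsSDer.zero _ _) ?_) f
  rintro (μ | ⟨a | a | i, m⟩)
  · change projRest n pw pφ (T.symm (homotopy n pw pφ (xCoord _ μ))) = 0
    rw [homotopy_xCoord, map_zero, map_zero]
  · change projRest n pw pφ (T.symm (homotopy n pw pφ (jetCoord _ _ m))) = 0
    rw [homotopy_w, map_zero, map_zero]
  · change projRest n pw pφ (T.symm (homotopy n pw pφ (jetCoord _ _ m))) = 0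
    have : T.symm (jetCoord _ (Sum.inl a) m) = jetCoord _ (Sum.inl a) m := by
      rw [AlgEquiv.symm_apply_eq, hT.jetCoord, Sum.elim_inl, ← jetCoord_eq_totalDs]
    rw [homotopy_v, this, projRest_w]
  · change projRest n pw pφ (T.symm (homotopy n pw pφ (jetCoord _ _ m))) = 0
    rw [homotopy_rest, map_zero, map_zero]

/-- A differential that maps `w^a` to `v^a`, and the `φ^i` to functions of the `φ^j` up to terms
of lower rank, decouples into `w^a, v^a` and corrected fields. -/
theorem exists_decoupled
    {Q : LocalFun n (splitParity pw pφ) →ₗ[ℝ] LocalFun n (splitParity pw pφ)}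
    (hQ : IsSDer (AlgHom.id ℝ _) 1 Q) (hx : ∀ μ, Q (xCoord _ μ) = 0)
    (hD : ∀ μ f, Q (totalD _ μ f) = totalD _ μ (Q f)) (hQQ : ∀ f, Q (Q f) = 0)
    (hw : ∀ a, Q (jetCoord _ (Sum.inl a) 0) = jetCoord _ (Sum.inr (Sum.inl a)) 0)
    (rank : W ⊕ W ⊕ R → ℕ) {N : ℕ} (hN : ∀ b, rank b < N)
    (hrank : ∀ a, rank (Sum.inl a) ≤ rank (Sum.inr (Sum.inl a)))
    (hφ : ∀ i, ∃ f, projRest n pw pφ f = f ∧ Q (jetCoord _ (Sum.inr (Sum.inr i)) 0) - f ∈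
      fieldsIn n (splitParity pw pφ) fun b => rank b < rank (Sum.inr (Sum.inr i))) :
    ∃ (φ : R → LocalFun n (splitParity pw pφ))
      (T : LocalFun n (splitParity pw pφ) ≃ₐ[ℝ] LocalFun n (splitParity pw pφ)),
      IsFieldChange (Sum.elim (fun a => jetCoord _ (Sum.inl a) 0)
        (Sum.elim (fun a => jetCoord _ (Sum.inr (Sum.inl a)) 0) φ)) T ∧
      ∀ i, ∃ g, Q (φ i) = T (inclRestJet n pw pφ g) := by
  set ρ := homotopy n pw pφ with hρ
  set L : LocalFun n (splitParity pw pφ) →ₗ[ℝ] LocalFun n (splitParity pw pφ) :=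
    Q ∘ₗ ρ + ρ ∘ₗ Q with hLdef
  have hLa : ∀ f, L f = Q (ρ f) + ρ (Q f) := fun f => rfl
  have hL : IsSDer (AlgHom.id ℝ _) 0 L := hQ.anticomm isSDer_homotopy
  have hLx : ∀ μ, L (xCoord _ μ) = 0 := fun μ => by
    rw [hLa, homotopy_xCoord, hx, map_zero, map_zero, add_zero]
  have hLD : ∀ μ f, L (totalD _ μ f) = totalD _ μ (L f) := fun μ f => by
    rw [hLa, hLa, homotopy_totalD, hD, hD, homotopy_totalD, map_add]
  have hLQ : ∀ f, L (Q f) = Q (L f) := fun f => by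
    rw [hLa, hLa, hQQ, map_add, hQQ, map_zero, add_zero, zero_add]
  have hLw : ∀ a, L (jetCoord _ (Sum.inl a) 0) = jetCoord _ (Sum.inl a) 0 := fun a => by
    rw [hLa, homotopy_w, hw, homotopy_v, map_zero, zero_add]
  have hLv : ∀ a, L (jetCoord _ (Sum.inr (Sum.inl a)) 0) = jetCoord _ (Sum.inr (Sum.inl a)) 0 :=
    fun a => by rw [hLa, homotopy_v, hw, ← hw, hQQ, map_zero, add_zero]
  have hLφ : ∀ i, L (jetCoord _ (Sum.inr (Sum.inr i)) 0) =
      ρ (Q (jetCoord _ (Sum.inr (Sum.inr i)) 0)) := fun i => by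
    rw [hLa, homotopy_rest, map_zero, zero_add]
  -- The leading part of `Q φ^i` depends on the `φ^j` only and is killed by the homotopy; the
  -- remaining terms are of lower rank and stay so.
  have hLr : ∀ i, L (jetCoord _ (Sum.inr (Sum.inr i)) 0) ∈
      fieldsIn n (splitParity pw pφ) fun b => rank b < rank (Sum.inr (Sum.inr i)) := fun i => by
    obtain ⟨f, hf, hf'⟩ := hφ i
    have := homotopy_mem_fieldsIn hrank hf'
    rwa [map_sub, homotopy_of_projRest hf, sub_zero, ← hρ, ← hLφ] at this
  have hLp : ∀ i, HasParity (pφ i) (L (jetCoord _ (Sum.inr (Sum.inr i)) 0)) := fun i => by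
    have := hL.hasParity (hasParity_coord (p := jetParity n (splitParity pw pφ))
      (Sum.inr (Sum.inr (Sum.inr i), 0)))
    rwa [add_zero] at this
  -- `g` is the correction to `φ`. At stage `k` only its values in rank below `k` matter; the others
  -- satisfy just the triangularity that keeps the corrected functions a system of fields.
  have main : ∀ k : ℕ, ∃ g : R → LocalFun n (splitParity pw pφ), (∀ i, HasParity (pφ i) (g i)) ∧
      (∀ i, g i ∈ fieldsIn n (splitParity pw pφ) fun b => rank b < rank (Sum.inr (Sum.inr i))) ∧
      ∀ i, rank (Sum.inr (Sum.inr i)) < k → L (jetCoord _ (Sum.inr (Sum.inr i)) 0 + g i) = 0 := by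
    intro k
    induction k with
    | zero =>
      exact ⟨0, fun i => HasParity.zero _, fun i => zero_mem _, fun i hi => absurd hi (by omega)⟩
    | succ k ih =>
      obtain ⟨g, hg, hgr, hgL⟩ := ih
      obtain ⟨T, hT, hTs, hTr⟩ := exists_shift_fieldChange rank hN g hg hgr
      have key : ∀ i, rank (Sum.inr (Sum.inr i)) = k →
          ∃ h : LocalFun n (splitParity pw pφ), HasParity (pφ i) h ∧
          h ∈ (fieldsIn n (splitParity pw pφ) fun b => rank b < k) ∧
          L (jetCoord _ (Sum.inr (Sum.inr i)) 0) = L h := by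
        intro i hi
        have hr := hLr i
        rw [hi] at hr
        -- In the corrected coordinates `L` is the Euler vector field on functions of rank below
        -- `k`. The function `L φ^i` is such a function and vanishes at `w = v = 0`, being in the
        -- image of the homotopy, so it has a preimage `κ`.
        obtain ⟨κ, hκ, hκ'⟩ := exists_eulerField_eq_of_hasParity (IsRestCoord n W R)
          (hT.isEven_symm.hasParity (hLp i)) (by
            rw [hLφ]; exact projRest_symm_homotopy hT _)
        -- The preimage may involve fields of higher rank. Putting these to zero commutes with the
        -- Euler vector field and does not change the right-hand side.
        have hκ2 : pairEuler n pw pφ (restrictTo _ (Sum.elim (fun _ => True)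
            fun b => rank b.1 < k) κ) = T.symm (L (jetCoord _ (Sum.inr (Sum.inr i)) 0)) :=
          (eulerField_restrictTo _ _ κ).trans ((congrArg _ hκ').trans (hTs k _ hr))
        refine ⟨T (restrictTo _ (Sum.elim (fun _ => True) fun b => rank b.1 < k) κ),
          hT.isEven.hasParity ((isEven_restrictTo _).hasParity hκ),
          hTr k _ (restrictTo_mem _ _), ?_⟩
        rw [apply_pairEuler_of_rank_lt hL hLx hLD hLw hLv hT hgL (restrictTo_mem _ _), hκ2,
          T.apply_symm_apply]
      choose! h hp hr hh using key
      classical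
      -- Subtracting `h i` cancels `L φ^i` in rank `k`; the provisional value of `g` there is
      -- discarded.
      refine ⟨fun i => if rank (Sum.inr (Sum.inr i)) = k then -h i else g i, fun i => ?_,
        fun i => ?_, fun i hi => ?_⟩
      · dsimp only
        split_ifs with hi
        · exact (hp i hi).neg
        · exact hg i
      · dsimp only
        split_ifs with hi
        · rw [hi]; exact neg_mem (hr i hi)
        · exact hgr i
      · dsimp only
        split_ifs with hi'
        · rw [map_add, map_neg, hh i hi', add_neg_cancel]
        · exact hgL i (by omega)
  obtain ⟨g, hg, hgr, hgL⟩ := main N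
  obtain ⟨T, hT, -, -⟩ := exists_shift_fieldChange rank hN g hg hgr
  obtain ⟨π, -, hπ⟩ := exists_inclRestJet_eq n pw pφ
  refine ⟨_, T, hT, fun i => ⟨π (T.symm (Q (jetCoord _ (Sum.inr (Sum.inr i)) 0 + g i))), ?_⟩⟩
  -- Now `L` is the Euler vector field on all functions, and it annihilates `Q φ'` because it
  -- commutes with `Q`.
  have h0 : pairEuler n pw pφ (T.symm (Q (jetCoord _ (Sum.inr (Sum.inr i)) 0 + g i))) = 0 := by
    apply T.injective
    rw [← apply_pairEuler_of_rank_lt hL hLx hLD hLw hLv hT hgL (mem_onlyIn_of_forall (by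
      rintro (μ | b)
      · trivial
      · exact hN b.1) _), T.apply_symm_apply, hLQ, hgL i (hN _), map_zero, map_zero]
  have h1 : projRest n pw pφ (T.symm (Q (jetCoord _ (Sum.inr (Sum.inr i)) 0 + g i))) =
      T.symm (Q (jetCoord _ (Sum.inr (Sum.inr i)) 0 + g i)) :=
    restrictTo_of_eulerField_eq_zero _ h0
  rw [hπ, h1, T.apply_symm_apply]

end Decouple

/-! ## Local generalized auxiliary fields -/

section Main

variable {n : ℕ} {F W R : Type*} {p : F → ZMod 2} {pw : W → ZMod 2} {pφ : R → ZMod 2}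
  {S : F → LocalFun n p} {w v : W → LocalFun n p} {φ : R → LocalFun n p}
  {Φ : LocalFun n (splitParity pw pφ) ≃ₐ[ℝ] LocalFun n p}

theorem mem_fieldsIn_rest_iff {f : LocalFun n (splitParity pw pφ)} :
    f ∈ fieldsIn n (splitParity pw pφ)
      (Sum.elim (fun _ => False) (Sum.elim (fun _ => False) fun _ => True)) ↔
      projRest n pw pφ f = f := Iff.rfl

/-- If `s w^a = v^a` up to a factor and terms of lower rank, there is a change of fields to
`w^a, s w^a, φ^i`. -/
theorem exists_fieldChange_of_rank (hS : ∀ A, HasParity (p A + 1) (S A))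
    (h : IsFieldChange (Sum.elim w (Sum.elim v φ)) Φ)
    (rank : W ⊕ W ⊕ R → ℕ) {N : ℕ} (hN : ∀ b, rank b < N)
    (hrank : ∀ a, rank (Sum.inl a) = rank (Sum.inr (Sum.inl a)))
    (c : W → ℝ) (hc : ∀ a, c a ≠ 0)
    (hw : ∀ a, Φ.symm (evol S (w a)) - c a • jetCoord _ (Sum.inr (Sum.inl a)) 0 ∈
      fieldsIn n (splitParity pw pφ) fun b => rank b < rank (Sum.inl a)) :
    ∃ T : LocalFun n (splitParity pw pφ) ≃ₐ[ℝ] LocalFun n (splitParity pw pφ),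
      IsFieldChange (Sum.elim (fun a => jetCoord _ (Sum.inl a) 0)
        (Sum.elim (fun a => Φ.symm (evol S (w a)))
          fun i => jetCoord _ (Sum.inr (Sum.inr i)) 0)) T ∧
      ∀ k, ∀ f ∈ fieldsIn n _ fun b => rank b < k,
        T.symm f ∈ fieldsIn n _ fun b => rank b < k := by
  obtain ⟨T, hT, hT'⟩ := exists_triangular_fieldChange (q := splitParity pw pφ) rank
    (Sum.elim (fun _ => 1) (Sum.elim c fun _ => 1)) (by
      rintro (a | a | i)
      · exact one_ne_zero
      · exact hc a
      · exact one_ne_zero)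
    (Sum.elim 0 (Sum.elim
      (fun a => Φ.symm (evol S (w a)) - c a • jetCoord _ (Sum.inr (Sum.inl a)) 0) 0)) (by
      rintro (a | a | i)
      · exact HasParity.zero _
      · exact (h.isEven_symm.hasParity ((isSDer_evol hS).hasParity (h.hasParity (Sum.inl a)))).sub
          ((hasParity_coord (p := jetParity n (splitParity pw pφ))
            (Sum.inr (Sum.inr (Sum.inl a), 0))).smul _)
      · exact HasParity.zero _) (by
      rintro (a | a | i)
      · exact zero_mem _
      · refine fieldsIn_mono (fun b hb => ?_) (hw a)
        rwa [hrank] at hb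
      · exact zero_mem _) hN
  refine ⟨T, ?_, hT'⟩
  convert hT using 1
  funext b
  rcases b with a | a | i
  · change jetCoord _ (Sum.inl a) 0 = (1 : ℝ) • jetCoord _ (Sum.inl a) 0 + 0
    rw [one_smul, add_zero]
  · exact (add_sub_cancel _ _).symm
  · change jetCoord _ (Sum.inr (Sum.inr i)) 0 =
      (1 : ℝ) • jetCoord _ (Sum.inr (Sum.inr i)) 0 + 0
    rw [one_smul, add_zero]

/-- The composite restricts functions to the surface `w = 0`, `y = 0`, parametrised by the `φ^i`. It
is fixed by the values of the `v^a` there, since `w` restricts to zero and `φ` to itself in both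
cases. -/
theorem projRest_symm_congr {y y' : W → LocalFun n (splitParity pw pφ)}
    {T E : LocalFun n (splitParity pw pφ) ≃ₐ[ℝ] LocalFun n (splitParity pw pφ)}
    (hT : IsFieldChange (Sum.elim (fun a => jetCoord _ (Sum.inl a) 0)
        (Sum.elim y fun i => jetCoord _ (Sum.inr (Sum.inr i)) 0)) T)
    (hE : IsFieldChange (Sum.elim (fun a => jetCoord _ (Sum.inl a) 0)
        (Sum.elim y' fun i => jetCoord _ (Sum.inr (Sum.inr i)) 0)) E)
    (h : ∀ a, projRest n pw pφ (T.symm (jetCoord _ (Sum.inr (Sum.inl a)) 0)) =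
      projRest n pw pφ (E.symm (jetCoord _ (Sum.inr (Sum.inl a)) 0)))
    (f : LocalFun n (splitParity pw pφ)) :
    projRest n pw pφ (T.symm f) = projRest n pw pφ (E.symm f) := by
  refine DFunLike.congr_fun (IsEven.ext (Θ₁ := (projRest n pw pφ).comp T.symm.toAlgHom)
    (Θ₂ := (projRest n pw pφ).comp E.symm.toAlgHom) (isEven_projRest.comp hT.isEven_symm) ?_) f
  rintro (μ | ⟨b, m⟩)
  · change projRest n pw pφ (T.symm (xCoord _ μ)) = projRest n pw pφ (E.symm (xCoord _ μ))
    rw [hT.symm_xCoord, hE.symm_xCoord]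
  · change projRest n pw pφ (T.symm (jetCoord _ b m)) = projRest n pw pφ (E.symm (jetCoord _ b m))
    rw [jetCoord_eq_totalDs, hT.symm_totalDs, hE.symm_totalDs, projRest_totalDs, projRest_totalDs]
    congr 1
    rcases b with a | a | i
    · exact congrArg _ ((hT.symm_apply (Sum.inl a)).trans (hE.symm_apply (Sum.inl a)).symm)
    · exact h a
    · exact congrArg _ ((hT.symm_apply (Sum.inr (Sum.inr i))).trans
        (hE.symm_apply (Sum.inr (Sum.inr i))).symm)

/-- A shear of the `v^a` by functions of the `φ^i`, which makes the left-hand sides of the solved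
equations `v^a - V^a = 0` new fields. -/
theorem exists_sub_fieldChange (V : W → LocalFun n pφ)
    (hV : ∀ a, HasParity (pw a + 1) (V a)) :
    ∃ E : LocalFun n (splitParity pw pφ) ≃ₐ[ℝ] LocalFun n (splitParity pw pφ),
      IsFieldChange (Sum.elim (fun a => jetCoord _ (Sum.inl a) 0)
        (Sum.elim (fun a => jetCoord _ (Sum.inr (Sum.inl a)) 0 - inclRestJet n pw pφ (V a))
          fun i => jetCoord _ (Sum.inr (Sum.inr i)) 0)) E ∧
      ∀ a, E.symm (jetCoord _ (Sum.inr (Sum.inl a)) 0) =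
        jetCoord _ (Sum.inr (Sum.inl a)) 0 + inclRestJet n pw pφ (V a) := by
  classical
  obtain ⟨E, hE, hE'⟩ := exists_elementary_fieldChange (q := splitParity pw pφ)
    (Sum.elim (fun _ => False) (Sum.elim (fun _ => True) fun _ => False)) (fun _ => 1)
    (fun _ => one_ne_zero) (Sum.elim 0 (Sum.elim (fun a => -inclRestJet n pw pφ (V a)) 0)) (by
      rintro (a | a | i)
      · exact HasParity.zero _
      · exact (isEven_inclRestJet.hasParity (hV a)).neg
      · exact HasParity.zero _) (by
      rintro (a | a | i) hb
      · exact hb.elim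
      · refine neg_mem (fieldsIn_mono ?_ (mem_fieldsIn_rest_iff.2 (projRest_inclRestJet (V a))))
        rintro (a | a | i) hb
        · exact id
        · exact hb.elim
        · exact id
      · exact hb.elim)
  refine ⟨E, ?_, fun a => ?_⟩
  · convert hE using 1
    funext b
    rcases b with a | a | i
    · exact (if_neg id).symm
    · refine Eq.trans ?_ (if_pos trivial).symm
      rw [one_smul]
      exact sub_eq_add_neg _ _
    · exact (if_neg id).symm
  · rw [hE']
    refine (if_pos trivial).trans ?_
    rw [inv_one, one_smul, sub_eq_add_neg, Sum.elim_inr, Sum.elim_inl, neg_neg]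

/-- Fields `w^a, v^a` are local generalized auxiliary fields if `s w^a = v^a` up to a factor and
terms of lower rank, and each `s φ^i` is a function of the `φ^j` up to terms of lower rank. -/
theorem isLocalGenAux_of_rank (hS : IsBRST S)
    (h : IsFieldChange (Sum.elim w (Sum.elim v φ)) Φ)
    (rank : W ⊕ W ⊕ R → ℕ) {N : ℕ} (hN : ∀ b, rank b < N)
    (hrank : ∀ a, rank (Sum.inl a) = rank (Sum.inr (Sum.inl a)))
    (c : W → ℝ) (hc : ∀ a, c a ≠ 0)
    (hw : ∀ a, Φ.symm (evol S (w a)) - c a • jetCoord _ (Sum.inr (Sum.inl a)) 0 ∈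
      fieldsIn n (splitParity pw pφ) fun b => rank b < rank (Sum.inl a))
    (hφ : ∀ i, ∃ f, projRest n pw pφ f = f ∧ Φ.symm (evol S (φ i)) - f ∈
      fieldsIn n (splitParity pw pφ) fun b => rank b < rank (Sum.inr (Sum.inr i))) :
    IsLocalGenAux S pw pφ w v φ := by
  obtain ⟨T, hT, hTr⟩ := exists_fieldChange_of_rank hS.odd h rank hN hrank c hc hw
  have h2 : IsFieldChange (Sum.elim w (Sum.elim (fun a => evol S (w a)) φ)) (T.trans Φ) := by
    convert h.trans hT using 1
    funext b
    rcases b with a | a | i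
    · exact (h.jetCoord_zero (Sum.inl a)).symm
    · exact (Φ.apply_symm_apply _).symm
    · exact (h.jetCoord_zero (Sum.inr (Sum.inr i))).symm
  refine ⟨⟨Φ, h, ?_⟩, ?_⟩
  · obtain ⟨π, hπ, hπ'⟩ := exists_inclRestJet_eq n pw pφ
    -- `V^a` is the value of `v^a` on the surface `w = s w = 0`: express `v^a` through `w, s w, φ`,
    -- then put `w` and `s w` to zero.
    have hV : ∀ a, HasParity (pw a + 1) (π (T.symm (jetCoord _ (Sum.inr (Sum.inl a)) 0))) :=
      fun a => hπ.hasParity (hT.isEven_symm.hasParity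
        (hasParity_coord (p := jetParity n (splitParity pw pφ))
          (Sum.inr (Sum.inr (Sum.inl a), 0))))
    obtain ⟨E, hE, hE'⟩ := exists_sub_fieldChange _ hV
    have h3 : IsFieldChange (Sum.elim w (Sum.elim (fun a => v a - Φ (inclRestJet n pw pφ
        (π (T.symm (jetCoord _ (Sum.inr (Sum.inl a)) 0))))) φ)) (E.trans Φ) := by
      convert h.trans hE using 1
      funext b
      rcases b with a | a | i
      · exact (h.jetCoord_zero (Sum.inl a)).symm
      · refine Eq.trans ?_ (map_sub Φ _ _).symm
        rw [h.jetCoord_zero]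
        rfl
      · exact (h.jetCoord_zero (Sum.inr (Sum.inr i))).symm
    refine ⟨_, hV, Ideal.ext fun f => ?_⟩
    -- Both ideals are now kernels of restrictions, and the two restrictions agree on `v^a` by the
    -- choice of `V^a`.
    rw [mem_eqIdeal_sup_iff h2, mem_eqIdeal_sup_iff h3]
    change projRest n pw pφ (T.symm (Φ.symm f)) = 0 ↔ projRest n pw pφ (E.symm (Φ.symm f)) = 0
    rw [projRest_symm_congr hT hE fun a => ?_]
    rw [hE', map_add, projRest_v, zero_add, projRest_inclRestJet, hπ']
  -- The differential is transported to the fields `w, s w, φ`, where it maps `w^a` exactly to its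
  -- partner.
  · have hQ : IsSDer (AlgHom.id ℝ _) 1 ((T.trans Φ).symm.toLinearMap ∘ₗ evol S ∘ₗ
        (T.trans Φ).toLinearMap) :=
      IsSDer.conj (Φ := (T.trans Φ).symm) h2.isEven_symm h2.isEven (isSDer_evol hS.odd)
    have hx : ∀ μ, (T.trans Φ).symm (evol S ((T.trans Φ) (xCoord _ μ))) = 0 := fun μ => by
      rw [h2.xCoord, evol_xCoord, map_zero]
    have hD : ∀ μ f, (T.trans Φ).symm (evol S ((T.trans Φ) (totalD _ μ f))) =
        totalD _ μ ((T.trans Φ).symm (evol S ((T.trans Φ) f))) := fun μ f => by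
      rw [h2.totalD, evol_totalD hS.odd, h2.symm_totalD]
    have hQQ : ∀ f, (T.trans Φ).symm (evol S ((T.trans Φ)
        ((T.trans Φ).symm (evol S ((T.trans Φ) f))))) = 0 := fun f => by
      rw [AlgEquiv.apply_symm_apply, hS.nilpotent, map_zero]
    have hQw : ∀ a, (T.trans Φ).symm (evol S ((T.trans Φ) (jetCoord _ (Sum.inl a) 0))) =
        jetCoord _ (Sum.inr (Sum.inl a)) 0 := fun a => by
      rw [h2.jetCoord_zero]
      exact h2.symm_apply (Sum.inr (Sum.inl a))
    have hQφ : ∀ i, ∃ f, projRest n pw pφ f = f ∧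
        (T.trans Φ).symm (evol S ((T.trans Φ) (jetCoord _ (Sum.inr (Sum.inr i)) 0))) - f ∈
        fieldsIn n (splitParity pw pφ) fun b => rank b < rank (Sum.inr (Sum.inr i)) := by
      intro i
      obtain ⟨f, hf, hf'⟩ := hφ i
      refine ⟨f, hf, ?_⟩
      have h4 := hTr _ _ hf'
      -- Passing from `v` to `s w` leaves functions of the `φ^i` unchanged and its inverse preserves
      -- the filtration, so the hypothesis on `s φ^i` survives.
      have h5 : T f = f := hT.apply_eq_self
        (Q := Sum.elim (fun _ => False) (Sum.elim (fun _ => False) fun _ => True)) (by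
          rintro (a | a | i) hb
          · exact hb.elim
          · exact hb.elim
          · rfl) (mem_fieldsIn_rest_iff.2 hf)
      have h6 : T.symm f = f := by rw [AlgEquiv.symm_apply_eq, h5]
      rw [map_sub, h6] at h4
      rw [h2.jetCoord_zero]
      exact h4
    obtain ⟨φ', Ψ, hΨ, hΨ'⟩ :=
      exists_decoupled hQ hx hD hQQ hQw rank hN (fun a => (hrank a).le) hQφ
    refine ⟨fun i => (T.trans Φ) (φ' i), Ψ.trans (T.trans Φ), ?_, fun a => rfl, fun i => ?_⟩
    · convert h2.trans hΨ using 1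
      funext b
      rcases b with a | a | i
      · exact (h2.jetCoord_zero (Sum.inl a)).symm
      · exact (h2.jetCoord_zero (Sum.inr (Sum.inl a))).symm
      · rfl
    · obtain ⟨g, hg⟩ := hΨ' i
      exact ⟨g, (AlgEquiv.symm_apply_eq (T.trans Φ)).1 hg⟩

/-- The descendants of trivial pairs and of the remaining coordinates as components of
superfields. -/
noncomputable def splitSuperfields (n : ℕ) (pw : W → ZMod 2) (pφ : R → ZMod 2) :
    Superfields n (splitParity pw pφ) (splitParity (descParity n pw) (descParity n pφ)) where
  equiv := (Equiv.sumProdDistrib W (W ⊕ R) (Finset (Fin n))).trans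
    ((Equiv.refl _).sumCongr (Equiv.sumProdDistrib W R (Finset (Fin n))))
  parity_eq := by
    rintro (a | a | i) N
    · rfl
    · exact add_right_comm _ _ _
    · rfl
  -- Descendants are the `θ`-derivatives themselves, without the signs of the parent fields.
  sign _ := 1
  sign_mul_self _ := one_mul 1

theorem inclRest_mem_onlyIn (g : SuperFun (restParity n pφ)) : inclRest n pw pφ g ∈
    onlyIn (pairParity n pw pφ)
      (Sum.elim (fun _ => True) (Sum.elim (fun _ => False)
        (Sum.elim (fun _ => False) fun _ => True))) := by
  refine hom_mem_onlyIn (Q := fun _ => True) (isEven_rename _ _) ?_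
    (mem_onlyIn_of_forall (fun _ => trivial) g)
  rintro (μ | i) -
  · rw [rename_coord]
    exact coord_mem_onlyIn (p := pairParity n pw pφ) (k := Sum.inl μ) trivial
  · rw [rename_coord]
    exact coord_mem_onlyIn (p := pairParity n pw pφ)
      (k := Sum.inr (Sum.inr (Sum.inr i))) trivial

end Main

end ParentBRST

/-! ### The descendants of trivial pairs, filtered by the number of `θ`-indices. -/

open ParentBRST in
theorem proposition2p3 {n : ℕ} {F W R : Type*} (p : F → ZMod 2)
    (S : F → ParentBRST.LocalFun n p) (hS : ParentBRST.IsBRST S)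
    (pw : W → ZMod 2) (pφ : R → ZMod 2)
    (w v : W → ParentBRST.LocalFun n p) (φ : R → ParentBRST.LocalFun n p)
    (h : ParentBRST.IsTrivialPairs S pw pφ w v φ) :
    ParentBRST.IsLocalGenAux (ParentBRST.parentS S)
      (ParentBRST.descParity n pw) (ParentBRST.descParity n pφ)
      (ParentBRST.descendant w) (ParentBRST.descendant v) (ParentBRST.descendant φ) := by
  obtain ⟨Θ, hΘ, hw, hφ⟩ := h
  have hΘw : ∀ a, Θ (coord _ (Sum.inr (Sum.inl a))) = w a := fun a => hΘ.map_coord _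
  have hΘv : ∀ a, Θ (coord _ (Sum.inr (Sum.inr (Sum.inl a)))) = v a := fun a => hΘ.map_coord _
  have hΘφ : ∀ i, Θ (coord _ (Sum.inr (Sum.inr (Sum.inr i)))) = φ i := fun i => hΘ.map_coord _
  have hΘx : ∀ μ, Θ (coord _ (Sum.inl μ)) = xCoord p μ := fun μ => hΘ.map_coord _
  -- The functions of the lowest components of the parent superfields are the local functions of the
  -- original theory, so `Θ` itself can be prolonged, although it need not respect total
  -- derivatives.
  obtain ⟨Φ, hΦ, hΦN, hΦr⟩ := (splitSuperfields n pw pφ).exists_prolong_fieldChange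
    (parentSuperfields n p) Θ hΘ.map_parityInv hΘx
  set P := splitSuperfields n pw pφ
  have hΦ2 : IsFieldChange (Sum.elim (descendant w) (Sum.elim (descendant v) (descendant φ))) Φ := by
    convert hΦ using 1
    funext b
    have hp := fun k N => (P.prolongField_equiv (parentSuperfields n p) Θ.toAlgHom k N).symm
    rcases b with ⟨a, N⟩ | ⟨a, N⟩ | ⟨i, N⟩
    · refine Eq.trans ?_ (hp (Sum.inl a) N)
      change thetaDs p N (bar p (w a)) =
        (1 : ℝ) ^ N.card • thetaDs p N (bar p (Θ (coord _ (Sum.inr (Sum.inl a)))))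
      rw [one_pow, one_smul, hΘw]
    · refine Eq.trans ?_ (hp (Sum.inr (Sum.inl a)) N)
      change thetaDs p N (bar p (v a)) =
        (1 : ℝ) ^ N.card • thetaDs p N (bar p (Θ (coord _ (Sum.inr (Sum.inr (Sum.inl a))))))
      rw [one_pow, one_smul, hΘv]
    · refine Eq.trans ?_ (hp (Sum.inr (Sum.inr i)) N)
      change thetaDs p N (bar p (φ i)) =
        (1 : ℝ) ^ N.card • thetaDs p N (bar p (Θ (coord _ (Sum.inr (Sum.inr (Sum.inr i))))))
      rw [one_pow, one_smul, hΘφ]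
  have hrank : ∀ k N, P.rank (P.equiv (k, N)) = N.card := P.rank_equiv
  -- `Φ.symm` preserves the rank filtration, so the error terms have lower rank in the descendants
  -- as well.
  have hlow : ∀ (N : Finset (Fin n)) (f : LocalFun n p),
      Φ.symm (evol (parentS S) (thetaDs p N (bar p f))) -
        (-1 : ℝ) ^ N.card • Φ.symm (thetaDs p N (bar p (evol S f))) ∈
        fieldsIn n _ fun b => P.rank b < N.card := fun N f => by
    have := hΦr _ _ (parent_thetaDs_bar hS.odd N f)
    rwa [map_sub, map_smul] at this
  -- The factor comes from moving `s^P` through the `N.card` odd derivatives. Corresponding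
  -- descendants of `w` and `v` have the same rank.
  refine isLocalGenAux_of_rank ⟨hasParity_parentS hS.odd, parent_nilpotent hS⟩ hΦ2 P.rank P.rank_lt
    (fun k => (hrank (Sum.inl k.1) k.2).trans (hrank (Sum.inr (Sum.inl k.1)) k.2).symm)
    (fun k => (-1) ^ k.2.card) (fun k => pow_ne_zero _ (by norm_num)) ?_ ?_
  · rintro ⟨a, N⟩
    have h1 := hlow N (w a)
    rw [hw a] at h1
    have h2 : Φ.symm (thetaDs p N (bar p (v a))) =
        jetCoord _ (Sum.inr (Sum.inl (a, N))) 0 := hΦ2.symm_apply (Sum.inr (Sum.inl (a, N)))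
    rw [h2] at h1
    exact fieldsIn_mono (fun b hb => hb.trans_eq (hrank (Sum.inl a) N).symm) h1
  · rintro ⟨i, N⟩
    obtain ⟨g, hg⟩ := hφ i
    have h1 := hlow N (φ i)
    have h2 : Φ.symm (thetaDs p N (bar p (evol S (φ i)))) =
        P.thetas N (P.bar (inclRest n pw pφ g)) := by
      rw [AlgEquiv.symm_apply_eq, hg]
      exact (hΦN N _).symm
    rw [h2] at h1
    -- The leading part is, up to sign, the descendant of `s φ^i`. As `s φ^i` involves only `x` and
    -- the `φ^j`, its descendant involves only the components of the `φ^j`.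
    refine ⟨_, ?_, fieldsIn_mono (fun b hb => hb.trans_eq
      (hrank (Sum.inr (Sum.inr i)) N).symm) h1⟩
    rw [← mem_fieldsIn_rest_iff]
    refine Subalgebra.smul_mem _ (fieldsIn_mono ?_ (P.thetas_bar_mem_fieldsIn_of_onlyIn
      (Q := Sum.elim (fun _ => False) (Sum.elim (fun _ => False) fun _ => True))
      (inclRest_mem_onlyIn g) N)) _
    rintro (k | k | k) hk
    · exact hk
    · exact hk
    · trivial
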